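/- Let $\mathcal X_1,\mathcal X_2,\mathcal Y,\mathcal Y_1,\mathcal Y_2$ be finite sets and let $p(y,y_1,y_2\mid x_1,x_2)$ be a discrete memoryless relay-eavesdropper channel: $x_1$ is the input of the source, $x_2$ the input of the relay, and $y,y_1,y_2$ are the outputs at the destination, the relay and the eavesdropper. An $(M,n)$ code ($M\ge 1$) consists of a stochastic encoder that maps a message $w_1\in\{1,\dots,M\}$ to a random codeword in $\mathcal X_1^n$; causal relay maps giving the relay input $x_{2,i}$ as a function of $(y_{1,1},\dots,y_{1,i-1})$ and of a private random seed of the relay, which takes finitely many values and is independent of the message and of the source's randomization; and a decoder $\phi:\mathcal Y^n\to\{1,\dots,M\}$. The message $W_1$ is uniform; $P_e^n=\frac1M\sum_{w_1}\Pr\{\phi(\mathbf Y)\ne w_1\mid w_1\text{ was sent}\}$ is the average error probability, and $\frac1nH(W_1\mid\mathbf Y_2)$ is the equivocation rate at the eavesdropper. Entropies and informations are in bits. A pair $(R_1,R_e)$ is achievable if for every $\epsilon>0$ there is $n(\epsilon)$ such that for every $n\ge n(\epsilon)$ there is an $(M,n)$ code with $$\Bigl|\tfrac1n\log_2M-R_1\Bigr|\le\epsilon,\qquad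 P_e^n\le\epsilon,\qquad \tfrac1nH(W_1\mid\mathbf Y_2)\ge R_e-\epsilon .$$ Theorem. Let $\mathcal R$ be the set of all pairs $(R_1,R_e)$ of real numbers with $R_1\ge0$ for which there are a finite set $\hat{\mathcal Y}_1$, a distribution $$p(x_1,x_2,y_1,y_2,y,\hat y_1)=p(x_1)\,p(x_2)\,p(y,y_1,y_2\mid x_1,x_2)\,p(\hat y_1\mid y_1,x_2)$$ and a real number $R_0\ge0$ such that $$\min\{I(X_2;Y),\,I(X_2;Y_2\mid X_1)\}-R_0\ \ge\ I(Y_1;\hat Y_1\mid X_2)$$ and $$R_1<I(X_1;\hat Y_1,Y\mid X_2),\qquad R_e<R_1,\qquad R_e<\bigl[R_0+I(X_1;\hat Y_1,Y\mid X_2)-I(X_1,X_2;Y_2)\bigr]^+,$$ where $[x]^+=\max\{0,x\}$. Then every pair in the closure of the convex hull of $\mathcal R$ is achievable. -/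

import Mathlib

noncomputable section

namespace RelayEavesdropper

/-! ### Finite probability and Shannon information (in bits) -/

/-- Probability distributions on a finite alphabet. -/
abbrev Dist (α : Type*) [Fintype α] := stdSimplex ℝ α

section Information

variable {Ω α β γ : Type*} [Fintype Ω] [Fintype α] [Fintype β] [Fintype γ]

open Classical in
/-- The probability mass function of the random variable `X` when outcomes have mass `P`. -/
def law (P : Ω → ℝ) (X : Ω → α) (a : α) : ℝ := ∑ ω, if X ω = a then P ω else 0

/-- Shannon entropy `H(X)`, in bits. -/
def entropy (P : Ω → ℝ) (X : Ω → α) : ℝ := (∑ a, Real.negMulLog (law P X a)) / Real.log 2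

/-- Conditional entropy `H(X | Y)`. -/
def condEntropy (P : Ω → ℝ) (X : Ω → α) (Y : Ω → β) : ℝ :=
  entropy P (fun ω => (X ω, Y ω)) - entropy P Y

/-- Mutual information `I(X ; Y) = H(X) - H(X | Y)`. -/
def mutualInfo (P : Ω → ℝ) (X : Ω → α) (Y : Ω → β) : ℝ :=
  entropy P X - condEntropy P X Y

/-- Conditional mutual information `I(X ; Y | Z) = H(X | Z) - H(X | Y, Z)`. -/
def condMutualInfo (P : Ω → ℝ) (X : Ω → α) (Y : Ω → β) (Z : Ω → γ) : ℝ :=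
  condEntropy P X Z - condEntropy P X (fun ω => (Y ω, Z ω))

end Information

/-! ### The relay-eavesdropper channel and its codes -/

/-- A discrete memoryless relay-eavesdropper channel: `W x₁ x₂ (y, y₁, y₂) = p(y, y₁, y₂ | x₁, x₂)`,
with source input `x₁`, relay input `x₂`, and outputs `y` at the destination, `y₁` at the relay,
`y₂` at the eavesdropper. -/
abbrev Channel (X₁ X₂ Y Y₁ Y₂ : Type*) [Fintype Y] [Fintype Y₁] [Fintype Y₂] :=
  X₁ → X₂ → Dist (Y × Y₁ × Y₂)

/-- An `(M, n)` code. The source encoder is stochastic. The relay encoder is causal, and may use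
private randomness: a seed drawn once from a finite set, independently of everything else. -/
structure Code (X₁ X₂ Y Y₁ : Type*) [Fintype X₁] (n : ℕ) where
  /-- the number of messages -/
  M : ℕ
  M_pos : 0 < M
  /-- the stochastic source encoder: message `w` is sent as `x` with probability `enc w x` -/
  enc : Fin M → Dist (Fin n → X₁)
  /-- the number of values of the relay's private seed -/
  seeds : ℕ
  /-- the law of the relay's private seed -/
  seedLaw : Dist (Fin seeds)
  /-- the relay input at time `i`, from the seed and the relay outputs received before time `i` -/
  relay : (i : Fin n) → Fin seeds → (Fin i → Y₁) → X₂
  /-- the decoder of the destination -/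
  dec : (Fin n → Y) → Fin M

section Codes

variable {X₁ X₂ Y Y₁ Y₂ : Type*} [Fintype X₁] [Fintype Y] [Fintype Y₁] [Fintype Y₂] {n : ℕ}

/-- The entries of a sequence before time `i`. -/
def before {α : Type*} (y : Fin n → α) (i : Fin n) : Fin i → α := fun j => y (j.castLE i.2.le)

namespace Code

/-- What happens in a transmission, apart from the choice of the message: the seed of the relay,
the source codeword and the channel outputs. -/
abbrev Event (c : Code X₁ X₂ Y Y₁ n) (Y₂ : Type*) :=
  Fin c.seeds × (Fin n → X₁) × (Fin n → Y × Y₁ × Y₂)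

/-- The probability of a transmission event given that message `w` was sent. -/
def probGiven (c : Code X₁ X₂ Y Y₁ n) (W : Channel X₁ X₂ Y Y₁ Y₂) (w : Fin c.M) :
    c.Event Y₂ → ℝ := fun ω =>
  c.seedLaw ω.1 * c.enc w ω.2.1 *
    ∏ i, W (ω.2.1 i) (c.relay i ω.1 (before (fun j => (ω.2.2 j).2.1) i)) (ω.2.2 i)

/-- The joint law of the uniformly distributed message and the transmission event. -/
def prob (c : Code X₁ X₂ Y Y₁ n) (W : Channel X₁ X₂ Y Y₁ Y₂) :
    Fin c.M × c.Event Y₂ → ℝ := fun ω => 1 / (c.M : ℝ) * c.probGiven W ω.1 ω.2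

/-- The average error probability. -/
def errorProb (c : Code X₁ X₂ Y Y₁ n) (W : Channel X₁ X₂ Y Y₁ Y₂) : ℝ :=
  ∑ w, 1 / (c.M : ℝ) *
    ∑ ω : c.Event Y₂, if c.dec (fun i => (ω.2.2 i).1) ≠ w then c.probGiven W w ω else 0

/-- The equivocation rate `H(W₁ | Y₂ⁿ) / n` at the eavesdropper. -/
def equivocationRate (c : Code X₁ X₂ Y Y₁ n) (W : Channel X₁ X₂ Y Y₁ Y₂) : ℝ :=
  1 / (n : ℝ) * condEntropy (c.prob W) (fun ω => ω.1) (fun ω i => (ω.2.2.2 i).2.2)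

end Code

/-- The rate-equivocation pair `(R₁, Rₑ)` is achievable. The rate is met up to `ε`, as `(log₂ M) / n`
takes only countably many values. -/
def Achievable (W : Channel X₁ X₂ Y Y₁ Y₂) (R₁ Rₑ : ℝ) : Prop :=
  ∀ ε > 0, ∃ N : ℕ, ∀ n ≥ N, ∃ c : Code X₁ X₂ Y Y₁ n,
    |1 / (n : ℝ) * Real.logb 2 c.M - R₁| ≤ ε ∧
    c.errorProb W ≤ ε ∧
    Rₑ - ε ≤ c.equivocationRate W

end Codes

/-! ### The compress-and-forward region -/

section Region

variable {X₁ X₂ Y Y₁ Y₂ V : Type*} [Fintype X₁] [Fintype X₂] [Fintype Y] [Fintype Y₁] [Fintype Y₂]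
  [Fintype V]

/-- Outcomes `(x₁, x₂, (y, y₁, y₂), ŷ₁)` of the single-letter experiment. -/
abbrev Letter (X₁ X₂ Y Y₁ Y₂ V : Type*) := X₁ × X₂ × (Y × Y₁ × Y₂) × V

/-- `p(x₁) p(x₂) p(y, y₁, y₂ | x₁, x₂) p(ŷ₁ | y₁, x₂)`. -/
def letterProb (W : Channel X₁ X₂ Y Y₁ Y₂) (p₁ : Dist X₁) (p₂ : Dist X₂) (q : Y₁ → X₂ → Dist V) :
    Letter X₁ X₂ Y Y₁ Y₂ V → ℝ :=
  fun (x₁, x₂, (y, y₁, y₂), v) => p₁ x₁ * p₂ x₂ * W x₁ x₂ (y, y₁, y₂) * q y₁ x₂ v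

namespace Letter

/-- the random variable `X₁` -/
def x₁ (ω : Letter X₁ X₂ Y Y₁ Y₂ V) : X₁ := ω.1

/-- the random variable `X₂` -/
def x₂ (ω : Letter X₁ X₂ Y Y₁ Y₂ V) : X₂ := ω.2.1

/-- the random variable `Y` -/
def y (ω : Letter X₁ X₂ Y Y₁ Y₂ V) : Y := ω.2.2.1.1

/-- the random variable `Y₁` -/
def y₁ (ω : Letter X₁ X₂ Y Y₁ Y₂ V) : Y₁ := ω.2.2.1.2.1

/-- the random variable `Y₂` -/
def y₂ (ω : Letter X₁ X₂ Y Y₁ Y₂ V) : Y₂ := ω.2.2.1.2.2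

/-- the random variable `Ŷ₁` -/
def yHat (ω : Letter X₁ X₂ Y Y₁ Y₂ V) : V := ω.2.2.2

end Letter

open Letter in
/-- The pairs `(R₁, Rₑ)` satisfying the inequalities of the region for a fixed law `P` of
`(X₁, X₂, Y, Y₁, Y₂, Ŷ₁)` and a fixed rate `R₀` of the noise generated by the relay. -/
def SatisfiesCF (P : Letter X₁ X₂ Y Y₁ Y₂ V → ℝ) (R₀ R₁ Rₑ : ℝ) : Prop :=
  min (mutualInfo P x₂ y) (condMutualInfo P x₂ y₂ x₁) - R₀ ≥ condMutualInfo P y₁ yHat x₂ ∧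
  R₁ < condMutualInfo P x₁ (fun ω => (yHat ω, y ω)) x₂ ∧
  Rₑ < R₁ ∧
  Rₑ < max 0 (R₀ + condMutualInfo P x₁ (fun ω => (yHat ω, y ω)) x₂
    - mutualInfo P (fun ω => (x₁ ω, x₂ ω)) y₂)

/-- The union of these pairs over all input laws, all finite alphabets of `Ŷ₁` (up to relabelling),
all test channels and all `R₀ ≥ 0`. -/
def cfRegion (W : Channel X₁ X₂ Y Y₁ Y₂) : Set (ℝ × ℝ) :=
  {r | 0 ≤ r.1 ∧ ∃ (p₁ : Dist X₁) (p₂ : Dist X₂) (k : ℕ) (q : Y₁ → X₂ → Dist (Fin k)) (R₀ : ℝ),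
    0 ≤ R₀ ∧ SatisfiesCF (letterProb W p₁ p₂ q) R₀ r.1 r.2}

end Region

end RelayEavesdropper

end

noncomputable section

namespace RelayEavesdropper

open scoped Classical

set_option linter.unusedSectionVars false

/-! ### Averages over finite distributions -/

section Average

variable {α β γ ι κ : Type*} [Fintype α] [Fintype β] [Fintype γ] [Fintype ι] [Fintype κ]

/-! The code is block-Markov compress-and-forward in which the relay also forwards noise. In each of
`B + 1` blocks of `m` letters the relay sends a codeword indexed by a pair: the compression index of
its observation in the preceding block, and a fresh uniform noise index of rate `R₀`. The
destination finds the pair of every block from its output in that block; the pair of the next block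
then gives it the compressed observation of the present one, and with that it decodes messages at
rates `ρ < I(X₁; Ŷ₁, Y | X₂)`. The pairs are decodable if `R₀ + I(Y₁; Ŷ₁ | X₂) < I(X₂; Y)`. The same
inequality with `I(X₂; Y₂ | X₁)` lets an eavesdropper who is told the message `U` find the noise
`L`. In `H(U | Y₂) = H(U) + H(L) - I(U, L; Y₂) - H(L | U, Y₂)` the last term is then negligible, and
the information term costs at most about `I(X₁, X₂; Y₂)` per letter, so the equivocation rate is
about `ρ + R₀ - I(X₁, X₂; Y₂)` (`le_markovCode_equiv`).

Typicality is replaced by likelihood-ratio tests. The relay chooses the description that minimises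
the probability that the source test fails given what it saw, so no Markov lemma is needed:
`avg_covering` bounds the minimum directly. Codebooks of different blocks are independent, hence the
codebook of a block is independent of the relay index sent in it (`avg_causal_compProd`), and errors
and leakage are summed block by block. A weighted sum of the two selects one codebook that is good
for both (`exists_gcode_of_reliable`).

To get `R₁ < ρ` with equivocation `min(R₁, E)`, messages become random bins of a longer code.
`exists_bin` loses the standard deviation of the posterior surprisal; `K²` independent repetitions
multiply it only by `K`, so the loss per letter vanishes (`BlockCodes.achievable`).

The region has a non-strict constraint while coding needs a strict one. `achievable_of_satisfiesCF`
recovers the margin by lowering `R₀`, by erasing `Ŷ₁` with small probability, or, if both are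
impossible, by dropping compression altogether. Time sharing gives convexity, and the tolerance `ε`
in the definition gives closedness. -/

theorem Dist.nonneg (p : Dist α) (a : α) : 0 ≤ p a := p.2.1 a

theorem Dist.sum_eq_one (p : Dist α) : ∑ a, p a = 1 := p.2.2

/-- A distribution from a nonnegative function of total mass one. -/
def Dist.mk (f : α → ℝ) (h₀ : ∀ a, 0 ≤ f a) (h₁ : ∑ a, f a = 1) : Dist α := ⟨f, h₀, h₁⟩

@[simp] theorem Dist.mk_apply (f : α → ℝ) (h₀ : ∀ a, 0 ≤ f a) (h₁ : ∑ a, f a = 1) (a : α) :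
    Dist.mk f h₀ h₁ a = f a := rfl

theorem Dist.ext {p q : Dist α} (h : ∀ a, p a = q a) : p = q := DFunLike.ext _ _ h

theorem Dist.nonempty (p : Dist α) : Nonempty α := by
  by_contra h
  have := (Dist.sum_eq_one p)
  rw [not_nonempty_iff] at h
  simp at this

/-- The average of `F` under `p`. -/
def avg (p : Dist α) (F : α → ℝ) : ℝ := ∑ a, p a * F a

/-- The indicator of a proposition. -/
def ind (P : Prop) : ℝ := if P then 1 else 0

theorem ind_true {P : Prop} (h : P) : ind P = 1 := if_pos h

theorem ind_false {P : Prop} (h : ¬P) : ind P = 0 := if_neg h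

theorem ind_nonneg (P : Prop) : 0 ≤ ind P := by unfold ind; split_ifs <;> norm_num

theorem ind_le_one (P : Prop) : ind P ≤ 1 := by unfold ind; split_ifs <;> norm_num

theorem ind_mono {P Q : Prop} (h : P → Q) : ind P ≤ ind Q := by
  by_cases hP : P
  · rw [ind_true hP, ind_true (h hP)]
  · rw [ind_false hP]; exact ind_nonneg _

theorem ind_congr {P Q : Prop} (h : P ↔ Q) : ind P = ind Q := by rw [propext h]

theorem ind_or_le (P Q : Prop) : ind (P ∨ Q) ≤ ind P + ind Q := by
  by_cases hP : P
  · rw [ind_true (Or.inl hP), ind_true hP]; linarith [ind_nonneg Q]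
  · by_cases hQ : Q
    · rw [ind_true (Or.inr hQ), ind_true hQ]; linarith [ind_nonneg P]
    · rw [ind_false (not_or.2 ⟨hP, hQ⟩)]; linarith [ind_nonneg P, ind_nonneg Q]

theorem ind_exists_le (P : ι → Prop) : ind (∃ i, P i) ≤ ∑ i, ind (P i) := by
  by_cases h : ∃ i, P i
  · obtain ⟨i, hi⟩ := h
    rw [ind_true ⟨i, hi⟩, ← ind_true hi]
    exact Finset.single_le_sum (f := fun i => ind (P i)) (fun j _ => ind_nonneg _)
      (Finset.mem_univ i)
  · rw [ind_false h]; exact Finset.sum_nonneg fun j _ => ind_nonneg _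

theorem avg_le_avg_of_pos (p : Dist α) {F G : α → ℝ} (h : ∀ a, 0 < p a → F a ≤ G a) :
    avg p F ≤ avg p G := by
  refine Finset.sum_le_sum fun a _ => ?_
  rcases (Dist.nonneg p a).eq_or_lt with h0 | h0
  · rw [← h0]; simp
  · exact mul_le_mul_of_nonneg_left (h a h0) h0.le

theorem avg_congr_of_pos (p : Dist α) {F G : α → ℝ} (h : ∀ a, 0 < p a → F a = G a) :
    avg p F = avg p G :=
  le_antisymm (avg_le_avg_of_pos p fun a ha => (h a ha).le)
    (avg_le_avg_of_pos p fun a ha => (h a ha).ge)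

theorem avg_le_avg (p : Dist α) {F G : α → ℝ} (h : ∀ a, F a ≤ G a) : avg p F ≤ avg p G :=
  avg_le_avg_of_pos p fun a _ => h a

theorem avg_const (p : Dist α) (c : ℝ) : avg p (fun _ => c) = c := by
  rw [avg, ← Finset.sum_mul, (Dist.sum_eq_one p), one_mul]

theorem avg_nonneg (p : Dist α) {F : α → ℝ} (h : ∀ a, 0 ≤ F a) : 0 ≤ avg p F :=
  Finset.sum_nonneg fun a _ => mul_nonneg ((Dist.nonneg p a)) (h a)

theorem avg_le_const (p : Dist α) {F : α → ℝ} {c : ℝ} (h : ∀ a, F a ≤ c) : avg p F ≤ c :=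
  (avg_le_avg p h).trans_eq (avg_const p c)

theorem avg_add (p : Dist α) (F G : α → ℝ) :
    avg p (fun a => F a + G a) = avg p F + avg p G := by
  simp only [avg, mul_add, Finset.sum_add_distrib]

theorem avg_sub (p : Dist α) (F G : α → ℝ) :
    avg p (fun a => F a - G a) = avg p F - avg p G := by
  simp only [avg, mul_sub, Finset.sum_sub_distrib]

theorem avg_neg (p : Dist α) (F : α → ℝ) : avg p (fun a => -F a) = -avg p F := by
  simp only [avg, mul_neg, Finset.sum_neg_distrib]

theorem avg_const_mul (p : Dist α) (c : ℝ) (F : α → ℝ) :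
    avg p (fun a => c * F a) = c * avg p F := by
  simp only [avg, Finset.mul_sum]; exact Finset.sum_congr rfl fun a _ => by ring

theorem avg_mul_const (p : Dist α) (c : ℝ) (F : α → ℝ) :
    avg p (fun a => F a * c) = avg p F * c := by
  simp only [avg, Finset.sum_mul]; exact Finset.sum_congr rfl fun a _ => by ring

theorem avg_sum {ι : Type*} (p : Dist α) (s : Finset ι) (F : ι → α → ℝ) :
    avg p (fun a => ∑ i ∈ s, F i a) = ∑ i ∈ s, avg p (F i) := by
  simp only [avg, Finset.mul_sum]; exact Finset.sum_comm

theorem avg_comm (p : Dist α) (q : Dist β) (F : α → β → ℝ) :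
    avg p (fun a => avg q (F a)) = avg q fun b => avg p fun a => F a b := by
  simp only [avg, Finset.mul_sum]
  rw [Finset.sum_comm]
  exact Finset.sum_congr rfl fun b _ => Finset.sum_congr rfl fun a _ => by ring

/-- The derandomisation step. Positive mass matters: the codewords of the selected codebook must lie
in the supports of the input laws for the density bounds to apply. -/
theorem exists_pos_le_avg (p : Dist α) (F : α → ℝ) : ∃ a, 0 < p a ∧ F a ≤ avg p F := by
  by_contra! h
  have h1 : avg p (fun _ => avg p F) < avg p F := by
    obtain ⟨a, ha⟩ : ∃ a, 0 < p a := by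
      by_contra! h0
      have := (Dist.sum_eq_one p)
      have h2 : ∑ a, p a ≤ 0 := Finset.sum_nonpos fun a _ => h0 a
      linarith
    refine Finset.sum_lt_sum (fun b _ => ?_)
      ⟨a, Finset.mem_univ a, mul_lt_mul_of_pos_left (h a ha) ha⟩
    rcases (Dist.nonneg p b).eq_or_lt with h0 | h0
    · rw [← h0, zero_mul, zero_mul]
    · exact mul_le_mul_of_nonneg_left (h b h0).le h0.le
  rw [avg_const] at h1
  exact lt_irrefl _ h1

theorem avg_pos {p : Dist α} {F : α → ℝ} (hF : ∀ b, 0 ≤ F b) {b : α}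
    (hp : 0 < p b) (hb : 0 < F b) : 0 < avg p F :=
  Finset.sum_pos' (fun b _ => mul_nonneg (Dist.nonneg p b) (hF b))
    ⟨b, Finset.mem_univ b, mul_pos hp hb⟩

/-- The product of two distributions. -/
def Dist.prod (p : Dist α) (q : Dist β) : Dist (α × β) :=
  Dist.mk (fun x => p x.1 * q x.2) (fun x => mul_nonneg ((Dist.nonneg p _)) ((Dist.nonneg q _))) (by
    rw [Fintype.sum_prod_type]
    simp only [← Finset.mul_sum, (Dist.sum_eq_one q), (Dist.sum_eq_one p), mul_one])

theorem avg_prod (p : Dist α) (q : Dist β) (F : α × β → ℝ) :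
    avg (Dist.prod p q) F = avg p fun a => avg q fun b => F (a, b) := by
  simp only [avg, Dist.prod, Dist.mk_apply, Fintype.sum_prod_type, Finset.mul_sum, mul_assoc]

/-- The point mass at `a`. -/
def Dist.point (a : α) : Dist α :=
  Dist.mk (fun b => ind (b = a)) (fun _ => ind_nonneg _) (by simp [ind])

theorem avg_point (a : α) (F : α → ℝ) : avg (Dist.point a) F = F a := by
  simp [avg, Dist.point, ind]

/-- The uniform distribution. -/
def Dist.unif (α : Type*) [Fintype α] [Nonempty α] : Dist α :=
  Dist.mk (fun _ => 1 / (Fintype.card α : ℝ)) (fun _ => by positivity) (by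
    have : (Fintype.card α : ℝ) ≠ 0 := by exact_mod_cast Fintype.card_ne_zero
    simp [this])

theorem avg_unif [Nonempty α] (F : α → ℝ) :
    avg (Dist.unif α) F = 1 / (Fintype.card α : ℝ) * ∑ a, F a := by
  simp [avg, Dist.unif, Finset.mul_sum]

/-- The distribution of `f a` when `a` has distribution `p`. -/
def Dist.map (p : Dist α) (f : α → β) : Dist β :=
  Dist.mk (fun b => avg p fun a => ind (f a = b)) (fun b => avg_nonneg p fun _ => ind_nonneg _) (by
    rw [← avg_sum]; simp [ind, avg_const])

theorem avg_map (p : Dist α) (f : α → β) (F : β → ℝ) :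
    avg (Dist.map p f) F = avg p fun a => F (f a) := by
  simp only [Dist.map, avg, Dist.mk_apply, Finset.sum_mul]
  rw [Finset.sum_comm]
  refine Finset.sum_congr rfl fun a _ => ?_
  simp [ind]

/-- The average of the kernel `q` under `p`. -/
def Dist.bind (p : Dist α) (q : α → Dist β) : Dist β :=
  Dist.mk (fun b => avg p fun a => q a b) (fun b => avg_nonneg p fun a => Dist.nonneg (q a) b) (by
    rw [← avg_sum]; simp [avg_const])

theorem avg_bind (p : Dist α) (q : α → Dist β) (F : β → ℝ) :
    avg (Dist.bind p q) F = avg p fun a => avg (q a) F := by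
  simp only [Dist.bind, avg, Dist.mk_apply, Finset.sum_mul, Finset.mul_sum]
  rw [Finset.sum_comm]
  exact Finset.sum_congr rfl fun a _ => Finset.sum_congr rfl fun b _ => by ring

end Average

/-! ### Product distributions -/

section Pi

variable {α ι κ : Type*} [Fintype α] [Fintype ι] [Fintype κ] [DecidableEq ι] [DecidableEq κ]

theorem sum_prod_pi {R : Type*} [CommSemiring R] (g : ι → α → R) :
    ∑ f : ι → α, ∏ i, g i (f i) = ∏ i, ∑ a, g i a := by
  rw [Finset.prod_univ_sum, Fintype.piFinset_univ]

/-- The product of the distributions `p i`. -/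
def Dist.pi (p : ι → Dist α) : Dist (ι → α) :=
  Dist.mk (fun f => ∏ i, p i (f i)) (fun f => Finset.prod_nonneg fun i _ => Dist.nonneg (p i) _) (by
    rw [sum_prod_pi fun i a => p i a]
    simp)

theorem Dist.pi_apply (p : ι → Dist α) (f : ι → α) : Dist.pi p f = ∏ i, p i (f i) := rfl

theorem Dist.pos_of_pi_pos {p : ι → Dist α} {f : ι → α} (h : 0 < Dist.pi p f) (i : ι) :
    0 < p i (f i) := by
  refine (Dist.nonneg (p i) _).lt_of_ne fun h0 => h.ne' ?_
  exact Finset.prod_eq_zero (Finset.mem_univ i) h0.symm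

theorem avg_pi_prod (p : ι → Dist α) (g : ι → α → ℝ) :
    avg (Dist.pi p) (fun f => ∏ i, g i (f i)) = ∏ i, avg (p i) (g i) := by
  simp only [avg, Dist.pi_apply, ← Finset.prod_mul_distrib]
  exact sum_prod_pi fun i a => p i a * g i a

/-- Source of all independence statements about codebooks: one codeword, two distinct codewords, or
the list attached to one relay input. It suffices to test on point masses, whose indicators factor
over the coordinates. -/
theorem avg_pi_comp (p : ι → Dist α) {g : κ → ι} (hg : Function.Injective g)
    (F : (κ → α) → ℝ) :
    avg (Dist.pi p) (fun f => F fun k => f (g k)) = avg (Dist.pi fun k => p (g k)) F := by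
  have key : ∀ h : κ → α, avg (Dist.pi p) (fun f => ind ((fun k => f (g k)) = h))
      = Dist.pi (fun k => p (g k)) h := by
    intro h
    -- Coordinates outside the range of `g` contribute the factor 1.
    have h1 : ∀ f : ι → α, ind ((fun k => f (g k)) = h)
        = ∏ i, (if hi : ∃ k, g k = i then ind (f i = h hi.choose) else 1) := by
      intro f
      by_cases hf : (fun k => f (g k)) = h
      · rw [ind_true hf, Finset.prod_eq_one]
        intro i _
        split_ifs with hi
        · rw [ind_true]
          rw [← hf]; simp [hi.choose_spec]
        · rfl
      · rw [ind_false hf]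
        obtain ⟨k, hk⟩ := Function.ne_iff.1 hf
        refine (Finset.prod_eq_zero (Finset.mem_univ (g k)) ?_).symm
        have hi : ∃ k', g k' = g k := ⟨k, rfl⟩
        rw [dif_pos hi, ind_false]
        rw [hg hi.choose_spec]; exact hk
    simp only [h1]
    rw [avg_pi_prod p (fun i a => if hi : ∃ k, g k = i then ind (a = h hi.choose) else 1),
      Dist.pi_apply]
    rw [← Finset.prod_subset (Finset.subset_univ (Finset.univ.image g)),
      Finset.prod_image (fun a _ b _ h => hg h)]
    · refine Finset.prod_congr rfl fun k _ => ?_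
      have hi : ∃ k', g k' = g k := ⟨k, rfl⟩
      simp only [dif_pos hi]
      rw [hg hi.choose_spec]
      simp [avg, ind]
    · intro i _ hi
      have : ¬∃ k, g k = i := by simpa using hi
      simp only [dif_neg this, avg_const]
  have h2 : ∀ f : ι → α, F (fun k => f (g k))
      = ∑ h : κ → α, ind ((fun k => f (g k)) = h) * F h := by
    intro f; simp [ind]
  simp only [h2]
  rw [avg_sum]
  simp only [avg_mul_const, key]
  rfl

theorem avg_pi_apply (p : ι → Dist α) (i : ι) (F : α → ℝ) :
    avg (Dist.pi p) (fun f => F (f i)) = avg (p i) F := by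
  have h := avg_pi_comp p (g := fun _ : Unit => i) (fun _ _ _ => rfl) (fun h => F (h ()))
  rw [h]
  simp only [avg, Dist.pi_apply]
  rw [← (Equiv.funUnique Unit α).symm.sum_comp]
  simp

theorem avg_pi_pair (p : ι → Dist α) {i j : ι} (hij : i ≠ j) (F : α → α → ℝ) :
    avg (Dist.pi p) (fun f => F (f i) (f j)) = avg (p i) fun a => avg (p j) fun b => F a b := by
  have hg : Function.Injective (fun k : Fin 2 => if k = 0 then i else j) := by
    intro a b; fin_cases a <;> fin_cases b <;> simp [hij, hij.symm]
  have h := avg_pi_comp p hg (fun h => F (h 0) (h 1))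
  simp only [if_true, Fin.isValue, one_ne_zero, if_false] at h
  rw [h]
  simp only [avg, Dist.pi_apply]
  rw [← (finTwoArrowEquiv α).symm.sum_comp, Fintype.sum_prod_type]
  refine Finset.sum_congr rfl fun a _ => ?_
  rw [Finset.mul_sum]
  refine Finset.sum_congr rfl fun b _ => ?_
  simp [Fin.prod_univ_two, mul_assoc]

end Pi

/-! ### Random coding for one block -/

section Packing

variable {S X O : Type*}

/-- Some element that satisfies `T`, if there is one. -/
def pick [Nonempty S] (T : S → Prop) : S := Classical.epsilon T

/-- A point where `g` is smallest. -/
def argmin [Nonempty S] (g : S → ℝ) : S := pick fun z => ∀ z', g z ≤ g z'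

theorem argmin_le [Nonempty S] [Finite S] (g : S → ℝ) (z : S) : g (argmin g) ≤ g z :=
  Classical.epsilon_spec (p := fun z => ∀ z', g z ≤ g z') (Finite.exists_min g) z

variable [Fintype S] [Fintype X] [Fintype O] [DecidableEq S]

/-- Any candidate that passes may be picked, so an error needs a miss of the true one or a false
acceptance of another. -/
theorem ind_pick_ne_le [Nonempty S] (T : S → Prop) (s : S) :
    ind (pick T ≠ s) ≤ ind (¬T s) + ∑ s' ∈ Finset.univ.erase s, ind (T s') := by
  have hsum : ∀ s' ≠ s, ind (T s') ≤ ∑ s' ∈ Finset.univ.erase s, ind (T s') := fun s' hs' =>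
    Finset.single_le_sum (f := fun s' => ind (T s')) (fun j _ => ind_nonneg _)
      (Finset.mem_erase.2 ⟨hs', Finset.mem_univ s'⟩)
  have hsum0 : 0 ≤ ∑ s' ∈ Finset.univ.erase s, ind (T s') :=
    Finset.sum_nonneg fun j _ => ind_nonneg _
  by_cases hT : T s
  · rw [ind_false (not_not.2 hT), zero_add]
    by_cases hs : pick T = s
    · rw [ind_false (not_not.2 hs)]; exact hsum0
    · refine le_trans ?_ (hsum _ hs)
      rw [ind_true hs, ind_true (show T (pick T) from Classical.epsilon_spec ⟨s, hT⟩)]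
  · rw [ind_true hT]; linarith [ind_le_one (pick T ≠ s)]

/-- The output depends on `f s` alone, so every other codeword is independent of it and is falsely
accepted with probability at most `ε`; the rest is a union bound. -/
theorem avg_packing [Nonempty S] (p : Dist X) (K : X → Dist O) (T : X → O → Prop) {ε : ℝ}
    (hT : ∀ o, avg p (fun x => ind (T x o)) ≤ ε) (s : S) :
    avg (Dist.pi fun _ : S => p)
        (fun f => avg (K (f s)) fun o => ind (pick (fun s' => T (f s') o) ≠ s))
      ≤ avg p (fun x => avg (K x) fun o => ind (¬T x o)) + (Fintype.card S - 1) * ε := by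
  have h1 : ∀ f : S → X, avg (K (f s)) (fun o => ind (pick (fun s' => T (f s') o) ≠ s))
      ≤ avg (K (f s)) (fun o => ind (¬T (f s) o))
        + ∑ s' ∈ Finset.univ.erase s, avg (K (f s)) (fun o => ind (T (f s') o)) := by
    intro f
    rw [← avg_sum, ← avg_add]
    exact avg_le_avg _ fun o => ind_pick_ne_le _ s
  refine (avg_le_avg _ h1).trans ?_
  rw [avg_add, avg_sum]
  refine add_le_add (avg_pi_apply (fun _ : S => p) s
    (fun x => avg (K x) fun o => ind (¬T x o))).le ?_
  have h2 : ∀ s' ∈ Finset.univ.erase s,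
      avg (Dist.pi fun _ : S => p) (fun f => avg (K (f s)) fun o => ind (T (f s') o)) ≤ ε := by
    intro s' hs'
    rw [avg_pi_pair (fun _ : S => p) (Finset.ne_of_mem_erase hs').symm
      (fun x x' => avg (K x) fun o => ind (T x' o))]
    refine avg_le_const _ fun x => ?_
    rw [avg_comm]
    exact avg_le_const _ hT
  refine (Finset.sum_le_card_nsmul _ _ _ h2).trans_eq ?_
  rw [Finset.card_erase_of_mem (Finset.mem_univ s), Finset.card_univ, nsmul_eq_mul,
    Nat.cast_sub Fintype.card_pos, Nat.cast_one]

end Packing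

/-! ### Codebooks, tests and decoders of one block. -/

section Block

variable {X₁ X₂ Y Y₁ Y₂ V α κ L : Type*} [Fintype X₁] [Fintype X₂] [Fintype Y] [Fintype Y₁]
  [Fintype Y₂] [Fintype V] [Fintype α] [Fintype κ] [Fintype L]

/-- The law of the relay's observation given its input. -/
def relayLaw (W : Channel X₁ X₂ Y Y₁ Y₂) (p₁ : Dist X₁) (x₂ : X₂) : Dist Y₁ :=
  Dist.map (Dist.bind p₁ fun x₁ => W x₁ x₂) fun o => o.2.1

theorem avg_relayLaw (W : Channel X₁ X₂ Y Y₁ Y₂) (p₁ : Dist X₁) (x₂ : X₂) (F : Y₁ → ℝ) :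
    avg (relayLaw W p₁ x₂) F = avg p₁ fun x₁ => avg (W x₁ x₂) fun o => F o.2.1 := by
  rw [relayLaw, avg_map, avg_bind]

/-- The law of the compressed observation given the relay input. -/
def compLaw (W : Channel X₁ X₂ Y Y₁ Y₂) (p₁ : Dist X₁) (q : Y₁ → X₂ → Dist V) (x₂ : X₂) :
    Dist V :=
  Dist.bind (relayLaw W p₁ x₂) fun y₁ => q y₁ x₂

/-- The joint-typicality tests used by the terminals. -/
structure Tests (X₁ X₂ Y Y₂ V : Type*) where
  /-- the destination's test of a relay codeword -/
  relayDest : X₂ → Y → Prop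
  /-- the destination's test of a source codeword -/
  source : X₁ → X₂ → V → Y → Prop
  /-- the eavesdropper's test of a relay codeword -/
  relayEve : X₁ → X₂ → Y₂ → Prop

/-- The codebook of one block: source codewords, relay codewords, and for each relay input a list
of compressed observations. -/
abbrev Book (α κ L X₁ X₂ V : Type*) := (α → X₁) × (κ × L → X₂) × (X₂ × κ → V)

namespace Tests

variable (T : Tests X₁ X₂ Y Y₂ V) (W : Channel X₁ X₂ Y Y₁ Y₂) (p₁ : Dist X₁)

/-- The probability that the relay observes `y₁` and the source test fails with `v`. -/
def score (x₂ : X₂) (y₁ : Y₁) (v : V) : ℝ :=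
  avg p₁ fun x₁ => avg (W x₁ x₂) fun o => ind (o.2.1 = y₁ ∧ ¬T.source x₁ x₂ v o.1)

/-- The compression index chosen by the relay. -/
def compress [Nonempty κ] (C : Book α κ L X₁ X₂ V) (x₂ : X₂) (y₁ : Y₁) : κ :=
  argmin fun z => T.score W p₁ x₂ y₁ (C.2.2 (x₂, z))

/-- The destination's decoder of the relay index. -/
def decRelay [Nonempty κ] [Nonempty L] (C : Book α κ L X₁ X₂ V) (y : Y) : κ × L :=
  pick fun s => T.relayDest (C.2.1 s) y

/-- The destination's decoder of the message. -/
def decSource [Nonempty α] (C : Book α κ L X₁ X₂ V) (y : Y) (s : κ × L) (z : κ) : α :=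
  pick fun u => T.source (C.1 u) (C.2.1 s) (C.2.2 (C.2.1 s, z)) y

/-- The relay index guessed by an eavesdropper who knows the message. -/
def decEve [Nonempty κ] [Nonempty L] (C : Book α κ L X₁ X₂ V) (u : α) (y₂ : Y₂) : κ × L :=
  pick fun s => T.relayEve (C.1 u) (C.2.1 s) y₂

/-- One of the decoders fails in a block. -/
def Fails [Nonempty α] [Nonempty κ] [Nonempty L] (C : Book α κ L X₁ X₂ V) (u : α) (s : κ × L)
    (o : Y × Y₁ × Y₂) : Prop :=
  T.decRelay C o.1 ≠ s ∨ T.decSource C o.1 s (T.compress W p₁ C (C.2.1 s) o.2.1) ≠ u ∨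
    T.decEve C u o.2.2 ≠ s

variable [DecidableEq X₂] [DecidableEq α] [DecidableEq κ] [DecidableEq L] (p₂ : Dist X₂)
  (q : Y₁ → X₂ → Dist V)

/-- The distribution of the random codebook of a block. -/
def bookLaw (α κ L : Type*) [Fintype α] [Fintype κ] [Fintype L] [DecidableEq α] [DecidableEq κ]
    [DecidableEq L] (W : Channel X₁ X₂ Y Y₁ Y₂) (p₁ : Dist X₁) (p₂ : Dist X₂)
    (q : Y₁ → X₂ → Dist V) : Dist (Book α κ L X₁ X₂ V) :=
  Dist.prod (Dist.pi fun _ => p₁)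
    (Dist.prod (Dist.pi fun _ => p₂) (Dist.pi fun i => compLaw W p₁ q i.1))

/-- All error probabilities relevant to a block are at most `δ`. -/
structure Reliable (α κ L : Type*) [Fintype α] [Fintype κ] [Fintype L] [DecidableEq κ]
    [Nonempty κ] (δ : ℝ) : Prop where
  relayDest_miss : avg p₁ (fun x₁ => avg p₂ fun x₂ => avg (W x₁ x₂) fun o =>
    ind (¬T.relayDest x₂ o.1)) ≤ δ
  relayDest_false : ∃ ε, (∀ y, avg p₂ (fun x₂ => ind (T.relayDest x₂ y)) ≤ ε) ∧
    (Fintype.card (κ × L) - 1) * ε ≤ δ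
  relayEve_miss : avg p₁ (fun x₁ => avg p₂ fun x₂ => avg (W x₁ x₂) fun o =>
    ind (¬T.relayEve x₁ x₂ o.2.2)) ≤ δ
  relayEve_false : ∃ ε, (∀ x₁ y₂, avg p₂ (fun x₂ => ind (T.relayEve x₁ x₂ y₂)) ≤ ε) ∧
    (Fintype.card (κ × L) - 1) * ε ≤ δ
  source_miss : avg p₂ (fun x₂ => ∑ y₁, avg (Dist.pi fun _ : κ => compLaw W p₁ q x₂) fun f =>
    T.score W p₁ x₂ y₁ (f (argmin fun z => T.score W p₁ x₂ y₁ (f z)))) ≤ δ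
  source_false : ∃ ε, (∀ x₂ v y, avg p₁ (fun x₁ => ind (T.source x₁ x₂ v y)) ≤ ε) ∧
    (Fintype.card α - 1) * ε ≤ δ

variable {T W p₁ p₂ q} [Nonempty α] [Nonempty κ] [Nonempty L]

/-- `avg_packing` for the relay codewords, with the source codeword fixed; one `δ` pays for a miss,
the other for false acceptances. -/
theorem avg_decRelay_ne_le {δ : ℝ} (h : T.Reliable W p₁ p₂ q α κ L δ) (u : α) (s : κ × L) :
    avg (bookLaw α κ L W p₁ p₂ q) (fun C => avg (W (C.1 u) (C.2.1 s)) fun o =>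
      ind (T.decRelay C o.1 ≠ s)) ≤ 2 * δ := by
  obtain ⟨ε, hε, hδ⟩ := h.relayDest_false
  simp only [bookLaw, avg_prod, decRelay, avg_const]
  rw [avg_pi_apply (fun _ : α => p₁) u (fun x₁ => avg (Dist.pi fun _ : κ × L => p₂) fun f =>
    avg (W x₁ (f s)) fun o => ind (pick (fun s' => T.relayDest (f s') o.1) ≠ s))]
  refine (avg_le_avg _ fun x₁ => avg_packing p₂ (W x₁) (fun x₂ o => T.relayDest x₂ o.1)
    (fun o => hε o.1) s).trans ?_
  rw [avg_add, avg_const]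
  linarith [h.relayDest_miss]

theorem avg_decEve_ne_le {δ : ℝ} (h : T.Reliable W p₁ p₂ q α κ L δ) (u : α) (s : κ × L) :
    avg (bookLaw α κ L W p₁ p₂ q) (fun C => avg (W (C.1 u) (C.2.1 s)) fun o =>
      ind (T.decEve C u o.2.2 ≠ s)) ≤ 2 * δ := by
  obtain ⟨ε, hε, hδ⟩ := h.relayEve_false
  simp only [bookLaw, avg_prod, decEve, avg_const]
  rw [avg_pi_apply (fun _ : α => p₁) u (fun x₁ => avg (Dist.pi fun _ : κ × L => p₂) fun f =>
    avg (W x₁ (f s)) fun o => ind (pick (fun s' => T.relayEve x₁ (f s') o.2.2) ≠ s))]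
  refine (avg_le_avg _ fun x₁ => avg_packing p₂ (W x₁) (fun x₂ o => T.relayEve x₁ x₂ o.2.2)
    (fun o => hε x₁ o.2.2) s).trans ?_
  rw [avg_add, avg_const]
  linarith [h.relayEve_miss]

/-- With the relay books fixed, the description chosen by the relay is a function of the output
alone, so the source test is a test of the output and `avg_packing` applies to the source codewords.
The probability of a miss is the sum over `y₁` of the minimal scores. -/
theorem avg_decSource_ne_le {δ : ℝ} (h : T.Reliable W p₁ p₂ q α κ L δ) (u : α) (s : κ × L) :
    avg (bookLaw α κ L W p₁ p₂ q) (fun C => avg (W (C.1 u) (C.2.1 s)) fun o =>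
      ind (T.decSource C o.1 s (T.compress W p₁ C (C.2.1 s) o.2.1) ≠ u)) ≤ 2 * δ := by
  obtain ⟨ε, hε, hδ⟩ := h.source_false
  rw [bookLaw, avg_prod, avg_comm]
  simp only [decSource, compress]
  have h1 : ∀ b : (κ × L → X₂) × (X₂ × κ → V), avg (Dist.pi fun _ : α => p₁) (fun a =>
      avg (W (a u) (b.1 s)) fun o => ind (pick (fun u => T.source (a u) (b.1 s)
        (b.2 (b.1 s, argmin fun z => T.score W p₁ (b.1 s) o.2.1 (b.2 (b.1 s, z)))) o.1) ≠ u))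
      ≤ (∑ y₁, T.score W p₁ (b.1 s) y₁
          (b.2 (b.1 s, argmin fun z => T.score W p₁ (b.1 s) y₁ (b.2 (b.1 s, z))))) + δ := by
    intro b
    refine (avg_packing p₁ (fun x₁ => W x₁ (b.1 s)) (fun x₁ o => T.source x₁ (b.1 s)
      (b.2 (b.1 s, argmin fun z => T.score W p₁ (b.1 s) o.2.1 (b.2 (b.1 s, z)))) o.1)
      (fun o => hε _ _ _) u).trans (add_le_add (le_of_eq ?_) hδ)
    simp only [score]
    rw [← avg_sum]
    congr 1; funext x₁
    rw [← avg_sum]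
    congr 1; funext o
    -- Only the observation that really occurred contributes to the sum of scores.
    rw [Finset.sum_eq_single o.2.1]
    · exact ind_congr (by simp)
    · intro y₁ _ hy; exact ind_false fun h => hy h.1.symm
    · simp
  have h2 := avg_le_avg (Dist.prod (Dist.pi fun _ : κ × L => p₂)
    (Dist.pi fun i : X₂ × κ => compLaw W p₁ q i.1)) h1
  refine h2.trans ?_
  rw [avg_prod]
  simp only [avg_add, avg_const]
  rw [avg_pi_apply (fun _ : κ × L => p₂) s (fun x₂ =>
    avg (Dist.pi fun i : X₂ × κ => compLaw W p₁ q i.1) fun f => ∑ y₁, T.score W p₁ x₂ y₁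
          (f (x₂, argmin fun z => T.score W p₁ x₂ y₁ (f (x₂, z)))))]
  -- Of all lists of descriptions only the one attached to the relay input sent is consulted; its
  -- entries are i.i.d.
  have h3 : ∀ x₂, avg (Dist.pi fun i : X₂ × κ => compLaw W p₁ q i.1) (fun f =>
      ∑ y₁, T.score W p₁ x₂ y₁ (f (x₂, argmin fun z => T.score W p₁ x₂ y₁ (f (x₂, z)))))
      = ∑ y₁, avg (Dist.pi fun _ : κ => compLaw W p₁ q x₂) fun f =>
        T.score W p₁ x₂ y₁ (f (argmin fun z => T.score W p₁ x₂ y₁ (f z))) := by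
    intro x₂
    rw [avg_sum]
    refine Finset.sum_congr rfl fun y₁ _ => ?_
    exact avg_pi_comp (fun i : X₂ × κ => compLaw W p₁ q i.1) (g := fun z : κ => (x₂, z))
      (fun a b hab => (Prod.mk.inj hab).2)
      (fun f => T.score W p₁ x₂ y₁ (f (argmin fun z => T.score W p₁ x₂ y₁ (f z))))
  simp only [h3]
  linarith [h.source_miss]

theorem avg_fails_le {δ : ℝ} (h : T.Reliable W p₁ p₂ q α κ L δ) (u : α) (s : κ × L) :
    avg (bookLaw α κ L W p₁ p₂ q) (fun C => avg (W (C.1 u) (C.2.1 s)) fun o =>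
      ind (T.Fails W p₁ C u s o)) ≤ 6 * δ := by
  have h1 : ∀ C : Book α κ L X₁ X₂ V, avg (W (C.1 u) (C.2.1 s)) (fun o =>
      ind (T.Fails W p₁ C u s o)) ≤ avg (W (C.1 u) (C.2.1 s)) (fun o =>
      ind (T.decRelay C o.1 ≠ s)) + (avg (W (C.1 u) (C.2.1 s)) (fun o =>
      ind (T.decSource C o.1 s (T.compress W p₁ C (C.2.1 s) o.2.1) ≠ u)) +
      avg (W (C.1 u) (C.2.1 s)) fun o => ind (T.decEve C u o.2.2 ≠ s)) := by
    intro C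
    rw [← avg_add, ← avg_add]
    refine avg_le_avg _ fun o => (ind_or_le _ _).trans ?_
    linarith [ind_or_le (T.decSource C o.1 s (T.compress W p₁ C (C.2.1 s) o.2.1) ≠ u)
      (T.decEve C u o.2.2 ≠ s)]
  refine (avg_le_avg _ h1).trans ?_
  rw [avg_add, avg_add]
  linarith [avg_decRelay_ne_le h u s, avg_decEve_ne_le h u s, avg_decSource_ne_le h u s]

theorem avg_bookLaw_words (u : α) (s : κ × L) (F : X₁ → X₂ → ℝ) :
    avg (bookLaw α κ L W p₁ p₂ q) (fun C => F (C.1 u) (C.2.1 s))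
      = avg p₁ fun x₁ => avg p₂ fun x₂ => F x₁ x₂ := by
  simp only [bookLaw, avg_prod, avg_const]
  rw [avg_pi_apply (fun _ : α => p₁) u (fun x₁ => avg (Dist.pi fun _ : κ × L => p₂) fun f =>
    F x₁ (f s))]
  congr 1; funext x₁
  exact avg_pi_apply (fun _ : κ × L => p₂) s (F x₁)

end Tests

/-! ### Covering -/

/-- With `c = k e^{-τ}` the left side is at most `e^{-cb}`, and convexity of `exp` interpolates in
`b` between the values 1 and `e^{-c}`. -/
theorem one_sub_pow_le {a b τ : ℝ} {k : ℕ} (ha' : a ≤ 1) (hb : b ≤ 1) (hb0 : 0 ≤ b)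
    (hab : Real.exp (-τ) * b ≤ a) :
    (1 - a) ^ k ≤ 1 - b + Real.exp (-(k * Real.exp (-τ))) := by
  set c := (k : ℝ) * Real.exp (-τ) with hc
  have hc0 : 0 ≤ c := by positivity
  have h1 : (1 - a) ^ k ≤ Real.exp (-(c * b)) := by
    have h2 : 1 - a ≤ Real.exp (-a) := by linarith [Real.add_one_le_exp (-a)]
    calc (1 - a) ^ k ≤ Real.exp (-a) ^ k := pow_le_pow_left₀ (by linarith) h2 k
      _ = Real.exp (k * (-a)) := (Real.exp_nat_mul _ k).symm
      _ ≤ _ := by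
        apply Real.exp_le_exp.2
        have : (k : ℝ) * (Real.exp (-τ) * b) ≤ k * a :=
          mul_le_mul_of_nonneg_left hab (by positivity)
        rw [hc]; nlinarith
  have h3 := convexOn_exp.2 (Set.mem_univ (0 : ℝ)) (Set.mem_univ (-c)) (sub_nonneg.2 hb) hb0
    (sub_add_cancel 1 b)
  simp only [smul_eq_mul, mul_zero, zero_add, Real.exp_zero, mul_one] at h3
  have h4 : b * Real.exp (-c) ≤ Real.exp (-c) := by
    have := Real.exp_pos (-c); nlinarith
  calc _ ≤ Real.exp (-(c * b)) := h1
    _ = Real.exp (b * -c) := by ring_nf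
    _ ≤ _ := by linarith

/-- Covering in terms of the cost `g` itself. Call `v` good if its cost is at most `η a` and its
density under `r` relative to `Q` is at most `e^τ`. The minimum over the list exceeds `η a` only if
no entry is good, and `|κ|` draws from `Q` hit a set of `r`-probability near 1 once `|κ|` is well
above `e^τ`. In the application `a` is the probability of the relay's observation, so that the
bounds can be summed over observations. -/
theorem avg_covering [Nonempty κ] [DecidableEq κ] (a : ℝ) (r Q : Dist V) (g : V → ℝ)
    (hg1 : ∀ v, g v ≤ a) (ha : 0 ≤ a) {η τ : ℝ} (hη : 0 < η) (hg0 : ∀ v, 0 ≤ g v) :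
    avg (Dist.pi fun _ : κ => Q) (fun f => g (f (argmin fun z => g (f z))))
      ≤ a * (η + Real.exp (-(Fintype.card κ * Real.exp (-τ)))) + avg r g / η
        + a * avg r (fun v => ind (Real.exp τ * Q v < r v)) := by
  set G : V → Prop := fun v => g v ≤ η * a ∧ r v ≤ Real.exp τ * Q v with hG
  set b := avg r (fun v => ind (G v)) with hb
  set A := avg Q (fun v => ind (G v)) with hA
  have hpt : ∀ f : κ → V, g (f (argmin fun z => g (f z)))
      ≤ η * a + a * ∏ z, ind (¬G (f z)) := by
    intro f
    by_cases h : ∃ z, G (f z)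
    · obtain ⟨z, hz⟩ := h
      have h1 := argmin_le (fun z => g (f z)) z
      have h2 : 0 ≤ a * ∏ z, ind (¬G (f z)) :=
        mul_nonneg ha (Finset.prod_nonneg fun z _ => ind_nonneg _)
      linarith [hz.1]
    · push Not at h
      rw [Finset.prod_eq_one fun z _ => ind_true (h z)]
      have := hg1 (f (argmin fun z => g (f z)))
      have : 0 ≤ η * a := by positivity
      linarith
  refine (avg_le_avg _ hpt).trans ?_
  rw [avg_add, avg_const, avg_const_mul, avg_pi_prod (fun _ : κ => Q) (fun _ v => ind (¬G v))]
  have hneg : ∀ p : Dist V, avg p (fun v => ind (¬G v)) = 1 - avg p (fun v => ind (G v)) := by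
    intro p
    rw [← avg_const p 1, ← avg_sub]
    congr 1; funext v
    by_cases h : G v
    · rw [ind_false (not_not.2 h), ind_true h, sub_self]
    · rw [ind_true h, ind_false h, sub_zero]
  rw [hneg, Finset.prod_const, Finset.card_univ]
  -- Change of measure from `r` to `Q` on the good set.
  have hAb : Real.exp (-τ) * b ≤ A := by
    rw [hb, hA, avg, avg, Finset.mul_sum]
    refine Finset.sum_le_sum fun v _ => ?_
    by_cases h : G v
    · rw [ind_true h, mul_one, mul_one, Real.exp_neg, inv_mul_le_iff₀ (Real.exp_pos τ)]
      exact h.2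
    · rw [ind_false h]; simp
  have h5 := one_sub_pow_le (k := Fintype.card κ)
    (avg_le_const Q fun v => ind_le_one (G v)) (avg_le_const r fun v => ind_le_one (G v))
    (avg_nonneg r fun v => ind_nonneg (G v)) hAb
  -- Markov's inequality for `g` under `r`; the factor `a` cancels the one in the threshold `η a`.
  have h6 : a * (1 - b) ≤ avg r g / η + a * avg r (fun v => ind (Real.exp τ * Q v < r v)) := by
    rw [hb, ← hneg, ← avg_const_mul, ← avg_const_mul, div_eq_mul_inv, ← avg_mul_const, ← avg_add]
    refine avg_le_avg _ fun v => ?_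
    have h7 : 0 ≤ g v * η⁻¹ := mul_nonneg (hg0 v) (by positivity)
    have h8 : 0 ≤ a * ind (Real.exp τ * Q v < r v) := mul_nonneg ha (ind_nonneg _)
    by_cases h : G v
    · rw [ind_false (not_not.2 h)]; linarith
    · rw [ind_true h]
      by_cases h1 : r v ≤ Real.exp τ * Q v
      · have h2 : ¬g v ≤ η * a := fun h2 => h ⟨h2, h1⟩
        have : a ≤ g v * η⁻¹ := by
          rw [← div_eq_mul_inv, le_div_iff₀ hη]; linarith
        linarith
      · rw [ind_true (not_le.1 h1)]; linarith
  have h9 := mul_le_mul_of_nonneg_left h5 ha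
  rw [← hA, ← hb] at h9
  linarith

variable {T : Tests X₁ X₂ Y Y₂ V} {W : Channel X₁ X₂ Y Y₁ Y₂} {p₁ : Dist X₁} {p₂ : Dist X₂}
  {q : Y₁ → X₂ → Dist V}

theorem Tests.score_nonneg (x₂ : X₂) (y₁ : Y₁) (v : V) : 0 ≤ T.score W p₁ x₂ y₁ v :=
  avg_nonneg _ fun _ => avg_nonneg _ fun _ => ind_nonneg _

theorem relayLaw_apply (x₂ : X₂) (y₁ : Y₁) : relayLaw W p₁ x₂ y₁
    = avg p₁ fun x₁ => avg (W x₁ x₂) fun o => ind (o.2.1 = y₁) := by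
  simp only [relayLaw, Dist.map, Dist.mk_apply, avg_bind]

theorem Tests.score_le (x₂ : X₂) (y₁ : Y₁) (v : V) :
    T.score W p₁ x₂ y₁ v ≤ relayLaw W p₁ x₂ y₁ := by
  rw [relayLaw_apply]
  exact avg_le_avg _ fun _ => avg_le_avg _ fun _ => ind_mono And.left

/-- Sum `avg_covering` over `y₁`, with the masses of `relayLaw` as `a`. The mean cost under `q y₁
x₂` then becomes the failure probability of the source test when `Ŷ₁` really comes from the test
channel, which the law of large numbers controls. -/
theorem Tests.source_miss_le [Nonempty κ] [DecidableEq κ] {η τ : ℝ} (hη : 0 < η) :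
    avg p₂ (fun x₂ => ∑ y₁, avg (Dist.pi fun _ : κ => compLaw W p₁ q x₂) fun f =>
      T.score W p₁ x₂ y₁ (f (argmin fun z => T.score W p₁ x₂ y₁ (f z))))
      ≤ η + Real.exp (-(Fintype.card κ * Real.exp (-τ)))
        + avg p₁ (fun x₁ => avg p₂ fun x₂ => avg (W x₁ x₂) fun o => avg (q o.2.1 x₂) fun v =>
            ind (¬T.source x₁ x₂ v o.1)) / η
        + avg p₁ (fun x₁ => avg p₂ fun x₂ => avg (W x₁ x₂) fun o => avg (q o.2.1 x₂) fun v =>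
            ind (Real.exp τ * compLaw W p₁ q x₂ v < q o.2.1 x₂ v)) := by
  have h1 : ∀ x₂, ∑ y₁, avg (Dist.pi fun _ : κ => compLaw W p₁ q x₂) (fun f =>
      T.score W p₁ x₂ y₁ (f (argmin fun z => T.score W p₁ x₂ y₁ (f z))))
      ≤ (η + Real.exp (-(Fintype.card κ * Real.exp (-τ))))
        + avg p₁ (fun x₁ => avg (W x₁ x₂) fun o => avg (q o.2.1 x₂) fun v =>
            ind (¬T.source x₁ x₂ v o.1)) / η
        + avg p₁ (fun x₁ => avg (W x₁ x₂) fun o => avg (q o.2.1 x₂) fun v =>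
            ind (Real.exp τ * compLaw W p₁ q x₂ v < q o.2.1 x₂ v)) := by
    intro x₂
    refine (Finset.sum_le_sum fun y₁ _ => avg_covering (relayLaw W p₁ x₂ y₁) (q y₁ x₂)
      (compLaw W p₁ q x₂) _ (T.score_le x₂ y₁) (Dist.nonneg _ _) (τ := τ) hη
      (T.score_nonneg x₂ y₁)).trans (le_of_eq ?_)
    rw [Finset.sum_add_distrib, Finset.sum_add_distrib, ← Finset.sum_mul, Dist.sum_eq_one, one_mul,
      ← Finset.sum_div]
    congr 1
    · congr 2
      calc ∑ y₁, avg (q y₁ x₂) (fun v => avg p₁ fun x₁ => avg (W x₁ x₂) fun o =>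
            ind (o.2.1 = y₁ ∧ ¬T.source x₁ x₂ v o.1))
          = ∑ y₁, avg p₁ (fun x₁ => avg (W x₁ x₂) fun o => avg (q y₁ x₂) fun v =>
            ind (o.2.1 = y₁ ∧ ¬T.source x₁ x₂ v o.1)) := by
            refine Finset.sum_congr rfl fun y₁ _ => ?_
            rw [avg_comm]
            congr 1; funext x₁
            rw [avg_comm]
        _ = _ := by
            rw [← avg_sum]
            congr 1; funext x₁
            rw [← avg_sum]
            congr 1; funext o
            rw [Finset.sum_eq_single o.2.1]
            · congr 1; funext v; exact ind_congr (by simp)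
            · intro y₁ _ hy
              rw [← avg_const (q y₁ x₂) 0]
              congr 1; funext v; exact ind_false fun h => hy h.1.symm
            · simp
    · exact avg_relayLaw W p₁ x₂ fun y₁ => avg (q y₁ x₂) fun v =>
        ind (Real.exp τ * compLaw W p₁ q x₂ v < q y₁ x₂ v)
  refine (avg_le_avg _ h1).trans (le_of_eq ?_)
  rw [avg_add, avg_add, avg_const]
  congr 1
  · congr 1
    simp only [div_eq_mul_inv]
    rw [avg_mul_const, avg_comm]
  · rw [avg_comm]

end Block

/-! ### Causally generated sequences -/

section Causal

variable {Θ Θ' : Type*} [Fintype Θ] [Fintype Θ']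

theorem sum_snoc {n : ℕ} {M : Type*} [AddCommMonoid M] (F : (Fin (n + 1) → Θ) → M) :
    ∑ θ, F θ = ∑ θ : Fin n → Θ, ∑ a, F (Fin.snoc θ a) := by
  rw [← (Fin.snocEquiv fun _ : Fin (n + 1) => Θ).sum_comp, Fintype.sum_prod_type_right]
  rfl

theorem before_snoc_castSucc {n : ℕ} (θ : Fin n → Θ) (a : Θ) (i : Fin n) :
    before (Fin.snoc θ a : Fin (n + 1) → Θ) i.castSucc = before θ i := by
  funext j
  exact Fin.snoc_castSucc (α := fun _ => Θ) a θ (j.castLE i.2.le)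

theorem before_snoc_last {n : ℕ} (θ : Fin n → Θ) (a : Θ) :
    before (Fin.snoc θ a : Fin (n + 1) → Θ) (Fin.last n) = θ := by
  funext j
  exact Fin.snoc_castSucc (α := fun _ => Θ) a θ j

/-- The weight of a sequence generated by causal kernels. -/
def causalWeight {n : ℕ} (k : (i : Fin n) → (Fin i → Θ) → Θ → ℝ) (θ : Fin n → Θ) : ℝ :=
  ∏ i, k i (before θ i) (θ i)

theorem causalWeight_snoc {n : ℕ} (k : (i : Fin (n + 1)) → (Fin i → Θ) → Θ → ℝ)
    (θ : Fin n → Θ) (a : Θ) : causalWeight k (Fin.snoc θ a)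
      = causalWeight (fun i => k i.castSucc) θ * k (Fin.last n) θ a := by
  rw [causalWeight, Fin.prod_univ_castSucc, before_snoc_last, Fin.snoc_last]
  congr 1
  refine Finset.prod_congr rfl fun i _ => ?_
  rw [before_snoc_castSucc, Fin.snoc_castSucc]

/-- Sum out the last coordinate first: its kernel is the only factor that sees it. -/
theorem sum_causalWeight_le {n : ℕ} (k : (i : Fin n) → (Fin i → Θ) → Θ → ℝ) (c : Fin n → ℝ)
    (hk : ∀ i h a, 0 ≤ k i h a) (hc : ∀ i h, ∑ a, k i h a ≤ c i) (hc0 : ∀ i, 0 ≤ c i) :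
    ∑ θ, causalWeight k θ ≤ ∏ i, c i := by
  induction n with
  | zero => simp [causalWeight]
  | succ n ih =>
    rw [sum_snoc, Fin.prod_univ_castSucc]
    calc _ ≤ ∑ θ : Fin n → Θ, causalWeight (fun i => k i.castSucc) θ * c (Fin.last n) := by
          refine Finset.sum_le_sum fun _ _ => ?_
          simp only [causalWeight_snoc, ← Finset.mul_sum]
          exact mul_le_mul_of_nonneg_left (hc _ _) (Finset.prod_nonneg fun i _ => hk _ _ _)
      _ ≤ _ := by
          rw [← Finset.sum_mul]
          exact mul_le_mul_of_nonneg_right (ih _ _ (fun i => hk i.castSucc)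
            (fun i => hc i.castSucc) fun i => hc0 i.castSucc) (hc0 _)

theorem sum_causalWeight_dist {n : ℕ} (k : (i : Fin n) → (Fin i → Θ) → Dist Θ) :
    ∑ θ, causalWeight (fun i h => k i h) θ = 1 := by
  induction n with
  | zero => simp [causalWeight]
  | succ n ih =>
    rw [sum_snoc]
    simp only [causalWeight_snoc, ← Finset.mul_sum, Dist.sum_eq_one, mul_one]
    exact ih fun i => k i.castSucc

/-- The law of a sequence generated by causal kernels. -/
def Dist.causal {n : ℕ} (k : (i : Fin n) → (Fin i → Θ) → Dist Θ) : Dist (Fin n → Θ) :=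
  Dist.mk (causalWeight fun i h => k i h)
    (fun _ => Finset.prod_nonneg fun i _ => Dist.nonneg (k i _) _) (sum_causalWeight_dist k)

/-- Block-by-block accounting: a bound that holds conditionally on every past may be summed,
whatever the dependence between blocks. -/
theorem avg_causal_sum_le {n : ℕ} (k : (i : Fin n) → (Fin i → Θ) → Dist Θ)
    (f : (i : Fin n) → (Fin i → Θ) → Θ → ℝ) (c : Fin n → ℝ)
    (h : ∀ i g, avg (k i g) (f i g) ≤ c i) :
    avg (Dist.causal k) (fun θ => ∑ i, f i (before θ i) (θ i)) ≤ ∑ i, c i := by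
  induction n with
  | zero => simp [avg]
  | succ n ih =>
    have hsplit : ∀ (θ : Fin n → Θ) (a : Θ), Dist.causal k (Fin.snoc θ a)
        = Dist.causal (fun i => k i.castSucc) θ * k (Fin.last n) θ a := fun θ a =>
      causalWeight_snoc (fun i h => k i h) θ a
    have hsum : ∀ (θ : Fin n → Θ) (a : Θ), ∑ i, f i (before (Fin.snoc θ a : Fin (n + 1) → Θ) i)
        ((Fin.snoc θ a : Fin (n + 1) → Θ) i)
        = (∑ i, f (Fin.castSucc i) (before θ i) (θ i)) + f (Fin.last n) θ a := by
      intro θ a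
      rw [Fin.sum_univ_castSucc, before_snoc_last, Fin.snoc_last]
      congr 1
      refine Finset.sum_congr rfl fun i _ => ?_
      rw [before_snoc_castSucc, Fin.snoc_castSucc]
    rw [Fin.sum_univ_castSucc]
    calc avg (Dist.causal k) (fun θ => ∑ i, f i (before θ i) (θ i))
        = avg (Dist.causal fun i => k i.castSucc) (fun θ => avg (k (Fin.last n) θ) fun a =>
            (∑ i, f (Fin.castSucc i) (before θ i) (θ i)) + f (Fin.last n) θ a) := by
          rw [avg, sum_snoc]
          simp only [hsplit, hsum, avg, Finset.mul_sum, mul_assoc]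
      _ ≤ avg (Dist.causal fun i => k i.castSucc) (fun θ =>
            (∑ i, f (Fin.castSucc i) (before θ i) (θ i)) + c (Fin.last n)) := by
          refine avg_le_avg _ fun θ => ?_
          rw [avg_add, avg_const]
          linarith [h (Fin.last n) θ]
      _ ≤ _ := by
          rw [avg_add, avg_const]
          linarith [ih (fun i => k i.castSucc) (fun i => f i.castSucc) (fun i => c i.castSucc)
            fun i => h i.castSucc]

/-- The joint law of `a` with law `p` and of `b` with law `q a`. -/
def Dist.compProd {α β : Type*} [Fintype α] [Fintype β] (p : Dist α) (q : α → Dist β) :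
    Dist (α × β) :=
  Dist.mk (fun x => p x.1 * q x.1 x.2)
    (fun x => mul_nonneg (Dist.nonneg p _) (Dist.nonneg (q _) _)) (by
      rw [Fintype.sum_prod_type]
      simp only [← Finset.mul_sum, Dist.sum_eq_one, mul_one])

theorem avg_compProd {α β : Type*} [Fintype α] [Fintype β] (p : Dist α) (q : α → Dist β)
    (F : α × β → ℝ) : avg (Dist.compProd p q) F = avg p fun a => avg (q a) fun b => F (a, b) := by
  simp only [avg, Dist.compProd, Dist.mk_apply, Fintype.sum_prod_type, Finset.mul_sum, mul_assoc]

/-- Deferred choice of codebooks: since `p` ignores the past, drawing the `i`-th codebook at time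
`i` or all of them in advance gives the same law. In the deferred picture the relay index of a block
is fixed before the codebook of that block is drawn. -/
theorem avg_causal_compProd {n : ℕ} (p : Dist Θ)
    (k : (i : Fin n) → (Fin i → Θ × Θ') → Θ → Dist Θ') (F : (Fin n → Θ × Θ') → ℝ) :
    avg (Dist.causal fun i h => Dist.compProd p (k i h)) F
      = avg (Dist.pi fun _ : Fin n => p) fun C =>
        avg (Dist.causal fun i g => k i (fun j => (C (j.castLE i.2.le), g j)) (C i)) fun o =>
          F fun i => (C i, o i) := by
  simp only [avg, Finset.mul_sum]
  rw [← (Equiv.arrowProdEquivProdArrow (Fin n) (fun _ => Θ) (fun _ => Θ')).symm.sum_comp,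
    Fintype.sum_prod_type]
  refine Finset.sum_congr rfl fun C _ => Finset.sum_congr rfl fun o _ => ?_
  rw [← mul_assoc]
  congr 1
  change ∏ i, p (C i) * k i (before (fun j => (C j, o j)) i) (C i) (o i)
    = (∏ i, p (C i)) * ∏ i, k i (fun j => (C (j.castLE i.2.le), before o i j)) (C i) (o i)
  exact Finset.prod_mul_distrib (f := fun i => p (C i))
    (g := fun i => k i (before (fun j => (C j, o j)) i) (C i) (o i))

end Causal

/-! ### Equivocation -/

section Equivocation

variable {μ T : Type*} [Fintype μ] [Fintype T]

/-- The posterior probability of `w` given the observation `t`, for a uniform input of `E`. -/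
def post (E : μ → T → ℝ) (w : μ) (t : T) : ℝ := E w t / ∑ w', E w' t

/-- The equivocation, in nats, of a uniform input of `E` given the output. -/
def eqv (E : μ → T → ℝ) : ℝ :=
  1 / (Fintype.card μ : ℝ) * ∑ w, ∑ t, E w t * -Real.log (post E w t)

theorem post_nonneg {E : μ → T → ℝ} (hE : ∀ w t, 0 ≤ E w t) (w : μ) (t : T) : 0 ≤ post E w t :=
  div_nonneg (hE w t) (Finset.sum_nonneg fun w' _ => hE w' t)

theorem post_pos {E : μ → T → ℝ} (hE : ∀ w t, 0 ≤ E w t) {w : μ} {t : T} (h : 0 < E w t) :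
    0 < post E w t :=
  div_pos h (Finset.sum_pos' (fun w' _ => hE w' t) ⟨w, Finset.mem_univ w, h⟩)

theorem post_le_one {E : μ → T → ℝ} (hE : ∀ w t, 0 ≤ E w t) (w : μ) (t : T) :
    post E w t ≤ 1 :=
  div_le_one_of_le₀ (Finset.single_le_sum (fun w' _ => hE w' t) (Finset.mem_univ w))
    (Finset.sum_nonneg fun w' _ => hE w' t)

theorem sum_post_le (E : μ → T → ℝ) (t : T) : ∑ w, post E w t ≤ 1 := by
  simp only [post, ← Finset.sum_div]
  exact div_self_le_one _

theorem eqv_nonneg {E : μ → T → ℝ} (hE : ∀ w t, 0 ≤ E w t) : 0 ≤ eqv E := by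
  refine mul_nonneg (by positivity) (Finset.sum_nonneg fun w _ => Finset.sum_nonneg fun t _ =>
    mul_nonneg (hE w t) (neg_nonneg.2 ?_))
  exact Real.log_nonpos (post_nonneg hE w t) (post_le_one hE w t)

end Equivocation

/-! ### Codes with arbitrary finite sets of messages and seeds -/

/-- A code with message set `μ` and relay seeds in `σ`. -/
structure GCode (X₁ X₂ Y Y₁ μ σ : Type*) [Fintype X₁] [Fintype σ] (n : ℕ) where
  /-- the stochastic source encoder -/
  enc : μ → Dist (Fin n → X₁)
  /-- the law of the relay's private seed -/
  seedLaw : Dist σ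
  /-- the causal relay encoder -/
  relay : (i : Fin n) → σ → (Fin i → Y₁) → X₂
  /-- the decoder of the destination -/
  dec : (Fin n → Y) → μ

namespace GCode

variable {X₁ X₂ Y Y₁ Y₂ μ σ : Type*} [Fintype X₁] [Fintype Y] [Fintype Y₁] [Fintype Y₂]
  [Fintype μ] [Fintype σ] {n : ℕ}

/-- The law of the channel outputs for a given seed and codeword. -/
def traj (c : GCode X₁ X₂ Y Y₁ μ σ n) (W : Channel X₁ X₂ Y Y₁ Y₂) (s : σ) (x : Fin n → X₁) :
    Dist (Fin n → Y × Y₁ × Y₂) :=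
  Dist.causal fun i g => W (x i) (c.relay i s fun j => (g j).2.1)

/-- The law of the channel outputs for a given message. -/
def out (c : GCode X₁ X₂ Y Y₁ μ σ n) (W : Channel X₁ X₂ Y Y₁ Y₂) (w : μ) :
    Dist (Fin n → Y × Y₁ × Y₂) :=
  Dist.bind c.seedLaw fun s => Dist.bind (c.enc w) fun x => c.traj W s x

theorem avg_out (c : GCode X₁ X₂ Y Y₁ μ σ n) (W : Channel X₁ X₂ Y Y₁ Y₂) (w : μ)
    (F : (Fin n → Y × Y₁ × Y₂) → ℝ) :
    avg (c.out W w) F = avg c.seedLaw fun s => avg (c.enc w) fun x => avg (c.traj W s x) F := by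
  simp only [out, avg_bind]

/-- The average error probability. -/
def err (c : GCode X₁ X₂ Y Y₁ μ σ n) (W : Channel X₁ X₂ Y Y₁ Y₂) : ℝ :=
  1 / (Fintype.card μ : ℝ) *
    ∑ w, avg (c.out W w) fun o => ind (c.dec (fun i => (o i).1) ≠ w)

/-- The law of the eavesdropper's observation for a given message. -/
def eve (c : GCode X₁ X₂ Y Y₁ μ σ n) (W : Channel X₁ X₂ Y Y₁ Y₂) (w : μ) :
    Dist (Fin n → Y₂) :=
  Dist.map (c.out W w) fun o i => (o i).2.2

/-- The equivocation, in nats. -/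
def equiv (c : GCode X₁ X₂ Y Y₁ μ σ n) (W : Channel X₁ X₂ Y Y₁ Y₂) : ℝ :=
  eqv fun w => c.eve W w

theorem equiv_eq (c : GCode X₁ X₂ Y Y₁ μ σ n) (W : Channel X₁ X₂ Y Y₁ Y₂) :
    c.equiv W = 1 / (Fintype.card μ : ℝ) * ∑ w, avg (c.out W w) fun o =>
      -Real.log (post (fun w => c.eve W w) w fun i => (o i).2.2) := by
  rw [equiv, eqv]
  congr 1
  refine Finset.sum_congr rfl fun w _ => ?_
  exact avg_map (c.out W w) (fun o i => (o i).2.2)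
    fun t => -Real.log (post (fun w => c.eve W w) w t)

end GCode

/-! ### Block-Markov compress-and-forward with noise forwarding -/

section Markov

variable {X₁ X₂ Y Y₁ Y₂ V α κ L : Type*} [Fintype X₁] [Fintype X₂] [Fintype Y] [Fintype Y₁]
  [Fintype Y₂] [Fintype V] [Fintype α] [Fintype κ] [Fintype L] [Nonempty α] [Nonempty κ]
  [Nonempty L]

variable (T : Tests X₁ X₂ Y Y₂ V) (W : Channel X₁ X₂ Y Y₁ Y₂) (p₁ : Dist X₁) (u₀ : α) (z₀ : κ)

/-- The compression index which the relay forwards after it has seen the given blocks. -/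
def relayState : (i : ℕ) → (Fin i → Book α κ L X₁ X₂ V × L × Y₁) → κ
  | 0, _ => z₀
  | i + 1, h =>
    T.compress W p₁ (h (Fin.last i)).1
      ((h (Fin.last i)).1.2.1 (relayState i fun j => h j.castSucc, (h (Fin.last i)).2.1))
      (h (Fin.last i)).2.2

/-- The relay index of block `i`, given the past. -/
def relayIndex {n : ℕ} (l : Fin n → L) (i : Fin n) (h : Fin i → Book α κ L X₁ X₂ V × Y₁) : κ × L :=
  (relayState T W p₁ z₀ i fun j => ((h j).1, l (j.castLE i.2.le), (h j).2), l i)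

variable {B : ℕ} (C : Fin (B + 1) → Book α κ L X₁ X₂ V)

/-- The source indices of all blocks; the last block carries a dummy. -/
def padded (u : Fin B → α) : Fin (B + 1) → α := Fin.snoc u u₀

theorem padded_castSucc (u : Fin B → α) (b : Fin B) : padded u₀ u b.castSucc = u b :=
  Fin.snoc_castSucc (α := fun _ => α) u₀ u b

/-- The block-Markov code for a sequence of codebooks. -/
def markovCode : GCode X₁ X₂ Y Y₁ (Fin B → α) (Fin (B + 1) → L) (B + 1) where
  enc u := Dist.point fun b => (C b).1 (padded u₀ u b)
  seedLaw := Dist.unif _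
  relay i l y := (C i).2.1 (relayIndex T W p₁ z₀ l i fun j => (C (j.castLE i.2.le), y j))
  dec y b := T.decSource (C b.castSucc) (y b.castSucc)
    (T.decRelay (C b.castSucc) (y b.castSucc)) (T.decRelay (C b.succ) (y b.succ)).1

/-- The law of the outputs of the block-Markov code for a given message and noise. -/
def markovTraj (u : Fin B → α) (l : Fin (B + 1) → L) : Dist (Fin (B + 1) → Y × Y₁ × Y₂) :=
  Dist.causal fun i g => W ((C i).1 (padded u₀ u i))
    ((C i).2.1 (relayIndex T W p₁ z₀ l i fun j => (C (j.castLE i.2.le), (g j).2.1)))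

theorem avg_markovCode_out (u : Fin B → α) (F : (Fin (B + 1) → Y × Y₁ × Y₂) → ℝ) :
    avg ((markovCode T W p₁ u₀ z₀ C).out W u) F
      = avg (Dist.unif _) fun l => avg (markovTraj T W p₁ u₀ z₀ C u l) F := by
  rw [GCode.avg_out]
  congr 1; funext l
  exact avg_point _ _

/-- The relay index actually sent in block `i`. -/
def sentIndex (l : Fin (B + 1) → L) (o : Fin (B + 1) → Y × Y₁ × Y₂) (i : Fin (B + 1)) : κ × L :=
  relayIndex T W p₁ z₀ l i (before (fun j => (C j, (o j).2.1)) i)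

/-- The block-Markov link: it allows the destination to read the description of block `b` off the
relay index of the next block, and is why the last block carries no message. -/
theorem sentIndex_succ (l : Fin (B + 1) → L) (o : Fin (B + 1) → Y × Y₁ × Y₂) (b : Fin B) :
    (sentIndex T W p₁ z₀ C l o b.succ).1 = T.compress W p₁ (C b.castSucc)
      ((C b.castSucc).2.1 (sentIndex T W p₁ z₀ C l o b.castSucc)) (o b.castSucc).2.1 := rfl

/-- Some decoder fails in some block. -/
def MarkovFails (u : Fin B → α) (l : Fin (B + 1) → L) (o : Fin (B + 1) → Y × Y₁ × Y₂) : Prop :=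
  ∃ i, T.Fails W p₁ (C i) (padded u₀ u i) (sentIndex T W p₁ z₀ C l o i) (o i)

/-- The noise guessed by an eavesdropper who knows the message. -/
def eveGuess (u : Fin B → α) (t : Fin (B + 1) → Y₂) (i : Fin (B + 1)) : L :=
  (T.decEve (C i) (padded u₀ u i) (t i)).2

theorem markovCode_dec_of_not_fails {u : Fin B → α} {l : Fin (B + 1) → L}
    {o : Fin (B + 1) → Y × Y₁ × Y₂} (h : ¬MarkovFails T W p₁ u₀ z₀ C u l o) :
    (markovCode T W p₁ u₀ z₀ C).dec (fun i => (o i).1) = u := by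
  simp only [MarkovFails, Tests.Fails, not_exists, not_or, not_not] at h
  funext b
  change T.decSource _ _ _ _ = _
  rw [(h b.castSucc).1, (h b.succ).1, sentIndex_succ, (h b.castSucc).2.1, padded_castSucc]

theorem eveGuess_of_not_fails {u : Fin B → α} {l : Fin (B + 1) → L}
    {o : Fin (B + 1) → Y × Y₁ × Y₂} (h : ¬MarkovFails T W p₁ u₀ z₀ C u l o) :
    eveGuess T u₀ C u (fun i => (o i).2.2) = l := by
  simp only [MarkovFails, Tests.Fails, not_exists, not_or, not_not] at h
  funext i
  simp only [eveGuess]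
  rw [(h i).2.2]
  rfl

/-- The probability that some decoder fails. -/
def markovErr : ℝ := avg (Dist.unif (Fin B → α)) fun u => avg (Dist.unif (Fin (B + 1) → L)) fun l =>
  avg (markovTraj T W p₁ u₀ z₀ C u l) fun o => ind (MarkovFails T W p₁ u₀ z₀ C u l o)

theorem markovCode_err_le :
    (markovCode T W p₁ u₀ z₀ C).err W ≤ markovErr T W p₁ u₀ z₀ C := by
  rw [GCode.err, ← avg_unif (α := Fin B → α)]
  refine avg_le_avg _ fun u => ?_
  rw [avg_markovCode_out]
  refine avg_le_avg _ fun l => avg_le_avg _ fun o => ind_mono fun h => ?_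
  by_contra hn
  exact h (markovCode_dec_of_not_fails T W p₁ u₀ z₀ C hn)

theorem ind_funext {ι β : Type*} [Fintype ι] (f g : ι → β) :
    ind (f = g) = ∏ i, ind (f i = g i) := by
  by_cases h : f = g
  · rw [ind_true h, Finset.prod_eq_one fun i _ => ind_true (congrFun h i)]
  · obtain ⟨i, hi⟩ := Function.ne_iff.1 h
    rw [ind_false h, Finset.prod_eq_zero (Finset.mem_univ i) (ind_false hi)]

/-- The eavesdropper's information density along a transmission. -/
def densitySum (ι : X₁ → X₂ → Y₂ → ℝ) (u : Fin B → α) (l : Fin (B + 1) → L)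
    (o : Fin (B + 1) → Y × Y₁ × Y₂) : ℝ :=
  ∑ i, ι ((C i).1 (padded u₀ u i)) ((C i).2.1 (sentIndex T W p₁ z₀ C l o i)) (o i).2.2

/-- The average information density. -/
def markovInfo (ι : X₁ → X₂ → Y₂ → ℝ) : ℝ :=
  avg (Dist.unif (Fin B → α)) fun u => avg (Dist.unif (Fin (B + 1) → L)) fun l =>
    avg (markovTraj T W p₁ u₀ z₀ C u l) (densitySum T W p₁ u₀ z₀ C ι u l)

variable {T W p₁ u₀ z₀ C} {p₂ : Dist X₂} {ι : X₁ → X₂ → Y₂ → ℝ} {Q : Y₂ → ℝ}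

/-- Weighted by `exp (-ι)`, the eavesdropper's kernel in each block is dominated by `Q` whatever the
past, so the causal dependence disappears from the bound. -/
theorem avg_markovTraj_exp_le (hQ0 : ∀ t, 0 ≤ Q t)
    (hι : ∀ x₁ x₂ t, 0 < p₁ x₁ → 0 < p₂ x₂ →
      avg (W x₁ x₂) (fun o => ind (o.2.2 = t) * Real.exp (-ι x₁ x₂ o.2.2)) ≤ Q t)
    (hC : ∀ i u s, 0 < p₁ ((C i).1 u) ∧ 0 < p₂ ((C i).2.1 s))
    (u : Fin B → α) (l : Fin (B + 1) → L) (t : Fin (B + 1) → Y₂) :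
    avg (markovTraj T W p₁ u₀ z₀ C u l) (fun o => ind ((fun i => (o i).2.2) = t) *
      Real.exp (-densitySum T W p₁ u₀ z₀ C ι u l o)) ≤ ∏ i, Q (t i) := by
  refine le_trans (le_of_eq ?_) (sum_causalWeight_le
    (fun i g a => W ((C i).1 (padded u₀ u i))
      ((C i).2.1 (relayIndex T W p₁ z₀ l i fun j => (C (j.castLE i.2.le), (g j).2.1))) a *
      (ind (a.2.2 = t i) * Real.exp (-ι ((C i).1 (padded u₀ u i))
      ((C i).2.1 (relayIndex T W p₁ z₀ l i fun j => (C (j.castLE i.2.le), (g j).2.1))) a.2.2)))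
    (fun i => Q (t i)) (fun i g a => mul_nonneg (Dist.nonneg _ _)
      (mul_nonneg (ind_nonneg _) (Real.exp_pos _).le))
      -- `hC` speaks of a source word and a relay word together; the word not in question gets a
      -- dummy index.
      (fun i g => hι _ _ _ (hC _ _ (z₀, Classical.arbitrary L)).1
      (hC i u₀ _).2) fun i => hQ0 _)
  refine Finset.sum_congr rfl fun o _ => ?_
  beta_reduce
  rw [causalWeight, Finset.prod_mul_distrib, Finset.prod_mul_distrib, densitySum,
    ← Finset.sum_neg_distrib, Real.exp_sum, ind_funext]
  rfl

/-- The eavesdropper's posterior of the noise, given the message and a guess. -/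
def guessLaw (u : Fin B → α) (l : Fin (B + 1) → L) (t : Fin (B + 1) → Y₂) : ℝ :=
  1 / 2 * ind (l = eveGuess T u₀ C u t) + 1 / (2 * (Fintype.card (Fin (B + 1) → L) : ℝ))

theorem guessLaw_pos (u : Fin B → α) (l : Fin (B + 1) → L) (t : Fin (B + 1) → Y₂) :
    0 < guessLaw (T := T) (u₀ := u₀) (C := C) u l t := by
  have : (0 : ℝ) < Fintype.card (Fin (B + 1) → L) := by exact_mod_cast Fintype.card_pos
  have := ind_nonneg (l = eveGuess T u₀ C u t)
  unfold guessLaw; positivity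

theorem sum_guessLaw (u : Fin B → α) (t : Fin (B + 1) → Y₂) :
    ∑ l, guessLaw (T := T) (u₀ := u₀) (C := C) u l t = 1 := by
  have : (Fintype.card (Fin (B + 1) → L) : ℝ) ≠ 0 := by exact_mod_cast Fintype.card_ne_zero
  simp only [guessLaw, Finset.sum_add_distrib, ← Finset.mul_sum, Finset.sum_const, Finset.card_univ,
    nsmul_eq_mul]
  rw [show ∑ l, ind (l = eveGuess T u₀ C u t) = 1 from
    Dist.sum_eq_one (Dist.point _)]
  field_simp
  norm_num

/-- Fano's inequality pointwise: a right guess costs `log 2`, the price of mixing with the uniform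
law, and a wrong one costs in addition the logarithm of the number of noise sequences. -/
theorem neg_log_guessLaw_le (u : Fin B → α) (l : Fin (B + 1) → L)
    (o : Fin (B + 1) → Y × Y₁ × Y₂) :
    -Real.log (guessLaw (T := T) (u₀ := u₀) (C := C) u l fun i => (o i).2.2) ≤ Real.log 2 +
      ind (MarkovFails T W p₁ u₀ z₀ C u l o) * Real.log (Fintype.card (Fin (B + 1) → L)) := by
  have h1 : (1 : ℝ) ≤ Fintype.card (Fin (B + 1) → L) := by exact_mod_cast Fintype.card_pos
  have h0 : (0 : ℝ) < Fintype.card (Fin (B + 1) → L) := by linarith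
  by_cases h : MarkovFails T W p₁ u₀ z₀ C u l o
  · rw [ind_true h, one_mul, ← Real.log_mul (by norm_num) h0.ne', ← Real.log_inv]
    rw [← one_div]
    refine Real.log_le_log (one_div_pos.2 (guessLaw_pos _ _ _)) ?_
    rw [one_div_le (guessLaw_pos _ _ _) (by positivity)]
    have := ind_nonneg (l = eveGuess T u₀ C u fun i => (o i).2.2)
    unfold guessLaw; linarith
  · rw [ind_false h, zero_mul, add_zero, ← Real.log_inv, ← one_div]
    refine Real.log_le_log (one_div_pos.2 (guessLaw_pos _ _ _)) ?_
    rw [one_div_le (guessLaw_pos _ _ _) (by norm_num), guessLaw,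
      ind_true (eveGuess_of_not_fails T W p₁ u₀ z₀ C h).symm]
    have : 0 ≤ 1 / (2 * (Fintype.card (Fin (B + 1) → L) : ℝ)) := by positivity
    linarith

/-- After `avg_markovTraj_exp_le` what remains is the total mass of `∏ Q`, then a posterior over
`u`, then a guess over `l`: a subprobability on triples `(t, u, l)`. -/
theorem sum_post_guessLaw_le (hQ0 : ∀ t, 0 ≤ Q t) (hQ1 : ∑ t, Q t ≤ 1)
    (E : (Fin B → α) → (Fin (B + 1) → Y₂) → ℝ) (hE : ∀ u t, 0 ≤ E u t)
    (hι : ∀ x₁ x₂ t, 0 < p₁ x₁ → 0 < p₂ x₂ →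
      avg (W x₁ x₂) (fun o => ind (o.2.2 = t) * Real.exp (-ι x₁ x₂ o.2.2)) ≤ Q t)
    (hC : ∀ i u s, 0 < p₁ ((C i).1 u) ∧ 0 < p₂ ((C i).2.1 s)) :
    ∑ u, ∑ l, avg (markovTraj T W p₁ u₀ z₀ C u l) (fun o =>
      post E u (fun i => (o i).2.2) *
        guessLaw (T := T) (u₀ := u₀) (C := C) u l (fun i => (o i).2.2) *
        Real.exp (-densitySum T W p₁ u₀ z₀ C ι u l o)) ≤ 1 := by
  calc _ = ∑ u, ∑ l, ∑ t, post E u t * guessLaw (T := T) (u₀ := u₀) (C := C) u l t *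
          avg (markovTraj T W p₁ u₀ z₀ C u l) (fun o => ind ((fun i => (o i).2.2) = t) *
            Real.exp (-densitySum T W p₁ u₀ z₀ C ι u l o)) := by
        refine Finset.sum_congr rfl fun u _ => Finset.sum_congr rfl fun l _ => ?_
        simp only [← avg_const_mul]
        rw [← avg_sum]
        congr 1; funext o
        rw [Finset.sum_eq_single fun i => (o i).2.2]
        · rw [ind_true rfl, one_mul]
        · intro t _ ht; rw [ind_false fun h => ht h.symm]; ring
        · simp
    _ ≤ ∑ u, ∑ l, ∑ t, post E u t * guessLaw (T := T) (u₀ := u₀) (C := C) u l t *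
          ∏ i, Q (t i) := by
        refine Finset.sum_le_sum fun u _ => Finset.sum_le_sum fun l _ => Finset.sum_le_sum
          fun t _ => mul_le_mul_of_nonneg_left (avg_markovTraj_exp_le hQ0 hι hC u l t)
            (mul_nonneg (post_nonneg hE u t) (guessLaw_pos u l t).le)
    _ = ∑ t, (∑ u, post E u t) * ∏ i, Q (t i) := by
        rw [Finset.sum_congr rfl fun u _ => Finset.sum_comm, Finset.sum_comm]
        refine Finset.sum_congr rfl fun t _ => ?_
        rw [Finset.sum_mul]
        refine Finset.sum_congr rfl fun u _ => ?_
        rw [← Finset.sum_mul, ← Finset.mul_sum, sum_guessLaw, mul_one]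
    _ ≤ ∑ t : Fin (B + 1) → Y₂, ∏ i, Q (t i) := by
        refine Finset.sum_le_sum fun t _ => mul_le_of_le_one_left
          (Finset.prod_nonneg fun i _ => hQ0 _) (sum_post_le E t)
    _ = ∏ _i : Fin (B + 1), ∑ t, Q t := sum_prod_pi fun _ t => Q t
    _ ≤ 1 := Finset.prod_le_one (fun _ _ => Finset.sum_nonneg fun t _ => hQ0 t) fun _ _ => hQ1

/-- The decomposition `H(U | Y₂) = H(U) + H(L) - I(U, L; Y₂) - H(L | U, Y₂)` as one application of
Gibbs' inequality: `log x ≤ x - 1` at `x = nU * nL * ρ`, whose mean under the transmission law is at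
most 1 by `sum_post_guessLaw_le`. -/
theorem le_markovCode_equiv (hQ0 : ∀ t, 0 ≤ Q t) (hQ1 : ∑ t, Q t ≤ 1)
    (hι : ∀ x₁ x₂ t, 0 < p₁ x₁ → 0 < p₂ x₂ →
      avg (W x₁ x₂) (fun o => ind (o.2.2 = t) * Real.exp (-ι x₁ x₂ o.2.2)) ≤ Q t)
    (hC : ∀ i u s, 0 < p₁ ((C i).1 u) ∧ 0 < p₂ ((C i).2.1 s)) :
    Real.log (Fintype.card (Fin B → α)) + Real.log (Fintype.card (Fin (B + 1) → L))
      - markovInfo T W p₁ u₀ z₀ C ι - Real.log 2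
      - markovErr T W p₁ u₀ z₀ C * Real.log (Fintype.card (Fin (B + 1) → L))
      ≤ (markovCode T W p₁ u₀ z₀ C).equiv W := by
  set c := markovCode T W p₁ u₀ z₀ C with hc
  set nU : ℝ := (Fintype.card (Fin B → α) : ℝ) with hnU
  set nL : ℝ := (Fintype.card (Fin (B + 1) → L) : ℝ) with hnL
  have hU : 0 < nU := by rw [hnU]; exact_mod_cast Fintype.card_pos
  have hL : 0 < nL := by rw [hnL]; exact_mod_cast Fintype.card_pos
  set E : (Fin B → α) → (Fin (B + 1) → Y₂) → ℝ := fun u => c.eve W u with hEdef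
  have hE : ∀ u t, 0 ≤ E u t := fun u t => Dist.nonneg (c.eve W u) t
  set ρ : (Fin B → α) → (Fin (B + 1) → L) → (Fin (B + 1) → Y × Y₁ × Y₂) → ℝ := fun u l o =>
    post E u (fun i => (o i).2.2) *
      guessLaw (T := T) (u₀ := u₀) (C := C) u l (fun i => (o i).2.2) *
      Real.exp (-densitySum T W p₁ u₀ z₀ C ι u l o) with hρ
  have hpt : ∀ u l o, 0 < markovTraj T W p₁ u₀ z₀ C u l o →
      Real.log nU + Real.log nL - densitySum T W p₁ u₀ z₀ C ι u l o - Real.log 2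
        - ind (MarkovFails T W p₁ u₀ z₀ C u l o) * Real.log nL - (nU * nL * ρ u l o - 1)
      ≤ -Real.log (post E u fun i => (o i).2.2) := by
    intro u l o ho
    -- The trajectory `o` occurs with positive probability, hence so does the eavesdropper's part of
    -- it, and the logarithm of the posterior is not a junk value.
    have hEpos : 0 < E u fun i => (o i).2.2 := by
      have h1 : E u (fun i => (o i).2.2) = avg (c.out W u)
        (fun o' => ind ((fun i => (o' i).2.2) = fun i => (o i).2.2)) := rfl
      rw [h1, hc, avg_markovCode_out]
      refine avg_pos (b := l) (fun l => avg_nonneg _ fun o => ind_nonneg _) (by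
        change 0 < 1 / nL
        positivity) ?_
      exact avg_pos (fun o => ind_nonneg _) ho (by rw [ind_true rfl]; norm_num)
    have hpost := post_pos hE hEpos
    have hg := guessLaw_pos (T := T) (u₀ := u₀) (C := C) u l fun i => (o i).2.2
    have h1 := Real.log_le_sub_one_of_pos (x := nU * nL * ρ u l o) (by
      simp only [hρ]; positivity)
    have h2 := neg_log_guessLaw_le (W := W) (p₁ := p₁) (z₀ := z₀) (T := T) (u₀ := u₀) (C := C) u l o
    have h3 : Real.log (nU * nL * ρ u l o) = Real.log nU + Real.log nL +
        (Real.log (post E u fun i => (o i).2.2) +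
        Real.log (guessLaw (T := T) (u₀ := u₀) (C := C) u l fun i => (o i).2.2)
        - densitySum T W p₁ u₀ z₀ C ι u l o) := by
      simp only [hρ]
      rw [Real.log_mul (by positivity) (by positivity), Real.log_mul hU.ne' hL.ne',
        Real.log_mul (by positivity) (Real.exp_pos _).ne', Real.log_mul hpost.ne' hg.ne',
        Real.log_exp]
      ring
    linarith
  rw [GCode.equiv_eq, ← avg_unif (α := Fin B → α)]
  have h1 : avg (Dist.unif (Fin B → α)) (fun u => avg (Dist.unif (Fin (B + 1) → L)) fun l =>
      avg (markovTraj T W p₁ u₀ z₀ C u l) fun o =>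
      Real.log nU + Real.log nL - densitySum T W p₁ u₀ z₀ C ι u l o - Real.log 2
        - ind (MarkovFails T W p₁ u₀ z₀ C u l o) * Real.log nL - (nU * nL * ρ u l o - 1))
      ≤ avg (Dist.unif (Fin B → α)) (fun u => avg (c.out W u) fun o =>
        -Real.log (post E u fun i => (o i).2.2)) := by
    refine avg_le_avg _ fun u => ?_
    rw [hc, avg_markovCode_out]
    exact avg_le_avg _ fun l => avg_le_avg_of_pos _ fun o ho => hpt u l o ho
  refine le_trans ?_ h1
  simp only [avg_sub, avg_const, avg_mul_const, avg_const_mul]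
  have h2 : nU * nL * avg (Dist.unif (Fin B → α)) (fun u => avg (Dist.unif (Fin (B + 1) → L))
      fun l => avg (markovTraj T W p₁ u₀ z₀ C u l) (ρ u l)) ≤ 1 := by
    refine le_trans (le_of_eq ?_) (sum_post_guessLaw_le (T := T) (W := W) (p₁ := p₁) (u₀ := u₀)
      (z₀ := z₀) (C := C) hQ0 hQ1 E hE hι hC)
    simp only [avg_unif, ← Finset.mul_sum]
    rw [← hnU, ← hnL]
    field_simp
    rfl
  have h3 : avg (Dist.unif (Fin B → α)) (fun u => avg (Dist.unif (Fin (B + 1) → L))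
      fun l => avg (markovTraj T W p₁ u₀ z₀ C u l) fun o => densitySum T W p₁ u₀ z₀ C ι u l o)
      = markovInfo T W p₁ u₀ z₀ C ι := rfl
  rw [h3]
  simp only [markovErr]
  linarith

end Markov

/-! ### Choosing the codebooks -/

section Derandomize

variable {X₁ X₂ Y Y₁ Y₂ V α κ L : Type*} [Fintype X₁] [Fintype X₂] [Fintype Y] [Fintype Y₁]
  [Fintype Y₂] [Fintype V] [Fintype α] [Fintype κ] [Fintype L] [Nonempty α] [Nonempty κ]
  [Nonempty L] [DecidableEq X₂] [DecidableEq α] [DecidableEq κ] [DecidableEq L]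
  {T : Tests X₁ X₂ Y Y₂ V} {W : Channel X₁ X₂ Y Y₁ Y₂} {p₁ : Dist X₁} {p₂ : Dist X₂}
  {q : Y₁ → X₂ → Dist V} {ι : X₁ → X₂ → Y₂ → ℝ} {Q : Y₂ → ℝ} {B : ℕ}

/-- A divergence from a subprobability: `1 - ι ≤ exp (-ι)`, and the mean of the right side is at
most 1. The sign is what allows error and leakage to be bounded together. -/
theorem avg_density_nonneg (hQ1 : ∑ t, Q t ≤ 1)
    (hι : ∀ x₁ x₂ t, 0 < p₁ x₁ → 0 < p₂ x₂ →
      avg (W x₁ x₂) (fun o => ind (o.2.2 = t) * Real.exp (-ι x₁ x₂ o.2.2)) ≤ Q t)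
    {x₁ : X₁} {x₂ : X₂} (h₁ : 0 < p₁ x₁) (h₂ : 0 < p₂ x₂) :
    0 ≤ avg (W x₁ x₂) fun o => ι x₁ x₂ o.2.2 := by
  have h1 : avg (W x₁ x₂) (fun o => Real.exp (-ι x₁ x₂ o.2.2)) ≤ 1 := by
    refine le_trans (le_of_eq ?_) ((Finset.sum_le_sum fun t _ => hι x₁ x₂ t h₁ h₂).trans hQ1)
    rw [← avg_sum]
    congr 1; funext o
    rw [← Finset.sum_mul, show ∑ t, ind (o.2.2 = t) = 1 by simp [ind], one_mul]
  have h2 : avg (W x₁ x₂) (fun o => 1 - ι x₁ x₂ o.2.2) ≤ 1 :=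
    (avg_le_avg _ fun o => by linarith [Real.add_one_le_exp (-ι x₁ x₂ o.2.2)]).trans h1
  rw [avg_sub, avg_const] at h2
  linarith

/-- The average divergence of the eavesdropper's outputs along a transmission. -/
def markovDiv (T : Tests X₁ X₂ Y Y₂ V) (W : Channel X₁ X₂ Y Y₁ Y₂) (p₁ : Dist X₁) (u₀ : α) (z₀ : κ)
    (C : Fin (B + 1) → Book α κ L X₁ X₂ V) (ι : X₁ → X₂ → Y₂ → ℝ) : ℝ :=
  avg (Dist.unif (Fin B → α)) fun u => avg (Dist.unif (Fin (B + 1) → L)) fun l =>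
    avg (markovTraj T W p₁ u₀ z₀ C u l) fun o => ∑ i,
      avg (W ((C i).1 (padded u₀ u i)) ((C i).2.1 (sentIndex T W p₁ z₀ C l o i))) fun a =>
        ι ((C i).1 (padded u₀ u i)) ((C i).2.1 (sentIndex T W p₁ z₀ C l o i)) a.2.2

/-- The densities minus their conditional means form martingale differences, so the densities may be
replaced by conditional means, which are nonnegative term by term. -/
theorem markovInfo_le_markovDiv (u₀ : α) (z₀ : κ) (C : Fin (B + 1) → Book α κ L X₁ X₂ V) :
    markovInfo T W p₁ u₀ z₀ C ι ≤ markovDiv T W p₁ u₀ z₀ C ι := by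
  refine avg_le_avg _ fun u => avg_le_avg _ fun l => ?_
  rw [← sub_nonpos, ← avg_sub]
  have h := avg_causal_sum_le
    (fun i g => W ((C i).1 (padded u₀ u i))
      ((C i).2.1 (relayIndex T W p₁ z₀ l i fun j => (C (j.castLE i.2.le), (g j).2.1))))
    (fun i g a => ι ((C i).1 (padded u₀ u i))
      ((C i).2.1 (relayIndex T W p₁ z₀ l i fun j => (C (j.castLE i.2.le), (g j).2.1))) a.2.2 -
      avg (W ((C i).1 (padded u₀ u i))
      ((C i).2.1 (relayIndex T W p₁ z₀ l i fun j => (C (j.castLE i.2.le), (g j).2.1)))) fun b =>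
      ι ((C i).1 (padded u₀ u i))
      ((C i).2.1 (relayIndex T W p₁ z₀ l i fun j => (C (j.castLE i.2.le), (g j).2.1))) b.2.2)
    (fun _ => 0) (fun i g => by rw [avg_sub, avg_const, sub_self])
  rw [Finset.sum_const_zero] at h
  refine le_trans (le_of_eq ?_) h
  simp only [Finset.sum_sub_distrib]
  rfl

theorem markovDiv_nonneg (hQ1 : ∑ t, Q t ≤ 1)
    (hι : ∀ x₁ x₂ t, 0 < p₁ x₁ → 0 < p₂ x₂ →
      avg (W x₁ x₂) (fun o => ind (o.2.2 = t) * Real.exp (-ι x₁ x₂ o.2.2)) ≤ Q t)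
    (u₀ : α) (z₀ : κ) (C : Fin (B + 1) → Book α κ L X₁ X₂ V)
    (hC : ∀ i u s, 0 < p₁ ((C i).1 u) ∧ 0 < p₂ ((C i).2.1 s)) :
    0 ≤ markovDiv T W p₁ u₀ z₀ C ι :=
  avg_nonneg _ fun _ => avg_nonneg _ fun _ => avg_nonneg _ fun _ =>
    Finset.sum_nonneg fun i _ => avg_density_nonneg hQ1 hι
      (hC i _ (z₀, Classical.arbitrary L)).1 (hC i u₀ _).2

/-- For fixed message and noise, draw each codebook when its block begins. Given the past the relay
index is then a constant, so the one-block bounds `Tests.avg_fails_le` and `Tests.avg_bookLaw_words`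
apply in every block. -/
theorem avg_markovErr_add_markovDiv_le {δ Λ I : ℝ} (hΛ : 0 ≤ Λ)
    (h : T.Reliable W p₁ p₂ q α κ L δ)
    (hI : avg p₁ (fun x₁ => avg p₂ fun x₂ => avg (W x₁ x₂) fun o => ι x₁ x₂ o.2.2) ≤ I)
    (u₀ : α) (z₀ : κ) :
    avg (Dist.pi fun _ : Fin (B + 1) => Tests.bookLaw α κ L W p₁ p₂ q) (fun C =>
      Λ * markovErr T W p₁ u₀ z₀ C + markovDiv T W p₁ u₀ z₀ C ι)
      ≤ (B + 1) * (Λ * (6 * δ) + I) := by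
  have h1 : ∀ u : Fin B → α, ∀ l : Fin (B + 1) → L,
      avg (Dist.pi fun _ : Fin (B + 1) => Tests.bookLaw α κ L W p₁ p₂ q) (fun C =>
        avg (markovTraj T W p₁ u₀ z₀ C u l) fun o =>
          Λ * ind (MarkovFails T W p₁ u₀ z₀ C u l o) + ∑ i,
      avg (W ((C i).1 (padded u₀ u i)) ((C i).2.1 (sentIndex T W p₁ z₀ C l o i))) fun a =>
        ι ((C i).1 (padded u₀ u i)) ((C i).2.1 (sentIndex T W p₁ z₀ C l o i)) a.2.2)
      ≤ (B + 1) * (Λ * (6 * δ) + I) := by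
    intro u l
    have h2 := avg_causal_sum_le (n := B + 1)
      (fun i (g : Fin i → Book α κ L X₁ X₂ V × (Y × Y₁ × Y₂)) =>
        Dist.compProd (Tests.bookLaw α κ L W p₁ p₂ q) fun c => W (c.1 (padded u₀ u i))
        (c.2.1 (relayIndex T W p₁ z₀ l i fun j => ((g j).1, (g j).2.2.1))))
      (fun i g a => Λ * ind (T.Fails W p₁ a.1 (padded u₀ u i)
          (relayIndex T W p₁ z₀ l i fun j => ((g j).1, (g j).2.2.1)) a.2) +
        avg (W (a.1.1 (padded u₀ u i))
        (a.1.2.1 (relayIndex T W p₁ z₀ l i fun j => ((g j).1, (g j).2.2.1)))) fun b =>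
          ι (a.1.1 (padded u₀ u i))
            (a.1.2.1 (relayIndex T W p₁ z₀ l i fun j => ((g j).1, (g j).2.2.1))) b.2.2)
      (fun _ => Λ * (6 * δ) + I) (fun i g => by
        rw [avg_compProd]
        simp only [avg_add, avg_const_mul, avg_const]
        refine add_le_add (mul_le_mul_of_nonneg_left (Tests.avg_fails_le h _ _) hΛ) ?_
        rw [Tests.avg_bookLaw_words (W := W) (p₁ := p₁) (p₂ := p₂) (q := q) (padded u₀ u i)
          (relayIndex T W p₁ z₀ l i fun j => ((g j).1, (g j).2.2.1))
          (fun x₁ x₂ => avg (W x₁ x₂) fun b => ι x₁ x₂ b.2.2)]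
        exact hI)
    rw [avg_causal_compProd (Tests.bookLaw α κ L W p₁ p₂ q)
      (fun i (g : Fin i → Book α κ L X₁ X₂ V × (Y × Y₁ × Y₂)) c => W (c.1 (padded u₀ u i))
        (c.2.1 (relayIndex T W p₁ z₀ l i fun j => ((g j).1, (g j).2.2.1)))), Finset.sum_const,
      Finset.card_univ, Fintype.card_fin, nsmul_eq_mul, Nat.cast_add, Nat.cast_one] at h2
    refine le_trans (avg_le_avg _ fun C => avg_le_avg _ fun o => ?_) h2
    rw [Finset.sum_add_distrib, ← Finset.mul_sum]
    exact add_le_add (mul_le_mul_of_nonneg_left (ind_exists_le _) hΛ) le_rfl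
  have h3 : ∀ C : Fin (B + 1) → Book α κ L X₁ X₂ V,
      Λ * markovErr T W p₁ u₀ z₀ C + markovDiv T W p₁ u₀ z₀ C ι
      = avg (Dist.unif (Fin B → α)) fun u => avg (Dist.unif (Fin (B + 1) → L)) fun l =>
        avg (markovTraj T W p₁ u₀ z₀ C u l) fun o =>
          Λ * ind (MarkovFails T W p₁ u₀ z₀ C u l o) + ∑ i,
      avg (W ((C i).1 (padded u₀ u i)) ((C i).2.1 (sentIndex T W p₁ z₀ C l o i))) fun a =>
        ι ((C i).1 (padded u₀ u i)) ((C i).2.1 (sentIndex T W p₁ z₀ C l o i)) a.2.2 := by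
    intro C
    simp only [avg_add, avg_const_mul]
    rfl
  simp only [h3]
  rw [avg_comm]
  refine avg_le_const _ fun u => ?_
  rw [avg_comm]
  exact avg_le_const _ fun l => h1 u l

theorem words_pos_of_bookLaw_pos {C : Fin (B + 1) → Book α κ L X₁ X₂ V}
    (h : 0 < Dist.pi (fun _ => Tests.bookLaw α κ L W p₁ p₂ q) C) (i : Fin (B + 1)) (u : α)
    (s : κ × L) : 0 < p₁ ((C i).1 u) ∧ 0 < p₂ ((C i).2.1 s) := by
  have h1 := Dist.pos_of_pi_pos h i
  have h2 := Dist.nonneg (Dist.pi fun _ : α => p₁) (C i).1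
  have h3 := Dist.nonneg (Dist.pi fun _ : κ × L => p₂) (C i).2.1
  have h4 := Dist.nonneg (Dist.pi fun i : X₂ × κ => compLaw W p₁ q i.1) (C i).2.2
  replace h1 : 0 < Dist.pi (fun _ : α => p₁) (C i).1 * (Dist.pi (fun _ : κ × L => p₂) (C i).2.1 *
    Dist.pi (fun i : X₂ × κ => compLaw W p₁ q i.1) (C i).2.2) := h1
  refine ⟨Dist.pos_of_pi_pos (pos_of_mul_pos_left h1 (mul_nonneg h3 h4)) u,
    Dist.pos_of_pi_pos (pos_of_mul_pos_left (pos_of_mul_pos_right h1 h2) h4) s⟩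

/-- A block-Markov code with small error probability and large equivocation. -/
theorem exists_gcode_of_reliable (B : ℕ) {δ Λ I : ℝ} (hΛ : 0 < Λ)
    (h : T.Reliable W p₁ p₂ q α κ L δ) (hQ0 : ∀ t, 0 ≤ Q t) (hQ1 : ∑ t, Q t ≤ 1)
    (hι : ∀ x₁ x₂ t, 0 < p₁ x₁ → 0 < p₂ x₂ →
      avg (W x₁ x₂) (fun o => ind (o.2.2 = t) * Real.exp (-ι x₁ x₂ o.2.2)) ≤ Q t)
    (hI : avg p₁ (fun x₁ => avg p₂ fun x₂ => avg (W x₁ x₂) fun o => ι x₁ x₂ o.2.2) ≤ I) :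
    ∃ c : GCode X₁ X₂ Y Y₁ (Fin B → α) (Fin (B + 1) → L) (B + 1),
      c.err W ≤ (B + 1) * (6 * δ + I / Λ) ∧
      B * Real.log (Fintype.card α) + (B + 1) * Real.log (Fintype.card L)
        - (B + 1) * (I + 6 * Λ * δ) - Real.log 2
        - (B + 1) * (6 * δ + I / Λ) * ((B + 1) * Real.log (Fintype.card L)) ≤ c.equiv W := by
  obtain ⟨u₀⟩ := ‹Nonempty α›
  obtain ⟨z₀⟩ := ‹Nonempty κ›
  have : Nonempty α := ⟨u₀⟩
  have : Nonempty κ := ⟨z₀⟩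
  -- Both terms of the weighted sum are nonnegative for a codebook in the support, so a bound on the
  -- sum bounds each. A large `Λ` makes the error bound insensitive to the leakage `I`; a small `δ`
  -- then controls `Λ * δ`.
  obtain ⟨C, hCpos, hC⟩ := exists_pos_le_avg
    (Dist.pi fun _ : Fin (B + 1) => Tests.bookLaw α κ L W p₁ p₂ q) fun C =>
      Λ * markovErr T W p₁ u₀ z₀ C + markovDiv T W p₁ u₀ z₀ C ι
  have hCw := words_pos_of_bookLaw_pos hCpos
  have h1 := hC.trans (avg_markovErr_add_markovDiv_le hΛ.le h hI u₀ z₀)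
  have h2 := markovDiv_nonneg (T := T) (p₁ := p₁) hQ1 hι u₀ z₀ C hCw
  have h3 : 0 ≤ markovErr T W p₁ u₀ z₀ C :=
    avg_nonneg _ fun _ => avg_nonneg _ fun _ => avg_nonneg _ fun _ => ind_nonneg _
  have h4 : markovErr T W p₁ u₀ z₀ C ≤ (B + 1) * (6 * δ + I / Λ) := by
    rw [show ((B : ℝ) + 1) * (6 * δ + I / Λ) = (B + 1) * (Λ * (6 * δ) + I) / Λ by field_simp,
      le_div_iff₀ hΛ]
    linarith
  have h5 : markovInfo T W p₁ u₀ z₀ C ι ≤ (B + 1) * (I + 6 * Λ * δ) := by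
    have := markovInfo_le_markovDiv (T := T) (W := W) (p₁ := p₁) (ι := ι) u₀ z₀ C
    nlinarith [mul_nonneg hΛ.le h3]
  refine ⟨markovCode T W p₁ u₀ z₀ C, (markovCode_err_le T W p₁ u₀ z₀ C).trans h4, ?_⟩
  have h6 := le_markovCode_equiv (T := T) (p₁ := p₁) (u₀ := u₀) (z₀ := z₀) (C := C) hQ0 hQ1 hι hCw
  have h7 : (0 : ℝ) ≤ (B + 1) * Real.log (Fintype.card L) := by
    have : 0 ≤ Real.log (Fintype.card L) := Real.log_nonneg (by exact_mod_cast Fintype.card_pos)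
    positivity
  have h8 := mul_le_mul_of_nonneg_right h4 h7
  simp only [Fintype.card_pi, Finset.prod_const, Finset.card_univ, Fintype.card_fin, Nat.cast_pow,
    Real.log_pow, Nat.cast_add, Nat.cast_one] at h6
  linarith

end Derandomize

/-! ### Law of large numbers for log-likelihood ratios -/

section Deviation

variable {Ω X : Type*} [Fintype Ω] [Fintype X]

theorem avg_pi_sum_sq (p : Dist Ω) (g : Ω → ℝ) (hg : avg p g = 0) (m : ℕ) :
    avg (Dist.pi fun _ : Fin m => p) (fun ω => (∑ j, g (ω j)) ^ 2)
      = m * avg p fun a => g a ^ 2 := by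
  have h1 : ∀ ω : Fin m → Ω, (∑ j, g (ω j)) ^ 2 = ∑ i, ∑ j, g (ω i) * g (ω j) := by
    intro ω; rw [sq, Finset.sum_mul_sum]
  simp only [h1, avg_sum]
  have h2 : ∀ i j : Fin m, avg (Dist.pi fun _ : Fin m => p) (fun ω => g (ω i) * g (ω j))
      = if i = j then avg p fun a => g a ^ 2 else 0 := by
    intro i j
    split_ifs with h
    · subst h
      rw [avg_pi_apply (fun _ : Fin m => p) i fun a => g a * g a]
      simp only [sq]
    · rw [avg_pi_pair (fun _ : Fin m => p) h fun a b => g a * g b]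
      simp only [avg_const_mul, hg, mul_zero, avg_const]
  simp [h2]

theorem avg_ind_le_of_sq {p : Dist Ω} {F : Ω → ℝ} {P : Ω → Prop} {r : ℝ} (hr : 0 < r)
    (h : ∀ a, P a → r ≤ |F a|) : avg p (fun a => ind (P a)) ≤ avg p (fun a => F a ^ 2) / r ^ 2 := by
  rw [div_eq_mul_inv, ← avg_mul_const]
  refine avg_le_avg _ fun a => ?_
  by_cases hP : P a
  · rw [ind_true hP, ← div_eq_mul_inv, le_div_iff₀ (by positivity), one_mul, ← sq_abs (F a)]
    exact pow_le_pow_left₀ hr.le (h a hP) 2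
  · rw [ind_false hP]; positivity

/-- The weak law of large numbers. -/
theorem eventually_avg_deviation_le (p : Dist Ω) (f : Ω → ℝ) {γ η : ℝ} (hγ : 0 < γ) (hη : 0 < η) :
    ∀ᶠ m : ℕ in Filter.atTop, avg (Dist.pi fun _ : Fin m => p)
      (fun ω => ind (m * γ ≤ |∑ j, f (ω j) - m * avg p f|)) ≤ η := by
  set v := avg p fun a => (f a - avg p f) ^ 2 with hv
  filter_upwards [Filter.eventually_gt_atTop 0,
    Filter.eventually_ge_atTop ⌈v / (γ ^ 2 * η)⌉₊] with m hm hm'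
  have hm0 : (0 : ℝ) < m := by exact_mod_cast hm
  have h1 : v / (γ ^ 2 * η) ≤ m := (Nat.le_ceil _).trans (by exact_mod_cast hm')
  have h2 := avg_ind_le_of_sq (p := Dist.pi fun _ : Fin m => p)
    (F := fun ω => ∑ j, (f (ω j) - avg p f))
    (P := fun ω => m * γ ≤ |∑ j, f (ω j) - m * avg p f|) (r := m * γ) (by positivity) (by
      intro ω h
      rwa [Finset.sum_sub_distrib, Finset.sum_const, Finset.card_univ, Fintype.card_fin,
        nsmul_eq_mul])
  refine h2.trans ?_
  rw [avg_pi_sum_sq p (fun a => f a - avg p f) (by rw [avg_sub, avg_const, sub_self]) m, ← hv,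
    div_le_iff₀ (by positivity)]
  rw [div_le_iff₀ (by positivity)] at h1
  nlinarith

theorem sum_log_div {m : ℕ} {a b : Ω → ℝ} {ω : Fin m → Ω} (ha : ∀ j, 0 < a (ω j))
    (hb : ∀ j, 0 < b (ω j)) :
    ∏ j, a (ω j) = Real.exp (∑ j, Real.log (a (ω j) / b (ω j))) * ∏ j, b (ω j) := by
  rw [Real.exp_sum, ← Finset.prod_mul_distrib]
  refine Finset.prod_congr rfl fun j _ => ?_
  rw [Real.exp_log (div_pos (ha j) (hb j)), div_mul_cancel₀ _ (hb j).ne']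

variable {p : Dist Ω} {a b : Ω → ℝ}

/-- The logarithm of the likelihood ratio is a sum of i.i.d. terms whose mean is the relevant
information; the weak law bounds the probability of falling `γ` per letter short of it. -/
theorem eventually_lower_tail_le (ha : ∀ ω, 0 < p ω → 0 < a ω) (hb : ∀ ω, 0 < p ω → 0 < b ω)
    {γ η : ℝ} (hγ : 0 < γ) (hη : 0 < η) :
    ∀ᶠ m : ℕ in Filter.atTop, avg (Dist.pi fun _ : Fin m => p) (fun ω =>
      ind (¬Real.exp (m * ((avg p fun ω => Real.log (a ω / b ω)) - γ)) * ∏ j, b (ω j)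
        < ∏ j, a (ω j))) ≤ η := by
  filter_upwards [eventually_avg_deviation_le p (fun ω => Real.log (a ω / b ω)) (half_pos hγ) hη,
    Filter.eventually_gt_atTop 0]
    with m hm hm0
  refine le_trans (avg_le_avg_of_pos _ fun ω hω => ind_mono fun h => ?_) hm
  have hp := Dist.pos_of_pi_pos hω
  rw [sum_log_div (fun j => ha _ (hp j)) (fun j => hb _ (hp j)), not_lt] at h
  have h1 := Real.exp_le_exp.1 (le_of_mul_le_mul_right h (Finset.prod_pos fun j _ => hb _ (hp j)))
  have : (0 : ℝ) < m * γ := by positivity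
  rw [abs_of_nonpos (by linarith)]
  linarith

theorem eventually_upper_tail_le (ha : ∀ ω, 0 < p ω → 0 < a ω) (hb : ∀ ω, 0 < p ω → 0 < b ω)
    {γ η : ℝ} (hγ : 0 < γ) (hη : 0 < η) :
    ∀ᶠ m : ℕ in Filter.atTop, avg (Dist.pi fun _ : Fin m => p) (fun ω =>
      ind (Real.exp (m * ((avg p fun ω => Real.log (a ω / b ω)) + γ)) * ∏ j, b (ω j)
        < ∏ j, a (ω j))) ≤ η := by
  filter_upwards [eventually_avg_deviation_le p (fun ω => Real.log (a ω / b ω)) hγ hη] with m hm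
  refine le_trans (avg_le_avg_of_pos _ fun ω hω => ind_mono fun h => ?_) hm
  have hp := Dist.pos_of_pi_pos hω
  rw [sum_log_div (fun j => ha _ (hp j)) (fun j => hb _ (hp j))] at h
  have h1 := Real.exp_lt_exp.1 (lt_of_mul_lt_mul_right h
    (Finset.prod_nonneg fun j _ => (hb _ (hp j)).le))
  refine le_trans ?_ (le_abs_self _)
  linarith

/-- Markov's inequality for `K` relative to its own mean. With `K` a channel law at a fixed output,
it bounds the false acceptance of an independent codeword. -/
theorem avg_ind_lt_le (p : Dist X) (K : X → ℝ) (hK : ∀ x, 0 ≤ K x) (τ : ℝ) :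
    avg p (fun x => ind (Real.exp τ * avg p K < K x)) ≤ Real.exp (-τ) := by
  have h0 : 0 ≤ avg p K := avg_nonneg p hK
  rcases h0.eq_or_lt with h | h
  -- If the mean is zero, `K` vanishes on the support and the test never passes there.
  · have h1 : avg p (fun x => ind (Real.exp τ * avg p K < K x)) ≤ avg p fun _ => 0 := by
      refine avg_le_avg_of_pos p fun x hx => ?_
      rw [ind_false]
      rw [← h, mul_zero, not_lt]
      by_contra! h2
      exact (avg_pos hK hx h2).ne h
    rw [avg_const] at h1
    exact h1.trans (Real.exp_pos _).le
  · calc avg p (fun x => ind (Real.exp τ * avg p K < K x))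
        ≤ avg p fun x => K x * (Real.exp (-τ) / avg p K) := by
          refine avg_le_avg p fun x => ?_
          by_cases h1 : Real.exp τ * avg p K < K x
          · rw [ind_true h1, ← mul_div_assoc, le_div_iff₀ h, one_mul]
            have h2 := mul_lt_mul_of_pos_right h1 (Real.exp_pos (-τ))
            have h3 : Real.exp τ * avg p K * Real.exp (-τ) = avg p K := by
              rw [mul_right_comm, ← Real.exp_add, add_neg_cancel, Real.exp_zero, one_mul]
            linarith
          · rw [ind_false h1]
            have := hK x; have := Real.exp_pos (-τ)
            positivity
      _ = Real.exp (-τ) := by rw [avg_mul_const]; field_simp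

theorem avg_pi_ind_lt_le {m : ℕ} (p : Dist X) (K : Fin m → X → ℝ) (hK : ∀ j x, 0 ≤ K j x) (τ : ℝ) :
    avg (Dist.pi fun _ : Fin m => p) (fun x =>
      ind (Real.exp τ * ∏ j, avg p (K j) < ∏ j, K j (x j))) ≤ Real.exp (-τ) := by
  have h := avg_ind_lt_le (Dist.pi fun _ : Fin m => p) (fun x => ∏ j, K j (x j))
    (fun x => Finset.prod_nonneg fun j _ => hK _ _) τ
  rwa [avg_pi_prod (fun _ : Fin m => p) K] at h

end Deviation

/-! ### Product channels -/

section ProductChannel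

variable {X₁ X₂ Y Y₁ Y₂ V : Type*} [Fintype X₁] [Fintype X₂] [Fintype Y] [Fintype Y₁]
  [Fintype Y₂] [Fintype V]

/-- Regroup a sequence of triples into a triple of sequences. -/
def unzip₃ {α β γ : Type*} (m : ℕ) : (Fin m → α × β × γ) ≃ (Fin m → α) × (Fin m → β) × (Fin m → γ)
    where
  toFun o := (fun j => (o j).1, fun j => (o j).2.1, fun j => (o j).2.2)
  invFun o j := (o.1 j, o.2.1 j, o.2.2 j)
  left_inv _ := rfl
  right_inv _ := rfl

/-- `m` uses of the channel, as one use of a channel with longer letters. -/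
def Channel.pow (W : Channel X₁ X₂ Y Y₁ Y₂) (m : ℕ) :
    Channel (Fin m → X₁) (Fin m → X₂) (Fin m → Y) (Fin m → Y₁) (Fin m → Y₂) := fun x₁ x₂ =>
  Dist.map (Dist.pi fun j => W (x₁ j) (x₂ j)) (unzip₃ m)

theorem Channel.pow_apply (W : Channel X₁ X₂ Y Y₁ Y₂) (m : ℕ) (x₁ : Fin m → X₁) (x₂ : Fin m → X₂)
    (o : Fin m → Y × Y₁ × Y₂) :
    Channel.pow W m x₁ x₂ (unzip₃ m o) = ∏ j, W (x₁ j) (x₂ j) (o j) := by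
  change avg (Dist.pi fun j => W (x₁ j) (x₂ j)) (fun o' => ind (unzip₃ m o' = unzip₃ m o)) = _
  simp only [EmbeddingLike.apply_eq_iff_eq]
  simp [avg, ind, Dist.pi_apply]

theorem avg_pow (W : Channel X₁ X₂ Y Y₁ Y₂) (m : ℕ) (x₁ : Fin m → X₁) (x₂ : Fin m → X₂)
    (F : (Fin m → Y) × (Fin m → Y₁) × (Fin m → Y₂) → ℝ) :
    avg (Channel.pow W m x₁ x₂) F
      = avg (Dist.pi fun j => W (x₁ j) (x₂ j)) fun o => F (unzip₃ m o) := avg_map _ _ _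

theorem avg_pi_compProd {ι α β : Type*} [Fintype ι] [DecidableEq ι] [Fintype α] [Fintype β]
    (p : ι → Dist α) (k : ι → α → Dist β) (F : (ι → α × β) → ℝ) :
    avg (Dist.pi fun i => Dist.compProd (p i) (k i)) F
      = avg (Dist.pi p) fun a => avg (Dist.pi fun i => k i (a i)) fun b =>
        F fun i => (a i, b i) := by
  simp only [avg, Finset.mul_sum]
  rw [← (Equiv.arrowProdEquivProdArrow ι (fun _ => α) (fun _ => β)).symm.sum_comp,
    Fintype.sum_prod_type]
  refine Finset.sum_congr rfl fun a _ => Finset.sum_congr rfl fun b _ => ?_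
  rw [← mul_assoc]
  congr 1
  change ∏ i, p i (a i) * k i (a i) (b i) = (∏ i, p i (a i)) * ∏ i, k i (a i) (b i)
  exact Finset.prod_mul_distrib

/-- The law of `(X₁, X₂, (Y, Y₁, Y₂), Ŷ₁)`. -/
def letterDist (W : Channel X₁ X₂ Y Y₁ Y₂) (p₁ : Dist X₁) (p₂ : Dist X₂) (q : Y₁ → X₂ → Dist V) :
    Dist (Letter X₁ X₂ Y Y₁ Y₂ V) :=
  Dist.compProd p₁ fun x₁ => Dist.compProd p₂ fun x₂ =>
    Dist.compProd (W x₁ x₂) fun o => q o.2.1 x₂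

theorem letterDist_apply (W : Channel X₁ X₂ Y Y₁ Y₂) (p₁ : Dist X₁) (p₂ : Dist X₂)
    (q : Y₁ → X₂ → Dist V) (ω : Letter X₁ X₂ Y Y₁ Y₂ V) :
    letterDist W p₁ p₂ q ω = letterProb W p₁ p₂ q ω := by
  obtain ⟨x₁, x₂, ⟨y, y₁, y₂⟩, v⟩ := ω
  change p₁ x₁ * (p₂ x₂ * (W x₁ x₂ (y, y₁, y₂) * q y₁ x₂ v))
    = p₁ x₁ * p₂ x₂ * W x₁ x₂ (y, y₁, y₂) * q y₁ x₂ v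
  ring

theorem avg_letterDist (W : Channel X₁ X₂ Y Y₁ Y₂) (p₁ : Dist X₁) (p₂ : Dist X₂)
    (q : Y₁ → X₂ → Dist V) (F : Letter X₁ X₂ Y Y₁ Y₂ V → ℝ) :
    avg (letterDist W p₁ p₂ q) F = avg p₁ fun x₁ => avg p₂ fun x₂ => avg (W x₁ x₂) fun o =>
      avg (q o.2.1 x₂) fun v => F (x₁, x₂, o, v) := by
  simp only [letterDist, avg_compProd]

theorem letterDist_pos {W : Channel X₁ X₂ Y Y₁ Y₂} {p₁ : Dist X₁} {p₂ : Dist X₂}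
    {q : Y₁ → X₂ → Dist V} {ω : Letter X₁ X₂ Y Y₁ Y₂ V} (h : 0 < letterDist W p₁ p₂ q ω) :
    0 < p₁ ω.1 ∧ 0 < p₂ ω.2.1 ∧ 0 < W ω.1 ω.2.1 ω.2.2.1 ∧ 0 < q ω.2.2.1.2.1 ω.2.1 ω.2.2.2 := by
  replace h : 0 < p₁ ω.1 * (p₂ ω.2.1 * (W ω.1 ω.2.1 ω.2.2.1 * q ω.2.2.1.2.1 ω.2.1 ω.2.2.2)) := h
  refine ⟨(Dist.nonneg _ _).lt_of_ne ?_, (Dist.nonneg _ _).lt_of_ne ?_,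
    (Dist.nonneg _ _).lt_of_ne ?_, (Dist.nonneg _ _).lt_of_ne ?_⟩ <;>
  · intro h0
    rw [← h0] at h
    simp at h

/-- The product test channel. -/
def testPow (q : Y₁ → X₂ → Dist V) (m : ℕ) (y₁ : Fin m → Y₁) (x₂ : Fin m → X₂) :
    Dist (Fin m → V) := Dist.pi fun j => q (y₁ j) (x₂ j)

/-- Transfers the law of large numbers for i.i.d. letters to one use of the block channel, the form
in which `Tests.Reliable` needs it. -/
theorem avg_letterDist_pow (W : Channel X₁ X₂ Y Y₁ Y₂) (p₁ : Dist X₁) (p₂ : Dist X₂)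
    (q : Y₁ → X₂ → Dist V) (m : ℕ)
    (F : (Fin m → X₁) → (Fin m → X₂) → (Fin m → Y × Y₁ × Y₂) → (Fin m → V) → ℝ) :
    avg (Dist.pi fun _ : Fin m => letterDist W p₁ p₂ q)
        (fun ω => F (fun j => (ω j).1) (fun j => (ω j).2.1) (fun j => (ω j).2.2.1)
          fun j => (ω j).2.2.2)
      = avg (Dist.pi fun _ : Fin m => p₁) fun x₁ => avg (Dist.pi fun _ : Fin m => p₂) fun x₂ =>
        avg (Channel.pow W m x₁ x₂) fun o => avg (testPow q m o.2.1 x₂) fun v =>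
          F x₁ x₂ ((unzip₃ m).symm o) v := by
  simp only [letterDist, avg_pow, testPow]
  rw [avg_pi_compProd]
  congr 1; funext x₁
  rw [avg_pi_compProd (fun _ => p₂) fun i x₂ => Dist.compProd (W (x₁ i) x₂) fun o => q o.2.1 x₂]
  congr 1; funext x₂
  rw [avg_pi_compProd (fun i => W (x₁ i) (x₂ i)) fun i o => q o.2.1 (x₂ i)]
  rfl

theorem compLaw_apply (W : Channel X₁ X₂ Y Y₁ Y₂) (p₁ : Dist X₁) (q : Y₁ → X₂ → Dist V) (x₂ : X₂)
    (v : V) : compLaw W p₁ q x₂ v = avg p₁ fun x₁ => avg (W x₁ x₂) fun o => q o.2.1 x₂ v :=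
  avg_relayLaw W p₁ x₂ fun y₁ => q y₁ x₂ v

theorem compLaw_pow (W : Channel X₁ X₂ Y Y₁ Y₂) (p₁ : Dist X₁) (q : Y₁ → X₂ → Dist V) (m : ℕ)
    (x₂ : Fin m → X₂) (v : Fin m → V) :
    compLaw (Channel.pow W m) (Dist.pi fun _ => p₁) (testPow q m) x₂ v
      = ∏ j, compLaw W p₁ q (x₂ j) (v j) := by
  simp only [compLaw_apply, avg_pow]
  rw [← avg_pi_prod (fun _ : Fin m => p₁) fun j x₁ => avg (W x₁ (x₂ j)) fun o =>
    q o.2.1 (x₂ j) (v j)]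
  congr 1; funext x₁
  rw [← avg_pi_prod (fun j => W (x₁ j) (x₂ j)) fun j o => q o.2.1 (x₂ j) (v j)]
  rfl

end ProductChannel

/-! ### Reliability of the tests over long blocks -/

section Reliability

variable {X₁ X₂ Y Y₁ Y₂ V : Type*} [Fintype X₁] [Fintype X₂] [Fintype Y] [Fintype Y₁]
  [Fintype Y₂] [Fintype V]

/-- The law of `Y` given `X₂`. -/
def destKer (W : Channel X₁ X₂ Y Y₁ Y₂) (p₁ : Dist X₁) (x₂ : X₂) : Dist Y :=
  Dist.map (Dist.bind p₁ fun x₁ => W x₁ x₂) fun o => o.1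

/-- The law of `Y`. -/
def destLaw (W : Channel X₁ X₂ Y Y₁ Y₂) (p₁ : Dist X₁) (p₂ : Dist X₂) : Dist Y :=
  Dist.bind p₂ (destKer W p₁)

/-- The law of `Y₂` given `X₁, X₂`. -/
def eveKer (W : Channel X₁ X₂ Y Y₁ Y₂) (x₁ : X₁) (x₂ : X₂) : Dist Y₂ :=
  Dist.map (W x₁ x₂) fun o => o.2.2

/-- The law of `Y₂` given `X₁`. -/
def eveKerSource (W : Channel X₁ X₂ Y Y₁ Y₂) (p₂ : Dist X₂) (x₁ : X₁) : Dist Y₂ :=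
  Dist.bind p₂ (eveKer W x₁)

/-- The law of `Y₂`. -/
def eveLaw (W : Channel X₁ X₂ Y Y₁ Y₂) (p₁ : Dist X₁) (p₂ : Dist X₂) : Dist Y₂ :=
  Dist.bind p₁ (eveKerSource W p₂)

/-- The law of `(Ŷ₁, Y)` given `X₁, X₂`. -/
def srcKer (W : Channel X₁ X₂ Y Y₁ Y₂) (q : Y₁ → X₂ → Dist V) (x₁ : X₁) (x₂ : X₂) : Dist (V × Y) :=
  Dist.map (Dist.compProd (W x₁ x₂) fun o => q o.2.1 x₂) fun a => (a.2, a.1.1)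

/-- The law of `(Ŷ₁, Y)` given `X₂`. -/
def srcLaw (W : Channel X₁ X₂ Y Y₁ Y₂) (p₁ : Dist X₁) (q : Y₁ → X₂ → Dist V) (x₂ : X₂) :
    Dist (V × Y) :=
  Dist.bind p₁ fun x₁ => srcKer W q x₁ x₂

variable (W : Channel X₁ X₂ Y Y₁ Y₂) (p₁ : Dist X₁) (p₂ : Dist X₂) (q : Y₁ → X₂ → Dist V)

open Letter

/-- `I(X₂; Y)` in nats. -/
def infoDest : ℝ := avg (letterDist W p₁ p₂ q) fun ω =>
  Real.log (destKer W p₁ ω.x₂ ω.y / destLaw W p₁ p₂ ω.y)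

/-- `I(X₂; Y₂ | X₁)` in nats. -/
def infoEve : ℝ := avg (letterDist W p₁ p₂ q) fun ω =>
  Real.log (eveKer W ω.x₁ ω.x₂ ω.y₂ / eveKerSource W p₂ ω.x₁ ω.y₂)

/-- `I(X₁; Ŷ₁, Y | X₂)` in nats. -/
def infoSource : ℝ := avg (letterDist W p₁ p₂ q) fun ω =>
  Real.log (srcKer W q ω.x₁ ω.x₂ (ω.yHat, ω.y) / srcLaw W p₁ q ω.x₂ (ω.yHat, ω.y))

/-- `I(Y₁; Ŷ₁ | X₂)` in nats. -/
def infoComp : ℝ := avg (letterDist W p₁ p₂ q) fun ω =>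
  Real.log (q ω.y₁ ω.x₂ ω.yHat / compLaw W p₁ q ω.x₂ ω.yHat)

/-- `I(X₁, X₂; Y₂)` in nats. -/
def infoLeak : ℝ := avg (letterDist W p₁ p₂ q) fun ω =>
  Real.log (eveKer W ω.x₁ ω.x₂ ω.y₂ / eveLaw W p₁ p₂ ω.y₂)

variable {W p₁ p₂ q} {ω : Letter X₁ X₂ Y Y₁ Y₂ V}

theorem Dist.map_pos {α β : Type*} [Fintype α] [Fintype β] {p : Dist α} (f : α → β) {a : α}
    (h : 0 < p a) : 0 < Dist.map p f (f a) :=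
  avg_pos (fun _ => ind_nonneg _) h (by rw [ind_true rfl]; norm_num)

theorem Dist.bind_pos {α β : Type*} [Fintype α] [Fintype β] {p : Dist α} {k : α → Dist β} {a : α}
    {b : β} (h : 0 < p a) (h' : 0 < k a b) : 0 < Dist.bind p k b :=
  avg_pos (fun a => Dist.nonneg (k a) b) h h'

theorem destKer_pos (h : 0 < letterDist W p₁ p₂ q ω) : 0 < destKer W p₁ ω.x₂ ω.y :=
  Dist.map_pos _ (Dist.bind_pos (k := fun x₁ => W x₁ ω.2.1) (letterDist_pos h).1
    (letterDist_pos h).2.2.1)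

theorem destLaw_pos (h : 0 < letterDist W p₁ p₂ q ω) : 0 < destLaw W p₁ p₂ ω.y :=
  Dist.bind_pos (letterDist_pos h).2.1 (destKer_pos h)

theorem eveKer_pos (h : 0 < letterDist W p₁ p₂ q ω) : 0 < eveKer W ω.x₁ ω.x₂ ω.y₂ :=
  Dist.map_pos (fun o : Y × Y₁ × Y₂ => o.2.2) (letterDist_pos h).2.2.1

theorem eveKerSource_pos (h : 0 < letterDist W p₁ p₂ q ω) : 0 < eveKerSource W p₂ ω.x₁ ω.y₂ :=
  Dist.bind_pos (letterDist_pos h).2.1 (eveKer_pos h)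

theorem eveLaw_pos (h : 0 < letterDist W p₁ p₂ q ω) : 0 < eveLaw W p₁ p₂ ω.y₂ :=
  Dist.bind_pos (letterDist_pos h).1 (eveKerSource_pos h)

theorem srcKer_pos (h : 0 < letterDist W p₁ p₂ q ω) :
    0 < srcKer W q ω.x₁ ω.x₂ (ω.yHat, ω.y) :=
  Dist.map_pos (a := (ω.2.2.1, ω.2.2.2)) (fun a : (Y × Y₁ × Y₂) × V => (a.2, a.1.1))
    (mul_pos (letterDist_pos h).2.2.1 (letterDist_pos h).2.2.2)

theorem srcLaw_pos (h : 0 < letterDist W p₁ p₂ q ω) : 0 < srcLaw W p₁ q ω.x₂ (ω.yHat, ω.y) :=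
  Dist.bind_pos (letterDist_pos h).1 (srcKer_pos h)

theorem compLaw_pos (h : 0 < letterDist W p₁ p₂ q ω) : 0 < compLaw W p₁ q ω.x₂ ω.yHat :=
  Dist.bind_pos (a := ω.y₁) (Dist.map_pos (fun o : Y × Y₁ × Y₂ => o.2.1)
    (Dist.bind_pos (k := fun x₁ => W x₁ ω.2.1) (letterDist_pos h).1 (letterDist_pos h).2.2.1))
    (letterDist_pos h).2.2.2

variable (W p₁ p₂ q)

/-- Likelihood-ratio tests over blocks of length `m`, with the given thresholds. -/
def powTests (m : ℕ) (τ₂ τ₁ τₑ : ℝ) :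
    Tests (Fin m → X₁) (Fin m → X₂) (Fin m → Y) (Fin m → Y₂) (Fin m → V) where
  relayDest x₂ y := Real.exp τ₂ * ∏ j, destLaw W p₁ p₂ (y j) < ∏ j, destKer W p₁ (x₂ j) (y j)
  source x₁ x₂ v y := Real.exp τ₁ * ∏ j, srcLaw W p₁ q (x₂ j) (v j, y j)
    < ∏ j, srcKer W q (x₁ j) (x₂ j) (v j, y j)
  relayEve x₁ x₂ y₂ := Real.exp τₑ * ∏ j, eveKerSource W p₂ (x₁ j) (y₂ j)
    < ∏ j, eveKer W (x₁ j) (x₂ j) (y₂ j)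

variable {W p₁ p₂ q} {m : ℕ} {τ₁ τ₂ τₑ : ℝ}

theorem powTests_relayDest_false (y : Fin m → Y) : avg (Dist.pi fun _ : Fin m => p₂) (fun x₂ =>
    ind ((powTests W p₁ p₂ q m τ₂ τ₁ τₑ).relayDest x₂ y)) ≤ Real.exp (-τ₂) :=
  avg_pi_ind_lt_le p₂ (fun j x₂ => destKer W p₁ x₂ (y j)) (fun _ _ => Dist.nonneg _ _) τ₂

theorem powTests_relayEve_false (x₁ : Fin m → X₁) (y₂ : Fin m → Y₂) :
    avg (Dist.pi fun _ : Fin m => p₂) (fun x₂ =>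
    ind ((powTests W p₁ p₂ q m τ₂ τ₁ τₑ).relayEve x₁ x₂ y₂)) ≤ Real.exp (-τₑ) :=
  avg_pi_ind_lt_le p₂ (fun j x₂ => eveKer W (x₁ j) x₂ (y₂ j)) (fun _ _ => Dist.nonneg _ _) τₑ

theorem powTests_source_false (x₂ : Fin m → X₂) (v : Fin m → V) (y : Fin m → Y) :
    avg (Dist.pi fun _ : Fin m => p₁) (fun x₁ =>
    ind ((powTests W p₁ p₂ q m τ₂ τ₁ τₑ).source x₁ x₂ v y)) ≤ Real.exp (-τ₁) :=
  avg_pi_ind_lt_le p₁ (fun j x₁ => srcKer W q x₁ (x₂ j) (v j, y j)) (fun _ _ => Dist.nonneg _ _) τ₁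

variable {γ η : ℝ}

theorem eventually_relayDest_miss_le (hγ : 0 < γ) (hη : 0 < η) : ∀ᶠ m : ℕ in Filter.atTop, ∀ τ₁ τₑ,
    avg (Dist.pi fun _ : Fin m => p₁) (fun x₁ => avg (Dist.pi fun _ : Fin m => p₂) fun x₂ =>
      avg (Channel.pow W m x₁ x₂) fun o =>
        ind (¬(powTests W p₁ p₂ q m (m * (infoDest W p₁ p₂ q - γ)) τ₁ τₑ).relayDest x₂ o.1))
      ≤ η := by
  filter_upwards [eventually_lower_tail_le (p := letterDist W p₁ p₂ q)
    (a := fun ω => destKer W p₁ ω.x₂ ω.y) (b := fun ω => destLaw W p₁ p₂ ω.y)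
    (fun ω h => destKer_pos h) (fun ω h => destLaw_pos h) hγ hη] with m hm τ₁ τₑ
  refine le_trans (le_of_eq ?_) hm
  refine Eq.trans ?_ (avg_letterDist_pow W p₁ p₂ q m fun x₁ x₂ o v =>
    ind (¬(powTests W p₁ p₂ q m (m * (infoDest W p₁ p₂ q - γ)) τ₁ τₑ).relayDest x₂
      fun j => (o j).1)).symm
  simp only [avg_const]
  rfl

theorem eventually_relayEve_miss_le (hγ : 0 < γ) (hη : 0 < η) : ∀ᶠ m : ℕ in Filter.atTop, ∀ τ₁ τ₂,
    avg (Dist.pi fun _ : Fin m => p₁) (fun x₁ => avg (Dist.pi fun _ : Fin m => p₂) fun x₂ =>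
      avg (Channel.pow W m x₁ x₂) fun o =>
        ind (¬(powTests W p₁ p₂ q m τ₂ τ₁ (m * (infoEve W p₁ p₂ q - γ))).relayEve x₁ x₂ o.2.2))
      ≤ η := by
  filter_upwards [eventually_lower_tail_le (p := letterDist W p₁ p₂ q)
    (a := fun ω => eveKer W ω.x₁ ω.x₂ ω.y₂) (b := fun ω => eveKerSource W p₂ ω.x₁ ω.y₂)
    (fun ω h => eveKer_pos h) (fun ω h => eveKerSource_pos h) hγ hη] with m hm τ₁ τ₂
  refine le_trans (le_of_eq ?_) hm
  refine Eq.trans ?_ (avg_letterDist_pow W p₁ p₂ q m fun x₁ x₂ o v =>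
    ind (¬(powTests W p₁ p₂ q m τ₂ τ₁ (m * (infoEve W p₁ p₂ q - γ))).relayEve x₁ x₂
      fun j => (o j).2.2)).symm
  simp only [avg_const]
  rfl

theorem eventually_source_miss_le (hγ : 0 < γ) (hη : 0 < η) : ∀ᶠ m : ℕ in Filter.atTop, ∀ τ₂ τₑ,
    avg (Dist.pi fun _ : Fin m => p₁) (fun x₁ => avg (Dist.pi fun _ : Fin m => p₂) fun x₂ =>
      avg (Channel.pow W m x₁ x₂) fun o => avg (testPow q m o.2.1 x₂) fun v =>
        ind (¬(powTests W p₁ p₂ q m τ₂ (m * (infoSource W p₁ p₂ q - γ)) τₑ).source x₁ x₂ v o.1))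
      ≤ η := by
  filter_upwards [eventually_lower_tail_le (p := letterDist W p₁ p₂ q)
    (a := fun ω => srcKer W q ω.x₁ ω.x₂ (ω.yHat, ω.y))
    (b := fun ω => srcLaw W p₁ q ω.x₂ (ω.yHat, ω.y))
    (fun ω h => srcKer_pos h) (fun ω h => srcLaw_pos h) hγ hη] with m hm τ₂ τₑ
  refine le_trans (le_of_eq ?_) hm
  exact (avg_letterDist_pow W p₁ p₂ q m fun x₁ x₂ o v =>
    ind (¬(powTests W p₁ p₂ q m τ₂ (m * (infoSource W p₁ p₂ q - γ)) τₑ).source x₁ x₂ v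
      fun j => (o j).1)).symm

theorem eventually_comp_tail_le (hγ : 0 < γ) (hη : 0 < η) : ∀ᶠ m : ℕ in Filter.atTop,
    avg (Dist.pi fun _ : Fin m => p₁) (fun x₁ => avg (Dist.pi fun _ : Fin m => p₂) fun x₂ =>
      avg (Channel.pow W m x₁ x₂) fun o => avg (testPow q m o.2.1 x₂) fun v =>
        ind (Real.exp (m * (infoComp W p₁ p₂ q + γ)) *
          compLaw (Channel.pow W m) (Dist.pi fun _ => p₁) (testPow q m) x₂ v
            < testPow q m o.2.1 x₂ v)) ≤ η := by
  filter_upwards [eventually_upper_tail_le (p := letterDist W p₁ p₂ q)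
    (a := fun ω => q ω.y₁ ω.x₂ ω.yHat) (b := fun ω => compLaw W p₁ q ω.x₂ ω.yHat)
    (fun ω h => (letterDist_pos h).2.2.2) (fun ω h => compLaw_pos h) hγ hη] with m hm
  refine le_trans (le_of_eq ?_) hm
  simp only [compLaw_pow]
  exact (avg_letterDist_pow W p₁ p₂ q m fun x₁ x₂ o v =>
    ind (Real.exp (m * (infoComp W p₁ p₂ q + γ)) * ∏ j, compLaw W p₁ q (x₂ j) (v j)
            < ∏ j, q (o j).2.1 (x₂ j) (v j))).symm

theorem eventually_exp_neg_le (hγ : 0 < γ) (hη : 0 < η) :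
    ∀ᶠ m : ℕ in Filter.atTop, Real.exp (-(m * γ)) ≤ η := by
  have h : Filter.Tendsto (fun m : ℕ => Real.exp (-(m * γ))) Filter.atTop (nhds 0) :=
    Real.tendsto_exp_neg_atTop_nhds_zero.comp
      (tendsto_natCast_atTop_atTop.atTop_mul_const hγ)
  exact h.eventually_le_const hη

theorem card_mul_exp_le {c τ τ' : ℝ} {n : ℕ} (h : (n : ℝ) ≤ c * Real.exp τ') :
    ((n : ℝ) - 1) * Real.exp (-τ) ≤ c * Real.exp (-(τ - τ')) := by
  have h1 : c * Real.exp (-(τ - τ')) = c * Real.exp τ' * Real.exp (-τ) := by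
    rw [mul_assoc, ← Real.exp_add]; ring_nf
  rw [h1]
  exact mul_le_mul_of_nonneg_right (by linarith) (Real.exp_pos _).le

/-- For rates below the corresponding informations, the tests are reliable. -/
theorem eventually_exists_reliable (hγ : 0 < γ) (hη : 0 < η) : ∀ᶠ m : ℕ in Filter.atTop,
    ∀ (a k l : ℕ) [NeZero k],
    (a : ℝ) ≤ Real.exp (m * (infoSource W p₁ p₂ q - 2 * γ)) →
    ((k * l : ℕ) : ℝ) ≤ 4 * Real.exp (m * (infoDest W p₁ p₂ q - 2 * γ)) →
    ((k * l : ℕ) : ℝ) ≤ 4 * Real.exp (m * (infoEve W p₁ p₂ q - 2 * γ)) →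
    Real.exp (m * (infoComp W p₁ p₂ q + 2 * γ)) ≤ k →
    ∃ T : Tests (Fin m → X₁) (Fin m → X₂) (Fin m → Y) (Fin m → Y₂) (Fin m → V),
      T.Reliable (Channel.pow W m) (Dist.pi fun _ => p₁) (Dist.pi fun _ => p₂) (testPow q m)
        (Fin a) (Fin k) (Fin l) η := by
  -- The bound `Tests.source_miss_le` has four terms, each allotted `η / 4`. One is a miss
  -- probability divided by the cost threshold `η / 4`, so that probability is requested below `(η /
  -- 4)²`.
  filter_upwards [eventually_relayDest_miss_le (W := W) (p₁ := p₁) (p₂ := p₂) (q := q) hγ hη,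
    eventually_relayEve_miss_le (W := W) (p₁ := p₁) (p₂ := p₂) (q := q) hγ hη,
    eventually_source_miss_le (W := W) (p₁ := p₁) (p₂ := p₂) (q := q) hγ
      (show 0 < η / 4 * (η / 4) by positivity),
    eventually_comp_tail_le (W := W) (p₁ := p₁) (p₂ := p₂) (q := q) hγ
      (show 0 < η / 4 by positivity),
    eventually_exp_neg_le hγ (show 0 < η / 4 by positivity)]
    with m h1 h2 h3 h4 h5 a k l hk ha h2' h3' hk'
  refine ⟨powTests W p₁ p₂ q m (m * (infoDest W p₁ p₂ q - γ)) (m * (infoSource W p₁ p₂ q - γ))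
    (m * (infoEve W p₁ p₂ q - γ)), h1 _ _, ⟨_, powTests_relayDest_false, ?_⟩, h2 _ _,
    ⟨_, powTests_relayEve_false, ?_⟩, ?_, ⟨_, powTests_source_false, ?_⟩⟩
  · rw [Fintype.card_prod, Fintype.card_fin, Fintype.card_fin]
    refine (card_mul_exp_le h2').trans ?_
    rw [show (m : ℝ) * (infoDest W p₁ p₂ q - γ) - m * (infoDest W p₁ p₂ q - 2 * γ) = m * γ by ring]
    linarith
  · rw [Fintype.card_prod, Fintype.card_fin, Fintype.card_fin]
    refine (card_mul_exp_le h3').trans ?_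
    rw [show (m : ℝ) * (infoEve W p₁ p₂ q - γ) - m * (infoEve W p₁ p₂ q - 2 * γ) = m * γ by ring]
    linarith
  · refine (Tests.source_miss_le (τ := m * (infoComp W p₁ p₂ q + γ))
      (show 0 < η / 4 by positivity)).trans ?_
    -- The list is larger than `exp τ` by the factor `exp (m * γ) ≥ m * γ`; this weak comparison
    -- already suffices.
    have h6 : Real.exp (-((Fintype.card (Fin k) : ℝ) *
        Real.exp (-(m * (infoComp W p₁ p₂ q + γ))))) ≤ η / 4 := by
      refine le_trans (Real.exp_le_exp.2 (neg_le_neg ?_)) h5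
      rw [Fintype.card_fin]
      calc (m : ℝ) * γ ≤ Real.exp (m * γ) := by linarith [Real.add_one_le_exp (m * γ)]
        _ = Real.exp (m * (infoComp W p₁ p₂ q + 2 * γ)) *
            Real.exp (-(m * (infoComp W p₁ p₂ q + γ))) := by
            rw [← Real.exp_add]; ring_nf
        _ ≤ _ := mul_le_mul_of_nonneg_right hk' (Real.exp_pos _).le
    have h7 := div_le_of_le_mul₀ (by positivity) (by positivity)
      (h3 (m * (infoDest W p₁ p₂ q - γ)) (m * (infoEve W p₁ p₂ q - γ)))
    linarith
  · rw [Fintype.card_fin]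
    refine (card_mul_exp_le (c := 1) (by rwa [one_mul])).trans ?_
    rw [show (m : ℝ) * (infoSource W p₁ p₂ q - γ) - m * (infoSource W p₁ p₂ q - 2 * γ) = m * γ by
      ring]
    linarith

/-- Without compression and relay noise, only the source rate matters. -/
theorem eventually_exists_reliable_of_unique [Unique V] (hγ : 0 < γ) (hη : 0 < η) :
    ∀ᶠ m : ℕ in Filter.atTop, ∀ a : ℕ,
    (a : ℝ) ≤ Real.exp (m * (infoSource W p₁ p₂ q - 2 * γ)) →
    ∃ T : Tests (Fin m → X₁) (Fin m → X₂) (Fin m → Y) (Fin m → Y₂) (Fin m → V),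
      T.Reliable (Channel.pow W m) (Dist.pi fun _ => p₁) (Dist.pi fun _ => p₂) (testPow q m)
        (Fin a) (Fin 1) (Fin 1) η := by
  filter_upwards [eventually_source_miss_le (W := W) (p₁ := p₁) (p₂ := p₂) (q := q) hγ hη,
    eventually_exp_neg_le hγ hη] with m h3 h5 a ha
  -- There is only one relay index, so its tests may always pass: the false-acceptance probability 1
  -- is multiplied by the number of wrong indices, which is 0.
  refine ⟨⟨fun _ _ => True, (powTests W p₁ p₂ q m 0 (m * (infoSource W p₁ p₂ q - γ)) 0).source,
    fun _ _ _ => True⟩, ?_, ⟨1, fun y => ?_, ?_⟩, ?_, ⟨1, fun x₁ y => ?_, ?_⟩, ?_,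
    ⟨_, powTests_source_false (p₂ := p₂) (τ₂ := 0) (τₑ := 0), ?_⟩⟩
  · simpa [ind, avg_const] using hη.le
  · simp [ind, avg_const]
  · simpa using hη.le
  · simpa [ind, avg_const] using hη.le
  · simp [ind, avg_const]
  · simpa using hη.le
  · refine le_trans (le_of_eq ?_) (h3 0 0)
    rw [avg_comm]
    congr 1; funext x₂
    -- Sequences over a one-letter alphabet are all equal, so the minimisation is vacuous.
    have h6 : ∀ (y₁ : Fin m → Y₁) (f : Fin 1 → Fin m → V) (z : Fin 1),
        Tests.score ⟨fun _ _ => True,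
          (powTests W p₁ p₂ q m 0 (m * (infoSource W p₁ p₂ q - γ)) 0).source,
          fun _ _ _ => True⟩ (Channel.pow W m) (Dist.pi fun _ => p₁) x₂ y₁ (f z)
        = avg (Dist.pi fun _ => p₁) fun x₁ => avg (Channel.pow W m x₁ x₂) fun o =>
          ind (o.2.1 = y₁ ∧ ¬(powTests W p₁ p₂ q m 0 (m * (infoSource W p₁ p₂ q - γ)) 0).source
            x₁ x₂ default o.1) := by
      intro y₁ f z
      rw [Subsingleton.elim (f z) default]
      rfl
    simp only [h6, avg_const]
    rw [← avg_sum]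
    congr 1; funext x₁
    rw [← avg_sum]
    congr 1; funext o
    rw [Finset.sum_eq_single o.2.1]
    · rw [← avg_const (testPow q m o.2.1 x₂) (ind _)]
      congr 1; funext v
      rw [Subsingleton.elim v default]
      exact ind_congr (by simp)
    · intro y₁ _ hy; exact ind_false fun h => hy h.1.symm
    · simp
  · rw [Fintype.card_fin]
    refine (card_mul_exp_le (c := 1) (by rwa [one_mul])).trans ?_
    rw [show (m : ℝ) * (infoSource W p₁ p₂ q - γ) - m * (infoSource W p₁ p₂ q - 2 * γ) = m * γ by
      ring]
    linarith

end Reliability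

/-! ### Equivocation of product and binned kernels -/

section EquivocationOps

variable {μ T : Type*} [Fintype μ] [Fintype T] [Nonempty μ]

/-- The joint law of a uniform input and the output of `E`. -/
def jointDist (E : μ → Dist T) : Dist (μ × T) := Dist.compProd (Dist.unif μ) E

/-- The posterior surprisal of the input. -/
def surprisal (E : μ → Dist T) (x : μ × T) : ℝ := -Real.log (post (fun w => E w) x.1 x.2)

/-- The variance of the posterior surprisal. -/
def dev (E : μ → Dist T) : ℝ :=
  avg (jointDist E) fun x => (surprisal E x - eqv fun w => E w) ^ 2

theorem eqv_eq_avg (E : μ → Dist T) : eqv (fun w => E w) = avg (jointDist E) (surprisal E) := by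
  rw [jointDist, avg_compProd, avg_unif]; rfl

theorem jointDist_pos {E : μ → Dist T} {x : μ × T} (h : 0 < jointDist E x) : 0 < E x.1 x.2 :=
  pos_of_mul_pos_right (b := E x.1 x.2) h (Dist.nonneg (Dist.unif μ) x.1)

theorem post_pos_of_jointDist_pos {E : μ → Dist T} {x : μ × T} (h : 0 < jointDist E x) :
    0 < post (fun w => E w) x.1 x.2 :=
  post_pos (fun w => Dist.nonneg (E w)) (jointDist_pos h)

theorem avg_surprisal_sub (E : μ → Dist T) :
    avg (jointDist E) (fun x => surprisal E x - eqv fun w => E w) = 0 := by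
  rw [avg_sub, avg_const, eqv_eq_avg, sub_self]

variable {μ' T' T'' : Type*} [Fintype μ'] [Fintype T'] [Fintype T''] [Nonempty μ']

theorem avg_jointDist_mul {E₁ : μ → Dist T} {E₂ : μ' → Dist T'} {E : μ × μ' → Dist T''}
    (Φ : T × T' ≃ T'') (hE : ∀ w w' t t', E (w, w') (Φ (t, t')) = E₁ w t * E₂ w' t')
    (F : (μ × μ') × T'' → ℝ) : avg (jointDist E) F
      = avg (jointDist E₁) fun x => avg (jointDist E₂) fun y => F ((x.1, y.1), Φ (x.2, y.2)) := by
  simp only [jointDist, avg_compProd]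
  simp only [avg_unif, Fintype.card_prod, Nat.cast_mul, Fintype.sum_prod_type]
  simp only [avg_const_mul, avg_sum]
  rw [Finset.mul_sum, Finset.mul_sum]
  refine Finset.sum_congr rfl fun w _ => ?_
  rw [← mul_assoc, one_div_mul_one_div]
  congr 1
  refine Finset.sum_congr rfl fun w' _ => ?_
  simp only [avg]
  rw [← Φ.sum_comp, Fintype.sum_prod_type]
  simp only [hE, Finset.mul_sum, mul_assoc]

theorem surprisal_mul {E₁ : μ → Dist T} {E₂ : μ' → Dist T'} {E : μ × μ' → Dist T''}
    (Φ : T × T' ≃ T'') (hE : ∀ w w' t t', E (w, w') (Φ (t, t')) = E₁ w t * E₂ w' t')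
    {x : μ × T} {y : μ' × T'} (hx : 0 < jointDist E₁ x) (hy : 0 < jointDist E₂ y) :
    surprisal E ((x.1, y.1), Φ (x.2, y.2)) = surprisal E₁ x + surprisal E₂ y := by
  have h1 : post (fun w => E w) (x.1, y.1) (Φ (x.2, y.2))
      = post (fun w => E₁ w) x.1 x.2 * post (fun w => E₂ w) y.1 y.2 := by
    simp only [post, Fintype.sum_prod_type, hE]
    rw [← Finset.sum_mul_sum, mul_div_mul_comm]
  rw [surprisal, h1, Real.log_mul (post_pos_of_jointDist_pos hx).ne'
    (post_pos_of_jointDist_pos hy).ne', surprisal, surprisal]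
  ring

theorem eqv_mul {E₁ : μ → Dist T} {E₂ : μ' → Dist T'} {E : μ × μ' → Dist T''}
    (Φ : T × T' ≃ T'') (hE : ∀ w w' t t', E (w, w') (Φ (t, t')) = E₁ w t * E₂ w' t') :
    eqv (fun w => E w) = eqv (fun w => E₁ w) + eqv fun w => E₂ w := by
  rw [eqv_eq_avg, eqv_eq_avg, eqv_eq_avg, avg_jointDist_mul Φ hE]
  rw [avg_congr_of_pos _ fun x hx => avg_congr_of_pos _ fun y hy => surprisal_mul Φ hE hx hy]
  simp only [avg_add, avg_const]

/-- Surprisals of independent transmissions are independent and add, so the cross term vanishes.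
Repetition therefore increases the variance linearly and the standard deviation only like a square
root. -/
theorem dev_mul {E₁ : μ → Dist T} {E₂ : μ' → Dist T'} {E : μ × μ' → Dist T''}
    (Φ : T × T' ≃ T'') (hE : ∀ w w' t t', E (w, w') (Φ (t, t')) = E₁ w t * E₂ w' t') :
    dev E = dev E₁ + dev E₂ := by
  rw [dev, avg_jointDist_mul Φ hE, eqv_mul Φ hE]
  rw [avg_congr_of_pos (G := fun x => avg (jointDist E₂) fun y =>
    (surprisal E₁ x - eqv fun w => E₁ w) ^ 2 + 2 * (surprisal E₁ x - eqv fun w => E₁ w) *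
      (surprisal E₂ y - eqv fun w => E₂ w) + (surprisal E₂ y - eqv fun w => E₂ w) ^ 2) _
    fun x hx => avg_congr_of_pos _ fun y hy => by rw [surprisal_mul Φ hE hx hy]; ring]
  have h : ∀ x, avg (jointDist E₂) (fun y =>
    (surprisal E₁ x - eqv fun w => E₁ w) ^ 2 + 2 * (surprisal E₁ x - eqv fun w => E₁ w) *
      (surprisal E₂ y - eqv fun w => E₂ w) + (surprisal E₂ y - eqv fun w => E₂ w) ^ 2)
      = (surprisal E₁ x - eqv fun w => E₁ w) ^ 2 + dev E₂ := by
    intro x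
    rw [avg_add, avg_add, avg_const, avg_const_mul, avg_surprisal_sub, mul_zero, add_zero]
    rfl
  simp only [h]
  rw [avg_add, avg_const]
  rfl

/-- If `x ≥ a⁻²` then `|log x| ≤ 2 log a`. Otherwise, with `s = x^(1/4)`, the bound `-log s ≤ 1/s`
gives `x log² x ≤ 16 √x < 16 / a`. -/
theorem mul_log_sq_le {x a : ℝ} (hx : 0 < x) (hx1 : x ≤ 1) (ha : 1 ≤ a) :
    x * Real.log x ^ 2 ≤ x * (4 * Real.log a ^ 2) + 16 / a := by
  have hl : Real.log x ≤ 0 := Real.log_nonpos hx.le hx1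
  have hla : 0 ≤ Real.log a := Real.log_nonneg ha
  by_cases h : 1 / a ^ 2 ≤ x
  · have h1 : -Real.log x ≤ 2 * Real.log a := by
      have := Real.log_le_log (by positivity) h
      rw [one_div, Real.log_inv, Real.log_pow] at this
      push_cast at this
      linarith
    have h2 : Real.log x ^ 2 ≤ 4 * Real.log a ^ 2 := by nlinarith
    have h3 : 0 ≤ 16 / a := by positivity
    nlinarith [mul_le_mul_of_nonneg_left h2 hx.le]
  · push Not at h
    set s := Real.sqrt (Real.sqrt x) with hs
    have hs0 : 0 < s := Real.sqrt_pos.2 (Real.sqrt_pos.2 hx)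
    have hs4 : s ^ 4 = x := by
      rw [show s ^ 4 = (s ^ 2) ^ 2 by ring, hs, Real.sq_sqrt (Real.sqrt_nonneg x),
        Real.sq_sqrt hx.le]
    have h1 : -Real.log x ≤ 4 / s := by
      have h2 := Real.log_le_sub_one_of_pos (inv_pos.2 hs0)
      rw [Real.log_inv] at h2
      have h3 : Real.log x = 4 * Real.log s := by rw [← hs4, Real.log_pow]; norm_num
      have h4 : 4 / s = 4 * s⁻¹ := div_eq_mul_inv _ _
      linarith
    have h2 : Real.log x ^ 2 ≤ (4 / s) ^ 2 := by
      rw [← neg_sq]; exact pow_le_pow_left₀ (by linarith) h1 2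
    have h3 : x * Real.log x ^ 2 ≤ 16 * s ^ 2 := by
      calc x * Real.log x ^ 2 ≤ x * (4 / s) ^ 2 := mul_le_mul_of_nonneg_left h2 hx.le
        _ = 16 * s ^ 2 := by rw [← hs4]; field_simp; ring
    have h4 : s ^ 2 ≤ 1 / a := by
      refine (sq_le_sq₀ (by positivity) (by positivity)).1 ?_
      rw [show (s ^ 2) ^ 2 = s ^ 4 by ring, hs4, div_pow, one_pow]
      exact h.le
    have h5 : 0 ≤ x * (4 * Real.log a ^ 2) := by positivity
    have h6 : 16 / a = 16 * (1 / a) := by ring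
    linarith

/-- Surprisal is unbounded, but improbable inputs contribute little to the second moment: apply
`mul_log_sq_le` to every posterior, with `a` the number of inputs, so that the remainders `16 / a`
add up to 16. -/
theorem dev_le (E : μ → Dist T) : dev E ≤ 4 * Real.log (Fintype.card μ) ^ 2 + 16 := by
  set a : ℝ := (Fintype.card μ : ℝ) with ha
  have ha1 : 1 ≤ a := by rw [ha]; exact_mod_cast Fintype.card_pos
  have h1 : dev E ≤ avg (jointDist E) fun x => surprisal E x ^ 2 := by
    have h2 : avg (jointDist E) (fun x => (surprisal E x - eqv fun w => E w) ^ 2)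
        = avg (jointDist E) (fun x => surprisal E x ^ 2) - (eqv fun w => E w) ^ 2 := by
      have h3 : ∀ x, (surprisal E x - eqv fun w => E w) ^ 2 = surprisal E x ^ 2
          - surprisal E x * (2 * eqv fun w => E w) + (eqv fun w => E w) ^ 2 := fun x => by ring
      simp only [h3]
      rw [avg_add, avg_sub, avg_const, avg_mul_const, ← eqv_eq_avg]
      ring
    rw [dev, h2]
    linarith [sq_nonneg (eqv fun w => E w)]
  refine h1.trans ?_
  set S : T → ℝ := fun t => ∑ w, E w t with hS
  have hS0 : ∀ t, 0 ≤ S t := fun t => Finset.sum_nonneg fun w _ => Dist.nonneg (E w) t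
  have hSsum : ∑ t, S t = a := by
    rw [hS, Finset.sum_comm]; simp [ha]
  have h4 : ∀ w t, E w t * surprisal E (w, t) ^ 2
      ≤ E w t * (4 * Real.log a ^ 2) + S t * (16 / a) := by
    intro w t
    rcases (Dist.nonneg (E w) t).eq_or_lt with h | h
    · rw [← h, zero_mul, zero_mul, zero_add]
      exact mul_nonneg (hS0 t) (by positivity)
    · have hp := post_pos (fun w => Dist.nonneg (E w)) h
      have hp1 := post_le_one (fun w => Dist.nonneg (E w)) w t
      have hSt : 0 < S t :=
        Finset.sum_pos' (fun w' _ => Dist.nonneg (E w') t) ⟨w, Finset.mem_univ w, h⟩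
      have h5 := mul_le_mul_of_nonneg_left (mul_log_sq_le hp hp1 ha1) hSt.le
      have h6 : E w t = S t * post (fun w => E w) w t := by
        rw [post, mul_div_cancel₀ _ hSt.ne']
      rw [surprisal, neg_sq, h6]
      linarith
  rw [jointDist, avg_compProd, avg_unif]
  calc 1 / a * ∑ w, avg (E w) (fun t => surprisal E (w, t) ^ 2)
      ≤ 1 / a * ∑ w, ∑ t, (E w t * (4 * Real.log a ^ 2) + S t * (16 / a)) :=
        mul_le_mul_of_nonneg_left (Finset.sum_le_sum fun w _ => Finset.sum_le_sum
          fun t _ => h4 w t) (by positivity)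
    _ = _ := by
      simp only [Finset.sum_add_distrib, ← Finset.sum_mul, Dist.sum_eq_one, hSsum,
        Finset.sum_const, Finset.card_univ, nsmul_eq_mul, ← ha]
      field_simp

theorem avg_abs_surprisal_sub_le (E : μ → Dist T) :
    avg (jointDist E) (fun x => |surprisal E x - eqv fun w => E w|) ≤ Real.sqrt (dev E) := by
  set f : μ × T → ℝ := fun x => |surprisal E x - eqv fun w => E w| with hf
  refine Real.le_sqrt_of_sq_le ?_
  have h1 : 0 ≤ avg (jointDist E) fun x => (f x - avg (jointDist E) f) ^ 2 :=
    avg_nonneg _ fun x => sq_nonneg _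
  have h2 : avg (jointDist E) (fun x => (f x - avg (jointDist E) f) ^ 2)
      = avg (jointDist E) (fun x => f x ^ 2) - avg (jointDist E) f ^ 2 := by
    have h3 : ∀ x, (f x - avg (jointDist E) f) ^ 2 = f x ^ 2
        - f x * (2 * avg (jointDist E) f) + avg (jointDist E) f ^ 2 := fun x => by ring
    simp only [h3]
    rw [avg_add, avg_sub, avg_const, avg_mul_const]
    ring
  have h3 : avg (jointDist E) (fun x => f x ^ 2) = dev E := by
    simp only [hf, sq_abs]; rfl
  linarith

end EquivocationOps

/-! ### Random binning -/

section Binning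

variable {μ ν κ T : Type*} [Fintype μ] [Fintype ν] [Fintype κ] [Fintype T] [DecidableEq μ]

/-- By transposing `u'` and `u''`, all partners collide with `u` equally often; and under every
permutation exactly `|κ| - 1` other inputs share the bin of `u`. -/
theorem sum_perm_same_bin (e : μ ≃ ν × κ) (u u' : μ) (h : u ≠ u') :
    ((Fintype.card μ : ℝ) - 1) * ∑ π : Equiv.Perm μ, ind ((e (π u)).1 = (e (π u')).1)
      = Fintype.card (Equiv.Perm μ) * (Fintype.card κ - 1) := by
  have h1 : ∀ u'' ∈ Finset.univ.erase u, ∑ π : Equiv.Perm μ, ind ((e (π u)).1 = (e (π u'')).1)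
      = ∑ π : Equiv.Perm μ, ind ((e (π u)).1 = (e (π u')).1) := by
    intro u'' hu''
    have hne := Finset.ne_of_mem_erase hu''
    refine Fintype.sum_equiv (Equiv.mulRight (Equiv.swap u' u'')) _ _ fun π => ?_
    simp [Equiv.Perm.mul_apply, Equiv.swap_apply_of_ne_of_ne h hne.symm]
  have h2 : ∀ π : Equiv.Perm μ, ∑ u'' ∈ Finset.univ.erase u, ind ((e (π u)).1 = (e (π u'')).1)
      = Fintype.card κ - 1 := by
    intro π
    have h3 : ∑ u'', ind ((e (π u)).1 = (e (π u'')).1) = Fintype.card κ := by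
      have h4 : ∑ u'', ind ((e (π u)).1 = (e (π u'')).1) = ∑ x : ν × κ, ind ((e (π u)).1 = x.1) :=
        Fintype.sum_equiv (π.trans e) _ _ fun _ => rfl
      rw [h4, Fintype.sum_prod_type_right]
      simp [ind]
    rw [← Finset.add_sum_erase _ _ (Finset.mem_univ u), ind_true rfl] at h3
    linarith
  calc _ = ∑ u'' ∈ Finset.univ.erase u,
        ∑ π : Equiv.Perm μ, ind ((e (π u)).1 = (e (π u'')).1) := by
        rw [Finset.sum_congr rfl h1, Finset.sum_const, Finset.card_erase_of_mem (Finset.mem_univ u),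
          Finset.card_univ, nsmul_eq_mul,
          Nat.cast_sub (Fintype.card_pos_iff.2 ⟨u⟩), Nat.cast_one]
    _ = _ := by
        rw [Finset.sum_comm, Finset.sum_congr rfl fun π _ => h2 π, Finset.sum_const,
          Finset.card_univ, nsmul_eq_mul]

/-- The kernel seen when a message `v` is sent as a uniform input in bin `v`. -/
def binKernel [Nonempty κ] (E : μ → Dist T) (e : μ ≃ ν × κ) (v : ν) : Dist T :=
  Dist.bind (Dist.unif κ) fun k => E (e.symm (v, k))

variable [Nonempty κ] [Nonempty ν] [Nonempty μ]

theorem avg_jointDist_binKernel (E : μ → Dist T) (e : μ ≃ ν × κ) (F : ν × T → ℝ) :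
    avg (jointDist (binKernel E e)) F = avg (jointDist E) fun x => F ((e x.1).1, x.2) := by
  have hc : (Fintype.card μ : ℝ) = Fintype.card ν * Fintype.card κ := by
    rw [Fintype.card_congr e, Fintype.card_prod, Nat.cast_mul]
  simp only [jointDist, avg_compProd, binKernel, avg_bind]
  simp only [avg_unif]
  rw [← e.symm.sum_comp, Fintype.sum_prod_type, hc, ← Finset.mul_sum, ← mul_assoc,
    one_div_mul_one_div]
  simp

theorem post_binKernel (E : μ → Dist T) (e : μ ≃ ν × κ) (v : ν) (t : T) :
    post (fun v => binKernel E e v) v t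
      = ∑ u', ind (v = (e u').1) * post (fun w => E w) u' t := by
  have h1 : ∀ v, binKernel E e v t = 1 / (Fintype.card κ : ℝ) * ∑ k, E (e.symm (v, k)) t :=
    fun v => avg_unif _
  have hk : (Fintype.card κ : ℝ) ≠ 0 := by exact_mod_cast Fintype.card_ne_zero
  have h2 : ∑ v, ∑ k, E (e.symm (v, k)) t = ∑ w, E w t := by
    rw [← e.symm.sum_comp, Fintype.sum_prod_type]
  have h3 : ∑ k, E (e.symm (v, k)) t = ∑ u', ind (v = (e u').1) * E u' t := by
    rw [← e.symm.sum_comp, Fintype.sum_prod_type, Finset.sum_eq_single v]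
    · simp [ind]
    · intro b _ hb; simp [ind, hb.symm]
    · simp
  simp only [post, h1, ← Finset.mul_sum, h2]
  rw [mul_div_mul_left _ _ (one_div_ne_zero hk), h3, Finset.sum_div]
  simp only [mul_div_assoc]

/-- Permute the inputs at random. The posterior of the true bin is that of the true input plus that
of its bin mates, on average at most `1 / N` more. By Jensen the surprisal of the bin is then on
average at least the smaller of the surprisal of the input and `log N`, up to `log 2`. -/
theorem exists_bin (E : μ → Dist T) (e : μ ≃ ν × κ) : ∃ e' : μ ≃ ν × κ,
    min (eqv fun w => E w) (Real.log (Fintype.card ν)) - Real.log 2 - Real.sqrt (dev E)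
      ≤ eqv fun v => binKernel E e' v := by
  set N : ℝ := (Fintype.card ν : ℝ) with hN
  have hN0 : 0 < N := by rw [hN]; exact_mod_cast Fintype.card_pos
  have hperm : (0 : ℝ) < Fintype.card (Equiv.Perm μ) := by exact_mod_cast Fintype.card_pos
  have hcol : ∀ u u', u ≠ u' → avg (Dist.unif (Equiv.Perm μ))
      (fun π => ind ((e (π u)).1 = (e (π u')).1)) ≤ 1 / N := by
    intro u u' h
    have h1 := sum_perm_same_bin e u u' h
    have hc : (Fintype.card μ : ℝ) = N * Fintype.card κ := by
      rw [Fintype.card_congr e, Fintype.card_prod, Nat.cast_mul]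
    have hm : 0 < (Fintype.card μ : ℝ) - 1 := by
      have : 1 < Fintype.card μ := Fintype.one_lt_card_iff.2 ⟨u, u', h⟩
      have : (1 : ℝ) < Fintype.card μ := by exact_mod_cast this
      linarith
    rw [avg_unif, one_div_mul_eq_div, div_le_div_iff₀ hperm hN0, one_mul]
    have hN1 : 1 ≤ N := by rw [hN]; exact_mod_cast Fintype.card_pos
    rw [← mul_le_mul_iff_right₀ hm, ← mul_assoc, h1, hc]
    nlinarith
  have hpost : ∀ x : μ × T, avg (Dist.unif (Equiv.Perm μ)) (fun π =>
      post (fun v => binKernel E (π.trans e) v) (e (π x.1)).1 x.2)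
      ≤ post (fun w => E w) x.1 x.2 + 1 / N := by
    intro x
    simp only [post_binKernel, avg_sum, avg_mul_const, Equiv.trans_apply]
    rw [← Finset.add_sum_erase _ _ (Finset.mem_univ x.1)]
    simp only [ind_true, avg_const, one_mul]
    refine add_le_add le_rfl ?_
    calc _ ≤ ∑ u' ∈ Finset.univ.erase x.1, 1 / N * post (fun w => E w) u' x.2 :=
          Finset.sum_le_sum fun u' hu' => mul_le_mul_of_nonneg_right
            (hcol _ _ (Finset.ne_of_mem_erase hu').symm)
            (post_nonneg (fun w => Dist.nonneg (E w)) _ _)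
      _ ≤ ∑ u', 1 / N * post (fun w => E w) u' x.2 :=
          Finset.sum_le_sum_of_subset_of_nonneg (Finset.subset_univ _) fun u' _ _ =>
            mul_nonneg (by positivity) (post_nonneg (fun w => Dist.nonneg (E w)) _ _)
      _ ≤ 1 / N := by
          rw [← Finset.mul_sum]
          exact mul_le_of_le_one_right (by positivity) (sum_post_le _ _)
  have hx : ∀ x : μ × T, 0 < jointDist E x →
      min (surprisal E x) (Real.log N) - Real.log 2 ≤ avg (Dist.unif (Equiv.Perm μ)) fun π =>
        surprisal (binKernel E (π.trans e)) ((e (π x.1)).1, x.2) := by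
    intro x hx
    have hp := post_pos_of_jointDist_pos hx
    set b := post (fun w => E w) x.1 x.2 + 1 / N with hb
    have hb0 : 0 < b := by positivity
    -- The tangent of `-log` at `b` stands in for Jensen's inequality.
    have h1 : ∀ π : Equiv.Perm μ, 1 - Real.log b -
        post (fun v => binKernel E (π.trans e) v) (e (π x.1)).1 x.2 / b
        ≤ surprisal (binKernel E (π.trans e)) ((e (π x.1)).1, x.2) := by
      intro π
      have h2 : 0 < post (fun v => binKernel E (π.trans e) v) (e (π x.1)).1 x.2 := by
        refine post_pos (fun v => Dist.nonneg (binKernel E (π.trans e) v)) ?_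
        refine Dist.bind_pos (a := (e (π x.1)).2) (one_div_pos.2 ?_) ?_
        · exact_mod_cast Fintype.card_pos
        · simpa using jointDist_pos hx
      have h3 := Real.log_le_sub_one_of_pos (div_pos h2 hb0)
      rw [Real.log_div h2.ne' hb0.ne'] at h3
      rw [surprisal]
      linarith
    refine le_trans ?_ (avg_le_avg _ h1)
    simp only [avg_sub, avg_const, div_eq_mul_inv, avg_mul_const]
    have h4 : avg (Dist.unif (Equiv.Perm μ)) (fun π =>
        post (fun v => binKernel E (π.trans e) v) (e (π x.1)).1 x.2) * b⁻¹ ≤ 1 := by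
      rw [← div_eq_mul_inv, div_le_one hb0]; exact hpost x
    have h5 : min (surprisal E x) (Real.log N) - Real.log 2 ≤ -Real.log b := by
      -- The loss `log 2` comes from bounding a sum by twice the maximum.
      have h6 : b ≤ 2 * max (post (fun w => E w) x.1 x.2) (1 / N) := by
        linarith [le_max_left (post (fun w => E w) x.1 x.2) (1 / N),
          le_max_right (post (fun w => E w) x.1 x.2) (1 / N)]
      have h7 := Real.log_le_log hb0 h6
      rw [Real.log_mul (by norm_num) (by positivity)] at h7
      rcases le_total (post (fun w => E w) x.1 x.2) (1 / N) with h8 | h8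
      · rw [max_eq_right h8, one_div, Real.log_inv] at h7
        linarith [min_le_right (surprisal E x) (Real.log N)]
      · rw [max_eq_left h8] at h7
        have h9 := min_le_left (surprisal E x) (Real.log N)
        rw [surprisal] at h9 ⊢
        linarith
    linarith
  obtain ⟨π, -, hπ⟩ := exists_pos_le_avg (Dist.unif (Equiv.Perm μ)) fun π =>
    -eqv fun v => binKernel E (π.trans e) v
  refine ⟨π.trans e, ?_⟩
  rw [avg_neg, neg_le_neg_iff] at hπ
  refine le_trans ?_ hπ
  simp only [eqv_eq_avg (binKernel E _), avg_jointDist_binKernel, Equiv.trans_apply]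
  rw [avg_comm]
  refine le_trans ?_ (avg_le_avg_of_pos _ hx)
  rw [avg_sub, avg_const]
  have h1 : min (eqv fun w => E w) (Real.log N) - Real.sqrt (dev E)
      ≤ avg (jointDist E) fun x => min (surprisal E x) (Real.log N) := by
    -- The minimum is 1-Lipschitz in the surprisal, so replacing the surprisal by its mean costs the
    -- mean absolute deviation.
    have h2 : ∀ x, min (eqv fun w => E w) (Real.log N) - |surprisal E x - eqv fun w => E w|
        ≤ min (surprisal E x) (Real.log N) := by
      intro x
      have h3 := neg_abs_le (surprisal E x - eqv fun w => E w)
      have h4 := abs_nonneg (surprisal E x - eqv fun w => E w)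
      refine le_min ?_ ?_
      · linarith [min_le_left (eqv fun w => E w) (Real.log N)]
      · linarith [min_le_right (eqv fun w => E w) (Real.log N)]
    refine le_trans ?_ (avg_le_avg _ h2)
    rw [avg_sub, avg_const]
    linarith [avg_abs_surprisal_sub_le E]
  linarith

end Binning

/-! ### Operations on codes -/

namespace GCode

variable {X₁ X₂ Y Y₁ Y₂ μ σ : Type*} [Fintype X₁] [Fintype X₂] [Fintype Y] [Fintype Y₁]
  [Fintype Y₂] [Fintype μ] [Fintype σ]

/-- The variance of the eavesdropper's posterior surprisal. -/
def var {n : ℕ} [Nonempty μ] (c : GCode X₁ X₂ Y Y₁ μ σ n) (W : Channel X₁ X₂ Y Y₁ Y₂) : ℝ :=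
  dev (c.eve W)

theorem traj_apply {n : ℕ} (c : GCode X₁ X₂ Y Y₁ μ σ n) (W : Channel X₁ X₂ Y Y₁ Y₂) (s : σ)
    (x : Fin n → X₁) (o : Fin n → Y × Y₁ × Y₂) : c.traj W s x o
      = ∏ i, W (x i) (c.relay i s (before (fun j => (o j).2.1) i)) (o i) := rfl

theorem eve_apply {n : ℕ} (c : GCode X₁ X₂ Y Y₁ μ σ n) (W : Channel X₁ X₂ Y Y₁ Y₂) (w : μ)
    (t : Fin n → Y₂) : c.eve W w t = avg (c.out W w) fun o => ind ((fun i => (o i).2.2) = t) := rfl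

/-! ### From block letters to letters. -/

section Flatten

variable {b m : ℕ}

/-- Concatenate `b` blocks of length `m`. -/
def flat (b m : ℕ) (α : Type*) : (Fin b → Fin m → α) ≃ (Fin (b * m) → α) :=
  (Equiv.curry (Fin b) (Fin m) α).symm.trans (finProdFinEquiv.arrowCongr (Equiv.refl α))

theorem flat_apply {α : Type*} (x : Fin b → Fin m → α) (i : Fin (b * m)) :
    flat b m α x i = x (finProdFinEquiv.symm i).1 (finProdFinEquiv.symm i).2 := rfl

theorem flat_finProdFinEquiv {α : Type*} (x : Fin b → Fin m → α) (k : Fin b) (j : Fin m) :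
    flat b m α x (finProdFinEquiv (k, j)) = x k j := by
  rw [flat_apply, Equiv.symm_apply_apply]

/-- A code for blocks of letters, as a code for letters. -/
def unblock (c : GCode (Fin m → X₁) (Fin m → X₂) (Fin m → Y) (Fin m → Y₁) μ σ b) :
    GCode X₁ X₂ Y Y₁ μ σ (b * m) where
  enc w := Dist.map (c.enc w) (flat b m X₁)
  seedLaw := c.seedLaw
  relay i s y := c.relay (finProdFinEquiv.symm i).1 s (fun k j => y ⟨j + m * k, by
    -- Causality: block `k` precedes the block of time `i`, so it is complete before time `i`.
    have hk : (k : ℕ) < i / m := k.2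
    have h2 : m * (i / m) ≤ i := Nat.mul_div_le i m
    have h3 : m * (k + 1) ≤ m * (i / m) := Nat.mul_le_mul_left m hk
    have := j.2
    rw [Nat.mul_add] at h3
    omega⟩) (finProdFinEquiv.symm i).2
  dec y := c.dec ((flat b m Y).symm y)

/-- Output sequences of the blocks, as an output sequence. -/
def flatOut (b m : ℕ) (α β γ : Type*) :
    (Fin b → (Fin m → α) × (Fin m → β) × (Fin m → γ)) ≃ (Fin (b * m) → α × β × γ) :=
  (Equiv.arrowCongr (Equiv.refl (Fin b)) (unzip₃ m).symm).trans (flat b m (α × β × γ))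

theorem flatOut_finProdFinEquiv {α β γ : Type*}
    (o : Fin b → (Fin m → α) × (Fin m → β) × (Fin m → γ)) (k : Fin b) (j : Fin m) :
    flatOut b m α β γ o (finProdFinEquiv (k, j)) = ((o k).1 j, (o k).2.1 j, (o k).2.2 j) := by
  rw [flatOut, Equiv.trans_apply, flat_finProdFinEquiv]
  rfl

variable (c : GCode (Fin m → X₁) (Fin m → X₂) (Fin m → Y) (Fin m → Y₁) μ σ b)
  (W : Channel X₁ X₂ Y Y₁ Y₂)

theorem unblock_traj (s : σ) (x : Fin b → Fin m → X₁)
    (o : Fin b → (Fin m → Y) × (Fin m → Y₁) × (Fin m → Y₂)) :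
    c.unblock.traj W s (flat b m X₁ x) (flatOut b m Y Y₁ Y₂ o)
      = c.traj (Channel.pow W m) s x o := by
  rw [traj_apply, traj_apply, ← finProdFinEquiv.prod_comp, Fintype.prod_prod_type]
  refine Finset.prod_congr rfl fun k _ => ?_
  have h1 := Channel.pow_apply W m (x k) (c.relay k s (before (fun j => (o j).2.1) k))
    ((unzip₃ m).symm (o k))
  rw [Equiv.apply_symm_apply] at h1
  rw [h1]
  refine Finset.prod_congr rfl fun j _ => ?_
  rw [flat_finProdFinEquiv, flatOut_finProdFinEquiv]
  -- Written as a function of the index pair, because the type of the past depends on the block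
  -- index and blocks direct rewriting.
  have h2 : c.unblock.relay (finProdFinEquiv (k, j)) s
      (before (fun i => (flatOut b m Y Y₁ Y₂ o i).2.1) (finProdFinEquiv (k, j)))
      = (fun k' : Fin b × Fin m => c.relay k'.1 s (before (fun j => (o j).2.1) k'.1) k'.2)
        (finProdFinEquiv.symm (finProdFinEquiv (k, j))) := by
    change c.relay _ s _ _ = c.relay _ s _ _
    refine congrFun (congrArg (c.relay _ s) ?_) _
    funext k' j'
    change (flatOut b m Y Y₁ Y₂ o _).2.1 = _
    have h3 := flatOut_finProdFinEquiv o
      (k'.castLE (finProdFinEquiv.symm (finProdFinEquiv (k, j))).1.2.le) j'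
    change _ = (o _).2.1 j'
    exact congrArg (fun a => a.2.1) h3
  rw [h2, Equiv.symm_apply_apply]
  rfl

theorem avg_unblock_out (w : μ) (F : (Fin (b * m) → Y × Y₁ × Y₂) → ℝ) :
    avg (c.unblock.out W w) F
      = avg (c.out (Channel.pow W m) w) fun o => F (flatOut b m Y Y₁ Y₂ o) := by
  rw [avg_out, avg_out]
  congr 1; funext s
  change avg (Dist.map _ _) _ = _
  rw [avg_map]
  congr 1; funext x
  rw [avg, ← (flatOut b m Y Y₁ Y₂).sum_comp]
  refine Finset.sum_congr rfl fun o _ => ?_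
  rw [unblock_traj]

theorem unblock_err : c.unblock.err W = c.err (Channel.pow W m) := by
  simp only [err, avg_unblock_out]
  congr 1
  refine Finset.sum_congr rfl fun w _ => ?_
  congr 1; funext o
  congr 2
  change c.dec ((flat b m Y).symm _) = c.dec _
  congr 1
  rw [Equiv.symm_apply_eq]
  rfl

theorem unblock_equiv : c.unblock.equiv W = c.equiv (Channel.pow W m) := by
  have h1 : ∀ w t, c.unblock.eve W w (flat b m Y₂ t) = c.eve (Channel.pow W m) w t := by
    intro w t
    rw [eve_apply, eve_apply, avg_unblock_out]
    congr 1; funext o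
    refine ind_congr ?_
    rw [← (flat b m Y₂).apply_eq_iff_eq]
    rfl
  simp only [equiv, eqv]
  congr 1
  refine Finset.sum_congr rfl fun w _ => ?_
  rw [← (flat b m Y₂).sum_comp]
  simp only [post, h1]

end Flatten

/-! ### Concatenation of codes. -/

section Concat

variable {μ' σ' : Type*} [Fintype μ'] [Fintype σ'] {n n' : ℕ}

/-- Use one code after the other. -/
def concat (c : GCode X₁ X₂ Y Y₁ μ σ n) (c' : GCode X₁ X₂ Y Y₁ μ' σ' n') :
    GCode X₁ X₂ Y Y₁ (μ × μ') (σ × σ') (n + n') where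
  enc w := Dist.map (Dist.prod (c.enc w.1) (c'.enc w.2)) fun x => Fin.append x.1 x.2
  seedLaw := Dist.prod c.seedLaw c'.seedLaw
  relay i s y := if h : i < n then c.relay ⟨i, h⟩ s.1 y else
    c'.relay ⟨i - n, by omega⟩ s.2 fun j => y ⟨n + j, by
      have h1 : (j : ℕ) < i - n := j.2
      omega⟩
  dec y := (c.dec fun i => y (i.castAdd n'), c'.dec fun i => y (i.natAdd n))

variable (c : GCode X₁ X₂ Y Y₁ μ σ n) (c' : GCode X₁ X₂ Y Y₁ μ' σ' n')
  (W : Channel X₁ X₂ Y Y₁ Y₂)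

/-- The second relay disregards the outputs of the first phase and the seeds are separate, so the
phases are independent. -/
theorem concat_traj (s : σ × σ') (x : Fin n → X₁) (x' : Fin n' → X₁) (o : Fin n → Y × Y₁ × Y₂)
    (o' : Fin n' → Y × Y₁ × Y₂) :
    (c.concat c').traj W s (Fin.append x x') (Fin.append o o')
      = c.traj W s.1 x o * c'.traj W s.2 x' o' := by
  rw [traj_apply, traj_apply, traj_apply, Fin.prod_univ_add]
  congr 1
  · refine Finset.prod_congr rfl fun i _ => ?_
    rw [Fin.append_left, Fin.append_left]
    congr 2
    change dite _ _ _ = _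
    rw [dif_pos (show ((i.castAdd n' : Fin (n + n')) : ℕ) < n from i.2)]
    congr 1
    funext j
    change (Fin.append o o' (Fin.castAdd n' (j.castLE i.2.le))).2.1 = _
    rw [Fin.append_left]
    rfl
  · refine Finset.prod_congr rfl fun i _ => ?_
    rw [Fin.append_right, Fin.append_right]
    congr 2
    change dite _ _ _ = _
    rw [dif_neg (show ¬((i.natAdd n : Fin (n + n')) : ℕ) < n by simp)]
    have h1 : (⟨((i.natAdd n : Fin (n + n')) : ℕ) - n, by simp⟩ : Fin n') = i := by
      ext; simp
    have h2 := congrArg (fun k => c'.relay k s.2 (before (fun j => (o' j).2.1) k)) h1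
    refine Eq.trans ?_ h2
    congr 1
    funext j
    change (Fin.append o o' (Fin.natAdd n (j.castLE
      (show ((i.natAdd n : Fin (n + n')) : ℕ) - n ≤ n' by simp [i.2.le])))).2.1 = _
    rw [Fin.append_right]
    rfl

theorem avg_concat_out (w : μ × μ') (F : (Fin (n + n') → Y × Y₁ × Y₂) → ℝ) :
    avg ((c.concat c').out W w) F
      = avg (c.out W w.1) fun o => avg (c'.out W w.2) fun o' => F (Fin.append o o') := by
  rw [avg_out]
  change avg (Dist.prod c.seedLaw c'.seedLaw) _ = _
  rw [avg_prod, avg_out]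
  congr 1; funext s
  have h1 : ∀ s', avg ((c.concat c').enc w) (fun x => avg ((c.concat c').traj W (s, s') x) F)
      = avg (c.enc w.1) fun x => avg (c'.enc w.2) fun x' => avg (c.traj W s x) fun o =>
        avg (c'.traj W s' x') fun o' => F (Fin.append o o') := by
    intro s'
    change avg (Dist.map _ _) _ = _
    rw [avg_map, avg_prod]
    congr 1; funext x
    congr 1; funext x'
    rw [avg, ← (Fin.appendEquiv n n').sum_comp, Fintype.sum_prod_type]
    refine Finset.sum_congr rfl fun o _ => ?_
    simp only [avg, Finset.mul_sum]
    refine Finset.sum_congr rfl fun o' _ => ?_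
    rw [← mul_assoc, ← concat_traj c c' W (s, s')]
    rfl
  simp only [h1]
  rw [avg_comm]
  congr 1; funext x
  simp only [avg_out]
  rw [avg_comm (c.traj W s x)]
  congr 1; funext s'
  rw [avg_comm (c.traj W s x)]

theorem concat_err_le [Nonempty μ] [Nonempty μ'] :
    (c.concat c').err W ≤ c.err W + c'.err W := by
  have h1 : ∀ w : μ × μ', avg ((c.concat c').out W w)
      (fun o => ind ((c.concat c').dec (fun i => (o i).1) ≠ w))
      ≤ avg (c.out W w.1) (fun o => ind (c.dec (fun i => (o i).1) ≠ w.1)) +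
        avg (c'.out W w.2) fun o => ind (c'.dec (fun i => (o i).1) ≠ w.2) := by
    intro w
    rw [avg_concat_out]
    calc _ ≤ avg (c.out W w.1) fun o => avg (c'.out W w.2) fun o' =>
          ind (c.dec (fun i => (o i).1) ≠ w.1) + ind (c'.dec (fun i => (o' i).1) ≠ w.2) := by
          refine avg_le_avg _ fun o => avg_le_avg _ fun o' =>
            le_trans (ind_mono fun h => ?_) (ind_or_le _ _)
          by_contra! hn
          refine h (Prod.ext ?_ ?_)
          · change c.dec _ = _
            rw [← hn.1]; simp [Fin.append_left]
          · change c'.dec _ = _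
            rw [← hn.2]; simp [Fin.append_right]
      _ = _ := by simp only [avg_add, avg_const]
  rw [err, err, err, ← avg_unif, ← avg_unif, ← avg_unif]
  refine (avg_le_avg _ h1).trans (le_of_eq ?_)
  have h2 : ∀ f : μ × μ' → ℝ, avg (Dist.unif (μ × μ')) f
      = avg (Dist.unif μ) fun w => avg (Dist.unif μ') fun w' => f (w, w') := by
    intro f
    simp only [avg_unif, Fintype.sum_prod_type, ← Finset.mul_sum, Fintype.card_prod, Nat.cast_mul]
    rw [← mul_assoc, one_div_mul_one_div]
  rw [h2]
  simp only [avg_add, avg_const]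

theorem concat_eve (w : μ) (w' : μ') (t : Fin n → Y₂) (t' : Fin n' → Y₂) :
    (c.concat c').eve W (w, w') (Fin.appendEquiv n n' (t, t')) = c.eve W w t * c'.eve W w' t' := by
  rw [eve_apply, eve_apply, eve_apply, avg_concat_out, ← avg_mul_const]
  congr 1; funext o
  rw [← avg_const_mul]
  congr 1; funext o'
  have h1 : (fun i => ((Fin.append o o' i).2.2 : Y₂))
      = Fin.appendEquiv n n' (fun i => (o i).2.2, fun i => (o' i).2.2) := by
    funext i
    refine Fin.addCases (fun j => ?_) (fun j => ?_) i <;> simp [Fin.appendEquiv]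
  rw [h1, (Fin.appendEquiv n n').apply_eq_iff_eq, Prod.mk.injEq]
  by_cases h : (fun i => (o i).2.2) = t
  · rw [ind_true h, one_mul]; exact ind_congr (and_iff_right h)
  · rw [ind_false h, zero_mul]; exact ind_false fun h' => h h'.1

theorem concat_equiv [Nonempty μ] [Nonempty μ'] :
    (c.concat c').equiv W = c.equiv W + c'.equiv W :=
  eqv_mul (Fin.appendEquiv n n') (concat_eve c c' W)

theorem concat_var [Nonempty μ] [Nonempty μ'] :
    (c.concat c').var W = c.var W + c'.var W :=
  dev_mul (Fin.appendEquiv n n') (concat_eve c c' W)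

end Concat

/-! ### Messages as bins. -/

section Bin

variable {ν κ : Type*} [Fintype ν] [Fintype κ] [Nonempty κ] {n : ℕ}

/-- Send a message as a uniformly chosen element of its bin. -/
def bin (c : GCode X₁ X₂ Y Y₁ μ σ n) (e : μ ≃ ν × κ) : GCode X₁ X₂ Y Y₁ ν σ n where
  enc v := Dist.bind (Dist.unif κ) fun k => c.enc (e.symm (v, k))
  seedLaw := c.seedLaw
  relay := c.relay
  dec y := (e (c.dec y)).1

variable (c : GCode X₁ X₂ Y Y₁ μ σ n) (e : μ ≃ ν × κ) (W : Channel X₁ X₂ Y Y₁ Y₂)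

theorem avg_bin_out (v : ν) (F : (Fin n → Y × Y₁ × Y₂) → ℝ) :
    avg ((c.bin e).out W v) F
      = avg (Dist.unif κ) fun k => avg (c.out W (e.symm (v, k))) F := by
  rw [avg_out]
  change avg c.seedLaw (fun s => avg (Dist.bind _ _) _) = _
  simp only [avg_bind, avg_out]
  rw [avg_comm]
  rfl

/-- Uniform in a uniform bin is uniform, and decoding the element correctly gives the bin. -/
theorem bin_err_le [Nonempty ν] [Nonempty μ] : (c.bin e).err W ≤ c.err W := by
  have hc : (Fintype.card μ : ℝ) = Fintype.card ν * Fintype.card κ := by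
    rw [Fintype.card_congr e, Fintype.card_prod, Nat.cast_mul]
  rw [err, err, ← e.symm.sum_comp, Fintype.sum_prod_type, hc, ← one_div_mul_one_div, mul_assoc]
  refine mul_le_mul_of_nonneg_left ?_ (by positivity)
  rw [Finset.mul_sum]
  refine Finset.sum_le_sum fun v _ => ?_
  rw [avg_bin_out, avg_unif]
  refine mul_le_mul_of_nonneg_left ?_ (by positivity)
  refine Finset.sum_le_sum fun k _ => avg_le_avg _ fun o => ind_mono fun h h' => h ?_
  change (e (c.dec _)).1 = v
  rw [h', Equiv.apply_symm_apply]

theorem bin_eve : (c.bin e).eve W = binKernel (c.eve W) e := by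
  funext v
  refine Dist.ext fun t => ?_
  rw [eve_apply, avg_bin_out]
  rfl

end Bin

end GCode

/-! ### Entropies as averages -/

section EntropyAverage

variable {Ω α β γ : Type*} [Fintype Ω] [Fintype α] [Fintype β] [Fintype γ]

theorem law_eq_map (p : Dist Ω) (X : Ω → α) (a : α) : law p X a = Dist.map p X a := by
  change _ = ∑ ω, p ω * ind (X ω = a)
  refine Finset.sum_congr rfl fun ω _ => ?_
  unfold ind
  split_ifs <;> simp

theorem entropy_eq_avg (p : Dist Ω) (X : Ω → α) :
    entropy p X = avg p (fun ω => -Real.log (Dist.map p X (X ω))) / Real.log 2 := by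
  rw [entropy, ← avg_map p X fun a => -Real.log (Dist.map p X a)]
  congr 1
  refine Finset.sum_congr rfl fun a _ => ?_
  rw [law_eq_map, Real.negMulLog]
  ring

theorem condEntropy_eq_avg (p : Dist Ω) (X : Ω → α) (Y : Ω → β) :
    condEntropy p X Y = avg p (fun ω => -Real.log
      (Dist.map p (fun ω => (X ω, Y ω)) (X ω, Y ω) / Dist.map p Y (Y ω))) / Real.log 2 := by
  rw [condEntropy, entropy_eq_avg, entropy_eq_avg, ← sub_div, ← avg_sub]
  congr 1
  refine avg_congr_of_pos p fun ω h => ?_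
  rw [Real.log_div (Dist.map_pos (fun ω => (X ω, Y ω)) h).ne' (Dist.map_pos Y h).ne']
  ring

end EntropyAverage

/-! ### Comparison with the codes of the statement -/

section Compare

variable {X₁ X₂ Y Y₁ Y₂ : Type*} [Fintype X₁] [Fintype X₂] [Fintype Y] [Fintype Y₁]
  [Fintype Y₂] {n : ℕ}

/-- A code as a code with finite message and seed types. -/
def Code.toGCode (c : Code X₁ X₂ Y Y₁ n) : GCode X₁ X₂ Y Y₁ (Fin c.M) (Fin c.seeds) n where
  enc := c.enc
  seedLaw := c.seedLaw
  relay := c.relay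
  dec := c.dec

variable (c : Code X₁ X₂ Y Y₁ n) (W : Channel X₁ X₂ Y Y₁ Y₂)

theorem Code.sum_probGiven (w : Fin c.M) (F : c.Event Y₂ → ℝ) :
    ∑ ω, c.probGiven W w ω * F ω = avg c.seedLaw fun s => avg (c.enc w) fun x =>
      avg (c.toGCode.traj W s x) fun o => F (s, x, o) := by
  simp only [Fintype.sum_prod_type, avg, Finset.mul_sum, Code.probGiven, mul_assoc]
  rfl

theorem Code.errorProb_eq : c.errorProb W = c.toGCode.err W := by
  rw [Code.errorProb, GCode.err, Finset.mul_sum, Fintype.card_fin]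
  refine Finset.sum_congr rfl fun w _ => ?_
  congr 1
  rw [GCode.avg_out]
  refine Eq.trans (Finset.sum_congr rfl fun ω _ => ?_)
    (c.sum_probGiven W w fun ω => ind (c.dec (fun i => (ω.2.2 i).1) ≠ w))
  unfold ind
  split_ifs <;> simp

/-- The joint law of message and transmission. -/
def Code.jointLaw [Nonempty (Fin c.M)] : Dist (Fin c.M × c.Event Y₂) :=
  Dist.compProd (Dist.unif _) fun w => Dist.compProd c.seedLaw fun s =>
    Dist.compProd (c.enc w) fun x => c.toGCode.traj W s x

theorem Code.jointLaw_eq [Nonempty (Fin c.M)] : c.prob W = c.jointLaw W := by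
  funext ω
  change 1 / (c.M : ℝ) * (c.seedLaw ω.2.1 * c.enc ω.1 ω.2.2.1 * _) =
    1 / (Fintype.card (Fin c.M) : ℝ) * (c.seedLaw ω.2.1 * (c.enc ω.1 ω.2.2.1 * _))
  rw [Fintype.card_fin, mul_assoc]
  rfl

theorem Code.avg_jointLaw [Nonempty (Fin c.M)] (F : Fin c.M → (Fin n → Y × Y₁ × Y₂) → ℝ) :
    avg (c.jointLaw W) (fun ω => F ω.1 ω.2.2.2)
      = avg (Dist.unif _) fun w => avg (c.toGCode.out W w) (F w) := by
  simp only [Code.jointLaw, avg_compProd, GCode.avg_out]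
  rfl

/-- The conditional probability of the message in `condEntropy` is the posterior, because the
uniform factor `1 / M` cancels; `log 2` converts nats to bits. -/
theorem Code.equivocationRate_eq :
    c.equivocationRate W = c.toGCode.equiv W / (n * Real.log 2) := by
  have : Nonempty (Fin c.M) := ⟨⟨0, c.M_pos⟩⟩
  rw [Code.equivocationRate, c.jointLaw_eq W, condEntropy_eq_avg,
    c.avg_jointLaw W (fun w o => -Real.log
      (Dist.map (c.jointLaw W) (fun ω => (ω.1, fun i => (ω.2.2.2 i).2.2)) (w, fun i => (o i).2.2) /
        Dist.map (c.jointLaw W) (fun ω i => (ω.2.2.2 i).2.2) fun i => (o i).2.2)),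
    GCode.equiv_eq, ← avg_unif, one_div_mul_eq_div, div_div, mul_comm (Real.log 2)]
  have hM : (Fintype.card (Fin c.M) : ℝ) ≠ 0 := by exact_mod_cast Fintype.card_ne_zero
  have h1 : ∀ w t, Dist.map (c.jointLaw W) (fun ω => (ω.1, fun i => (ω.2.2.2 i).2.2)) (w, t)
      = 1 / (Fintype.card (Fin c.M) : ℝ) * c.toGCode.eve W w t := by
    intro w t
    change avg (c.jointLaw W) (fun ω => ind ((ω.1, fun i => (ω.2.2.2 i).2.2) = (w, t))) = _
    rw [c.avg_jointLaw W fun w' o => ind ((w', fun i => (o i).2.2) = (w, t)), avg_unif]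
    congr 1
    rw [Finset.sum_eq_single w]
    · rw [GCode.eve_apply]
      congr 1; funext o
      exact ind_congr (by simp)
    · intro w' _ hw
      rw [← avg_const (c.toGCode.out W w') 0]
      congr 1; funext o
      exact ind_false fun h => hw (Prod.mk.inj h).1
    · simp
  have h2 : ∀ t, Dist.map (c.jointLaw W) (fun ω i => (ω.2.2.2 i).2.2) t
      = 1 / (Fintype.card (Fin c.M) : ℝ) * ∑ w, c.toGCode.eve W w t := by
    intro t
    change avg (c.jointLaw W) (fun ω => ind ((fun i => (ω.2.2.2 i).2.2) = t)) = _
    rw [c.avg_jointLaw W fun w' o => ind ((fun i => (o i).2.2) = t), avg_unif]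
    rfl
  simp only [h1, h2, mul_div_mul_left _ _ (one_div_ne_zero hM)]
  rfl

namespace GCode

variable {μ σ μ' σ' : Type*} [Fintype μ] [Fintype σ] [Fintype μ'] [Fintype σ']

/-- Rename messages and seeds. -/
def relabel (c : GCode X₁ X₂ Y Y₁ μ σ n) (e : μ ≃ μ') (f : σ ≃ σ') : GCode X₁ X₂ Y Y₁ μ' σ' n where
  enc w := c.enc (e.symm w)
  seedLaw := Dist.map c.seedLaw f
  relay i s := c.relay i (f.symm s)
  dec y := e (c.dec y)

variable (c : GCode X₁ X₂ Y Y₁ μ σ n) (e : μ ≃ μ') (f : σ ≃ σ')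

theorem avg_relabel_out (w : μ') (F : (Fin n → Y × Y₁ × Y₂) → ℝ) :
    avg ((c.relabel e f).out W w) F = avg (c.out W (e.symm w)) F := by
  rw [avg_out, avg_out]
  change avg (Dist.map _ _) _ = _
  rw [avg_map]
  congr 1; funext s
  change avg (c.enc (e.symm w)) (fun x => avg (Dist.causal fun i g =>
    W (x i) (c.relay i (f.symm (f s)) fun j => (g j).2.1)) F) = _
  rw [Equiv.symm_apply_apply]
  rfl

theorem relabel_err : (c.relabel e f).err W = c.err W := by
  rw [err, err, ← e.sum_comp, Fintype.card_congr e]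
  congr 1
  refine Finset.sum_congr rfl fun w _ => ?_
  rw [avg_relabel_out, Equiv.symm_apply_apply]
  congr 1; funext o
  exact ind_congr (not_congr e.apply_eq_iff_eq)

theorem relabel_equiv : (c.relabel e f).equiv W = c.equiv W := by
  have h : ∀ w t, (c.relabel e f).eve W (e w) t = c.eve W w t := by
    intro w t
    rw [eve_apply, avg_relabel_out, Equiv.symm_apply_apply]
    rfl
  simp only [equiv, eqv, post]
  rw [← e.sum_comp, Fintype.card_congr e]
  simp only [← e.sum_comp fun w' => (c.relabel e f).eve W w' _, h]

end GCode

end Compare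

/-! ### Existence of codes -/

section HasCode

variable {X₁ X₂ Y Y₁ Y₂ : Type*} [Fintype X₁] [Fintype X₂] [Fintype Y] [Fintype Y₁] [Fintype Y₂]

/-- There is a code of length `n` with `M` messages, error probability at most `e`, equivocation at
least `h` nats and variance of the posterior surprisal at most `d`. -/
def HasCode (W : Channel X₁ X₂ Y Y₁ Y₂) (n M : ℕ) (e h d : ℝ) : Prop :=
  ∃ (μ σ : Type) (_ : Fintype μ) (_ : Nonempty μ) (_ : Fintype σ) (c : GCode X₁ X₂ Y Y₁ μ σ n),
    Fintype.card μ = M ∧ c.err W ≤ e ∧ h ≤ c.equiv W ∧ c.var W ≤ d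

variable {W : Channel X₁ X₂ Y Y₁ Y₂} {n n' M M' : ℕ} {e e' h h' d d' : ℝ}

theorem GCode.hasCode {μ σ : Type} [Fintype μ] [Nonempty μ] [Fintype σ]
    (c : GCode X₁ X₂ Y Y₁ μ σ n) (he : c.err W ≤ e) (hh : h ≤ c.equiv W) :
    HasCode W n (Fintype.card μ) e h (4 * Real.log (Fintype.card μ) ^ 2 + 16) :=
  ⟨μ, σ, _, ‹_›, _, c, rfl, he, hh, dev_le _⟩

theorem HasCode.mono (H : HasCode W n M e h d) (he : e ≤ e') (hh : h' ≤ h) :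
    HasCode W n M e' h' d := by
  obtain ⟨μ, σ, i1, i2, i3, c, h1, h2, h3, h4⟩ := H
  exact ⟨μ, σ, i1, i2, i3, c, h1, h2.trans he, hh.trans h3, h4⟩

theorem HasCode.nonneg (H : HasCode W n M e h d) : HasCode W n M e (max 0 h) d := by
  obtain ⟨μ, σ, i1, i2, i3, c, h1, h2, h3, h4⟩ := H
  exact ⟨μ, σ, i1, i2, i3, c, h1, h2,
    max_le (eqv_nonneg fun w => Dist.nonneg (c.eve W w)) h3, h4⟩

theorem HasCode.pos (H : HasCode W n M e h d) : 0 < M := by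
  obtain ⟨μ, σ, i1, i2, i3, c, h1, -⟩ := H
  rw [← h1]; exact Fintype.card_pos

/-- Filler for left-over channel uses: it adds neither error nor equivocation nor variance. -/
theorem hasCode_one (W : Channel X₁ X₂ Y Y₁ Y₂) (x₁ : X₁) (x₂ : X₂) (n : ℕ) :
    HasCode W n 1 0 0 0 := by
  refine ⟨Unit, Unit, inferInstance, inferInstance, inferInstance,
    ⟨fun _ => Dist.point fun _ => x₁, Dist.unif _, fun _ _ _ => x₂, fun _ => ()⟩, rfl, ?_,
    eqv_nonneg fun w => Dist.nonneg _, ?_⟩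
  · rw [GCode.err]
    simp [ind, avg_const]
  · have h1 : ∀ (E : Unit → Dist (Fin n → Y₂)) (x : Unit × (Fin n → Y₂)), surprisal E x = 0 := by
      intro E x
      rw [surprisal, post, Fintype.sum_unique]
      by_cases h : E x.1 x.2 = 0
      · rw [h]; simp
      · rw [div_self h]; simp
    have h2 : ∀ E : Unit → Dist (Fin n → Y₂), surprisal E = fun _ => 0 := fun E => funext (h1 E)
    rw [GCode.var, dev, eqv_eq_avg, h2, avg_const]
    simp [avg_const]

theorem HasCode.concat (H : HasCode W n M e h d) (H' : HasCode W n' M' e' h' d') :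
    HasCode W (n + n') (M * M') (e + e') (h + h') (d + d') := by
  obtain ⟨μ, σ, i1, i2, i3, c, h1, h2, h3, h4⟩ := H
  obtain ⟨μ', σ', i1', i2', i3', c', h1', h2', h3', h4'⟩ := H'
  refine ⟨μ × μ', σ × σ', inferInstance, inferInstance, inferInstance, c.concat c', ?_, ?_, ?_, ?_⟩
  · rw [Fintype.card_prod, h1, h1']
  · exact (c.concat_err_le c' W).trans (add_le_add h2 h2')
  · rw [c.concat_equiv c' W]; exact add_le_add h3 h3'
  · rw [c.concat_var c' W]; exact add_le_add h4 h4'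

theorem HasCode.repeat (x₁ : X₁) (x₂ : X₂) (H : HasCode W n M e h d) (N : ℕ) :
    HasCode W (N * n) (M ^ N) (N * e) (N * h) (N * d) := by
  induction N with
  | zero => simpa using hasCode_one W x₁ x₂ 0
  | succ N ih =>
    have := ih.concat H
    simpa only [Nat.succ_mul, pow_succ, Nat.cast_succ, add_mul, one_mul] using this

/-- The only place where the variance is spent; the variance of the binned code plays no further
role. -/
theorem HasCode.bin (H : HasCode W n (M * M') e h d) : ∃ d',
    HasCode W n M e (min h (Real.log M) - Real.log 2 - Real.sqrt d) d' := by
  have hpos := H.pos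
  obtain ⟨μ, σ, i1, i2, i3, c, h1, h2, h3, h4⟩ := H
  have : Nonempty (Fin M) := Fin.pos_iff_nonempty.1 (pos_of_mul_pos_left hpos (Nat.zero_le _))
  have : Nonempty (Fin M') := Fin.pos_iff_nonempty.1 (pos_of_mul_pos_right hpos (Nat.zero_le _))
  have e₀ : μ ≃ Fin M × Fin M' := Fintype.equivOfCardEq (by simp [h1])
  obtain ⟨e', he'⟩ := exists_bin (c.eve W) e₀
  have h5 := GCode.hasCode (W := W) (c.bin e') ((c.bin_err_le e' W).trans h2)
    (h := min h (Real.log M) - Real.log 2 - Real.sqrt d) (by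
      rw [GCode.equiv, c.bin_eve]
      refine le_trans ?_ he'
      rw [Fintype.card_fin]
      have h6 : Real.sqrt (dev (c.eve W)) ≤ Real.sqrt d := Real.sqrt_le_sqrt h4
      have h7 : min h (Real.log M) ≤ min (eqv fun w => c.eve W w) (Real.log M) :=
        min_le_min_right _ h3
      linarith)
  rw [Fintype.card_fin] at h5
  exact ⟨_, h5⟩

theorem HasCode.exists_code (H : HasCode W n M e h d) : ∃ c : Code X₁ X₂ Y Y₁ n, c.M = M ∧
    c.errorProb W ≤ e ∧ h / (n * Real.log 2) ≤ c.equivocationRate W := by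
  obtain ⟨μ, σ, i1, i2, i3, c, h1, h2, h3, h4⟩ := H
  set c' := c.relabel (Fintype.equivFin μ) (Fintype.equivFin σ) with hc'
  refine ⟨⟨Fintype.card μ, Fintype.card_pos, c'.enc, Fintype.card σ, c'.seedLaw, c'.relay, c'.dec⟩,
    h1, ?_, ?_⟩
  · rw [Code.errorProb_eq]
    exact (c.relabel_err W _ _).trans_le h2
  · rw [Code.equivocationRate_eq]
    refine div_le_div_of_nonneg_right (h3.trans_eq (c.relabel_equiv W _ _).symm) ?_
    have := Real.log_nonneg (show (1 : ℝ) ≤ 2 by norm_num)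
    positivity

theorem Code.exists_hasCode (c : Code X₁ X₂ Y Y₁ n) (W : Channel X₁ X₂ Y Y₁ Y₂) (hn : 0 < n) :
    ∃ d, HasCode W n c.M (c.errorProb W) (c.equivocationRate W * (n * Real.log 2)) d := by
  have : Nonempty (Fin c.M) := ⟨⟨0, c.M_pos⟩⟩
  have h1 := GCode.hasCode (W := W) c.toGCode (c.errorProb_eq W).ge
    (h := c.equivocationRate W * (n * Real.log 2)) (by
      have h2 := Real.log_pos (show (1 : ℝ) < 2 by norm_num)
      have h3 : (0 : ℝ) < n := by exact_mod_cast hn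
      rw [Code.equivocationRate_eq, div_mul_cancel₀ _ (by positivity)])
  rw [Fintype.card_fin] at h1
  exact ⟨_, h1⟩

theorem achievable_iff (W : Channel X₁ X₂ Y Y₁ Y₂) (R₁ Rₑ : ℝ) : Achievable W R₁ Rₑ ↔
    ∀ ε > 0, ∀ᶠ n : ℕ in Filter.atTop, ∃ M d, HasCode W n M ε
      ((Rₑ - ε) * (n * Real.log 2)) d ∧ |Real.log M - R₁ * (n * Real.log 2)|
        ≤ ε * (n * Real.log 2) := by
  have hl := Real.log_pos (show (1 : ℝ) < 2 by norm_num)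
  have hrate : ∀ (n M : ℕ) (ε : ℝ), 0 < n → (|1 / (n : ℝ) * Real.logb 2 M - R₁| ≤ ε ↔
      |Real.log M - R₁ * (n * Real.log 2)| ≤ ε * (n * Real.log 2)) := by
    intro n M ε hn
    have hn' : (0 : ℝ) < n := by exact_mod_cast hn
    have h1 : Real.log M - R₁ * (n * Real.log 2)
        = (1 / (n : ℝ) * Real.logb 2 M - R₁) * (n * Real.log 2) := by
      rw [Real.logb]; field_simp
    rw [h1, abs_mul, abs_of_pos (show 0 < n * Real.log 2 by positivity),
      mul_le_mul_iff_left₀ (by positivity)]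
  constructor
  · intro H ε hε
    obtain ⟨N, hN⟩ := H ε hε
    filter_upwards [Filter.eventually_ge_atTop N, Filter.eventually_gt_atTop 0] with n hn hn0
    obtain ⟨c, h1, h2, h3⟩ := hN n hn
    obtain ⟨d, hd⟩ := c.exists_hasCode W hn0
    refine ⟨c.M, d, hd.mono h2 (mul_le_mul_of_nonneg_right h3 (by positivity)),
      (hrate n c.M ε hn0).1 h1⟩
  · intro H ε hε
    obtain ⟨N, hN⟩ := Filter.eventually_atTop.1 ((H ε hε).and (Filter.eventually_gt_atTop 0))
    refine ⟨N, fun n hn => ?_⟩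
    obtain ⟨⟨M, d, hM, hr⟩, hn0⟩ := hN n hn
    have hn' : (0 : ℝ) < n := by exact_mod_cast hn0
    obtain ⟨c, h1, h2, h3⟩ := hM.exists_code
    refine ⟨c, ?_, h2, ?_⟩
    · rw [h1]; exact (hrate n M ε hn0).2 hr
    · rwa [mul_div_assoc, div_self (by positivity), mul_one] at h3

end HasCode

/-! ### The achievable region is convex and closed -/

section Convexity

variable {X₁ X₂ Y Y₁ Y₂ : Type*} [Fintype X₁] [Fintype X₂] [Fintype Y] [Fintype Y₁] [Fintype Y₂]

/-- Time sharing: one code for about `a n` letters, the other for the rest. Rounding moves less than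
one letter, a bounded error that `ε / 2 * n` absorbs for large `n`. -/
theorem convex_achievable (W : Channel X₁ X₂ Y Y₁ Y₂) :
    Convex ℝ {r : ℝ × ℝ | Achievable W r.1 r.2} := by
  have hl := Real.log_pos (show (1 : ℝ) < 2 by norm_num)
  rw [convex_iff_forall_pos]
  rintro ⟨R, S⟩ hR ⟨R', S'⟩ hR' a b ha hb hab
  simp only [Set.mem_ofPred_eq, achievable_iff] at hR hR' ⊢
  simp only [Prod.smul_mk, Prod.mk_add_mk, smul_eq_mul]
  intro ε hε
  obtain ⟨K, hK⟩ := exists_nat_gt ((|R - R'| + |S - S'|) / (ε / 2))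
  obtain ⟨N, hN⟩ := Filter.eventually_atTop.1 (hR (ε / 2) (by positivity))
  obtain ⟨N', hN'⟩ := Filter.eventually_atTop.1 (hR' (ε / 2) (by positivity))
  have t1 : ∀ᶠ n : ℕ in Filter.atTop, N ≤ ⌊a * n⌋₊ :=
    (tendsto_nat_floor_atTop.comp
      (tendsto_natCast_atTop_atTop.const_mul_atTop ha)).eventually_ge_atTop N
  have t2 : ∀ᶠ n : ℕ in Filter.atTop, (N' : ℝ) ≤ b * n :=
    (tendsto_natCast_atTop_atTop.const_mul_atTop hb).eventually_ge_atTop (N' : ℝ)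
  filter_upwards [t1, t2, Filter.eventually_ge_atTop K, Filter.eventually_gt_atTop 0]
    with n h1 h2 h3 h4
  have hn0 : (0 : ℝ) < n := by exact_mod_cast h4
  set i := ⌊a * n⌋₊ with hi
  have hi1 : (i : ℝ) ≤ a * n := Nat.floor_le (by positivity)
  have hi2 : a * n < i + 1 := Nat.lt_floor_add_one _
  have hin : i ≤ n := by
    have : (i : ℝ) ≤ n := by nlinarith
    exact_mod_cast this
  obtain ⟨j, hj⟩ := Nat.exists_eq_add_of_le hin
  have hjr : (n : ℝ) = i + j := by exact_mod_cast hj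
  have hjN : N' ≤ j := by
    have : (N' : ℝ) ≤ j := by nlinarith
    exact_mod_cast this
  obtain ⟨M, d, hM, hr⟩ := hN i h1
  obtain ⟨M', d', hM', hr'⟩ := hN' j hjN
  have hpos := hM.pos
  have hpos' := hM'.pos
  have hKn : |R - R'| + |S - S'| ≤ ε / 2 * n := by
    rw [div_lt_iff₀ (by positivity)] at hK
    have : (K : ℝ) ≤ n := by exact_mod_cast h3
    nlinarith
  set t := a * n - i with ht
  have ht0 : 0 ≤ t := by linarith
  have ht1 : t ≤ 1 := by linarith
  have htb : b * n = j - t := by rw [ht, eq_sub_of_add_eq' hab, hjr]; ring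
  have hta : a * n = i + t := by rw [ht]; ring
  have bound : ∀ x : ℝ, |t * x| ≤ |x| := by
    intro x
    rw [abs_mul, abs_of_nonneg ht0]
    exact mul_le_of_le_one_left (abs_nonneg x) ht1
  rw [hj]
  refine ⟨M * M', d + d', (hM.concat hM').mono (by linarith) ?_, ?_⟩
  · have e1 : (a * S + b * S' - ε) * (((i + j : ℕ) : ℝ) * Real.log 2) =
        (i * S + j * S' + t * (S - S') - ε * (i + j)) * Real.log 2 := by
      rw [Nat.cast_add, ← hjr]
      have : a * S * n + b * S' * n = i * S + j * S' + t * (S - S') := by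
        linear_combination S * hta + S' * htb
      linear_combination (Real.log 2) * this
    have h5 := (abs_le.1 (bound (S - S'))).2
    have h6 : t * (S - S') ≤ ε / 2 * (i + j) := by
      rw [← hjr]; linarith [abs_nonneg (R - R')]
    rw [e1]
    nlinarith
  · rw [Nat.cast_mul, Real.log_mul (by positivity) (by positivity)]
    have e1 : Real.log M + Real.log M' - (a * R + b * R') * (((i + j : ℕ) : ℝ) * Real.log 2) =
        (Real.log M - R * (i * Real.log 2)) + (Real.log M' - R' * (j * Real.log 2))
          - t * (R - R') * Real.log 2 := by
      rw [Nat.cast_add, ← hjr]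
      have : a * R * n + b * R' * n = i * R + j * R' + t * (R - R') := by
        linear_combination R * hta + R' * htb
      linear_combination (-Real.log 2) * this
    rw [e1]
    have h5 : |t * (R - R') * Real.log 2| ≤ ε / 2 * n * Real.log 2 := by
      rw [abs_mul, abs_of_pos hl]
      refine mul_le_mul_of_nonneg_right ?_ hl.le
      linarith [bound (R - R'), abs_nonneg (S - S')]
    calc _ ≤ |Real.log M - R * (i * Real.log 2)| + |Real.log M' - R' * (j * Real.log 2)|
          + |t * (R - R') * Real.log 2| :=
          (abs_sub _ _).trans (add_le_add (abs_add_le _ _) le_rfl)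
      _ ≤ ε / 2 * (i * Real.log 2) + ε / 2 * (j * Real.log 2) + ε / 2 * n * Real.log 2 :=
          add_le_add (add_le_add hr hr') h5
      _ = _ := by rw [Nat.cast_add, hjr]; ring

theorem isClosed_achievable (W : Channel X₁ X₂ Y Y₁ Y₂) :
    IsClosed {r : ℝ × ℝ | Achievable W r.1 r.2} := by
  rw [← closure_subset_iff_isClosed]
  intro r hr ε hε
  obtain ⟨r', hr', hd⟩ := Metric.mem_closure_iff.1 hr (ε / 2) (by positivity)
  obtain ⟨N, hN⟩ := hr' (ε / 2) (by positivity)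
  have h1 : |r.1 - r'.1| ≤ ε / 2 := by
    rw [← Real.dist_eq]; exact (le_max_left _ _).trans hd.le
  have h2 : |r.2 - r'.2| ≤ ε / 2 := by
    rw [← Real.dist_eq]; exact (le_max_right _ _).trans hd.le
  refine ⟨N, fun n hn => ?_⟩
  obtain ⟨c, h3, h4, h5⟩ := hN n hn
  refine ⟨c, ?_, by linarith, by linarith [(abs_le.1 h2).2]⟩
  rw [abs_le] at h1 h3 ⊢
  constructor <;> linarith [h1.1, h1.2, h3.1, h3.2]

end Convexity

/-! ### Codes for long blocks -/

section BlockCodes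

variable {X₁ X₂ Y Y₁ Y₂ V : Type*} [Fintype X₁] [Fintype X₂] [Fintype Y] [Fintype Y₁]
  [Fintype Y₂] [Fintype V]

/-- The information density of the eavesdropper about both inputs. -/
def leakDensity (W : Channel X₁ X₂ Y Y₁ Y₂) (p₁ : Dist X₁) (p₂ : Dist X₂) (x₁ : X₁) (x₂ : X₂)
    (y₂ : Y₂) : ℝ := Real.log (eveKer W x₁ x₂ y₂ / eveLaw W p₁ p₂ y₂)

/-- The information density of a block. -/
def leakDensitySum (W : Channel X₁ X₂ Y Y₁ Y₂) (p₁ : Dist X₁) (p₂ : Dist X₂) {m : ℕ}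
    (x₁ : Fin m → X₁) (x₂ : Fin m → X₂) (y₂ : Fin m → Y₂) : ℝ :=
  ∑ j, leakDensity W p₁ p₂ (x₁ j) (x₂ j) (y₂ j)

variable {W : Channel X₁ X₂ Y Y₁ Y₂} {p₁ : Dist X₁} {p₂ : Dist X₂} {q : Y₁ → X₂ → Dist V} {m : ℕ}

/-- The density is the log-ratio of `eveKer` to `eveLaw`, so its negative exponential exchanges one
for the other. Inputs of positive mass make `eveLaw` positive wherever `eveKer` is. -/
theorem avg_exp_neg_leakDensity_le {x₁ : X₁} {x₂ : X₂} (h₁ : 0 < p₁ x₁) (h₂ : 0 < p₂ x₂) (t : Y₂) :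
    avg (W x₁ x₂) (fun o => ind (o.2.2 = t) * Real.exp (-leakDensity W p₁ p₂ x₁ x₂ o.2.2))
      ≤ eveLaw W p₁ p₂ t := by
  calc _ ≤ avg (W x₁ x₂) (fun o => ind (o.2.2 = t) * (eveLaw W p₁ p₂ t / eveKer W x₁ x₂ t)) := by
        refine avg_le_avg_of_pos _ fun o ho => ?_
        by_cases h : o.2.2 = t
        · have h3 : 0 < eveKer W x₁ x₂ o.2.2 :=
            Dist.map_pos (fun o : Y × Y₁ × Y₂ => o.2.2) ho
          have h4 : 0 < eveLaw W p₁ p₂ o.2.2 :=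
            Dist.bind_pos h₁ (show 0 < eveKerSource W p₂ x₁ o.2.2 from Dist.bind_pos h₂ h3)
          rw [← h, leakDensity, Real.exp_neg, Real.exp_log (div_pos h3 h4), inv_div]
        · rw [ind_false h, zero_mul, zero_mul]
    _ = eveKer W x₁ x₂ t * (eveLaw W p₁ p₂ t / eveKer W x₁ x₂ t) := avg_mul_const _ _ _
    _ ≤ _ := by
        by_cases h : eveKer W x₁ x₂ t = 0
        · rw [h, zero_mul]; exact Dist.nonneg _ _
        · rw [mul_div_cancel₀ _ h]

theorem avg_exp_neg_sum_leakDensity_le {x₁ : Fin m → X₁} {x₂ : Fin m → X₂}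
    (h₁ : ∀ j, 0 < p₁ (x₁ j)) (h₂ : ∀ j, 0 < p₂ (x₂ j)) (t : Fin m → Y₂) :
    avg (Channel.pow W m x₁ x₂) (fun o => ind (o.2.2 = t) *
      Real.exp (-leakDensitySum W p₁ p₂ x₁ x₂ o.2.2))
      ≤ Dist.pi (fun _ => eveLaw W p₁ p₂) t := by
  rw [avg_pow, Dist.pi_apply]
  calc _ = avg (Dist.pi fun j => W (x₁ j) (x₂ j)) (fun o => ∏ j, ind ((o j).2.2 = t j) *
        Real.exp (-leakDensity W p₁ p₂ (x₁ j) (x₂ j) (o j).2.2)) := by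
        congr 1; funext o
        rw [Finset.prod_mul_distrib, ← Real.exp_sum, Finset.sum_neg_distrib, ind_funext]
        rfl
    _ = ∏ j, avg (W (x₁ j) (x₂ j)) (fun o => ind (o.2.2 = t j) *
        Real.exp (-leakDensity W p₁ p₂ (x₁ j) (x₂ j) o.2.2)) :=
        avg_pi_prod (fun j => W (x₁ j) (x₂ j)) fun j o => ind (o.2.2 = t j) *
          Real.exp (-leakDensity W p₁ p₂ (x₁ j) (x₂ j) o.2.2)
    _ ≤ _ := Finset.prod_le_prod
        (fun j _ => avg_nonneg _ fun o => mul_nonneg (ind_nonneg _) (Real.exp_pos _).le)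
        fun j _ => avg_exp_neg_leakDensity_le (h₁ j) (h₂ j) (t j)

theorem avg_sum_leakDensity (q : Y₁ → X₂ → Dist V) :
    avg (Dist.pi fun _ : Fin m => p₁) (fun x₁ => avg (Dist.pi fun _ : Fin m => p₂) fun x₂ =>
      avg (Channel.pow W m x₁ x₂) fun o => leakDensitySum W p₁ p₂ x₁ x₂ o.2.2)
      = m * infoLeak W p₁ p₂ q := by
  have h := avg_letterDist_pow W p₁ p₂ q m fun x₁ x₂ o _ =>
    ∑ j, leakDensity W p₁ p₂ (x₁ j) (x₂ j) (o j).2.2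
  simp only [avg_const] at h
  refine h.symm.trans ?_
  rw [avg_sum]
  have h1 : ∀ j : Fin m, avg (Dist.pi fun _ : Fin m => letterDist W p₁ p₂ q) (fun ω =>
      leakDensity W p₁ p₂ (ω j).1 (ω j).2.1 (ω j).2.2.1.2.2) = infoLeak W p₁ p₂ q := fun j =>
    avg_pi_apply (fun _ : Fin m => letterDist W p₁ p₂ q) j fun ω =>
      leakDensity W p₁ p₂ ω.1 ω.2.1 ω.2.2.1.2.2
  simp only [h1, Finset.sum_const, Finset.card_univ, Fintype.card_fin, nsmul_eq_mul]

theorem hasCode_of_reliable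
    {T : Tests (Fin m → X₁) (Fin m → X₂) (Fin m → Y) (Fin m → Y₂) (Fin m → V)}
    {a k l : ℕ} [NeZero k] {η Λ : ℝ} (hm : 0 < m) (ha : 0 < a) (hl : 0 < l) (hΛ : 0 < Λ) (B : ℕ)
    (h : T.Reliable (Channel.pow W m) (Dist.pi fun _ => p₁) (Dist.pi fun _ => p₂) (testPow q m)
      (Fin a) (Fin k) (Fin l) η) :
    HasCode W ((B + 1) * m) (a ^ B) ((B + 1) * (6 * η + infoLeak W p₁ p₂ q / Λ))
      (B * Real.log a + (B + 1) * Real.log l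
        - (B + 1) * (m * (infoLeak W p₁ p₂ q + 6 * Λ * η)) - Real.log 2
        - (B + 1) * (6 * η + infoLeak W p₁ p₂ q / Λ) * ((B + 1) * Real.log l))
      (4 * (B * Real.log a) ^ 2 + 16) := by
  have : Nonempty (Fin a) := Fin.pos_iff_nonempty.1 ha
  have : Nonempty (Fin l) := Fin.pos_iff_nonempty.1 hl
  have hm' : (0 : ℝ) < m := by exact_mod_cast hm
  -- The leakage of a block grows with `m`; scaling `Λ` likewise makes the error bound independent
  -- of `m`.
  obtain ⟨c, h1, h2⟩ := exists_gcode_of_reliable B (Λ := m * Λ) (I := m * infoLeak W p₁ p₂ q)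
    (Q := Dist.pi fun _ : Fin m => eveLaw W p₁ p₂)
    (ι := leakDensitySum W p₁ p₂)
    (by positivity) h (Dist.nonneg (Dist.pi fun _ : Fin m => eveLaw W p₁ p₂))
    (Dist.sum_eq_one (Dist.pi fun _ : Fin m => eveLaw W p₁ p₂)).le
    (fun x₁ x₂ t h₁ h₂ => avg_exp_neg_sum_leakDensity_le (Dist.pos_of_pi_pos (p := fun _ => p₁) h₁)
      (Dist.pos_of_pi_pos (p := fun _ => p₂) h₂) t) (avg_sum_leakDensity q).le
  have h3 := GCode.hasCode (W := W) c.unblock (c.unblock_err (W := W)).le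
    (c.unblock_equiv (W := W)).ge
  rw [mul_div_mul_left _ _ hm'.ne'] at h1 h2
  simp only [Fintype.card_fin] at h2
  simp only [Fintype.card_pi, Finset.prod_const, Finset.card_univ, Fintype.card_fin, Nat.cast_pow,
    Real.log_pow] at h3
  refine h3.mono h1 (le_trans (le_of_eq ?_) h2)
  ring

/-- There are arbitrarily good block codes with rate `ρ` and equivocation rate `E`, in nats. -/
def BlockCodes (W : Channel X₁ X₂ Y Y₁ Y₂) (ρ E : ℝ) : Prop :=
  ∀ ε > 0, ∃ b : ℕ, 0 < b ∧ ∀ᶠ m : ℕ in Filter.atTop, ∃ s : ℕ,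
    b * m * (ρ - ε) ≤ s * Real.log 2 ∧ s * Real.log 2 ≤ b * m * ρ ∧
    HasCode W (b * m) (2 ^ s) ε (b * m * (E - ε)) (4 * (b * m * ρ) ^ 2 + 16)

/-- The constants are chosen in the order `B`, `θ`, `Λ`, `η`, `m`. Message numbers are powers of two
so that they can later be split into bins of equal size. -/
theorem blockCodes_of_reliable {ρ R₀ : ℝ} (hρ : 0 ≤ ρ) (hR : 0 ≤ R₀)
    (h : ∀ η : ℝ, 0 < η → ∀ᶠ m : ℕ in Filter.atTop, ∃ (k l : ℕ) (_ : NeZero k),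
      Real.exp (m * R₀) ≤ l ∧ (l : ℝ) ≤ 2 * Real.exp (m * R₀) ∧
      ∃ T : Tests (Fin m → X₁) (Fin m → X₂) (Fin m → Y) (Fin m → Y₂) (Fin m → V),
        T.Reliable (Channel.pow W m) (Dist.pi fun _ => p₁) (Dist.pi fun _ => p₂) (testPow q m)
          (Fin (2 ^ ⌊m * ρ / Real.log 2⌋₊)) (Fin k) (Fin l) η) :
    BlockCodes W ρ (ρ + R₀ - infoLeak W p₁ p₂ q) := by
  intro ε hε
  have hlog : 0 < Real.log 2 := Real.log_pos (by norm_num)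
  have hlog1 : Real.log 2 ≤ 1 := by
    have := Real.log_le_sub_one_of_pos (show (0 : ℝ) < 2 by norm_num)
    linarith
  set J := infoLeak W p₁ p₂ q
  -- The block without a message costs the fraction `1 / (B + 1)` of the rate.
  obtain ⟨B, hB⟩ := exists_nat_gt (4 * ρ / ε)
  have hb : (0 : ℝ) < B + 1 := by positivity
  have hB' : ρ ≤ (B + 1) * (ε / 4) := by
    rw [div_lt_iff₀ hε] at hB; nlinarith
  -- Target for `6 * η + J / Λ`: the first bound is for the total error, the second for the Fano
  -- term, which multiplies the error by the noise of all blocks.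
  set θ := min (ε / (B + 1)) (ε / (4 * (B + 1) * (R₀ + 1))) with hθdef
  have hθ : 0 < θ := lt_min (by positivity) (by positivity)
  have hθ1 : (B + 1) * θ ≤ ε := by
    rw [mul_comm, ← le_div_iff₀ hb]; exact min_le_left _ _
  have hθ2 : (B + 1) * θ * (R₀ + 1) ≤ ε / 4 := by
    have : θ ≤ ε / (4 * (B + 1) * (R₀ + 1)) := min_le_right _ _
    rw [le_div_iff₀ (by positivity)] at this
    linarith
  set Λ := 2 * |J| / θ + 1 with hΛdef
  have hΛ : 0 < Λ := by positivity
  have hJ : J / Λ ≤ θ / 2 := by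
    rw [div_le_iff₀ hΛ, hΛdef]
    have : θ / 2 * (2 * |J| / θ + 1) = |J| + θ / 2 := by field_simp
    rw [this]
    linarith [le_abs_self J]
  -- Besides the error, `η` has to keep the leakage penalty `6 * Λ * η` small, so it comes after
  -- `Λ`.
  set η := min (θ / 12) (ε / (24 * Λ)) with hηdef
  have hη : 0 < η := lt_min (by positivity) (by positivity)
  have hη1 : 6 * η ≤ θ / 2 := by
    have : η ≤ θ / 12 := min_le_left _ _
    linarith
  have hη2 : 6 * Λ * η ≤ ε / 4 := by
    have : η ≤ ε / (24 * Λ) := min_le_right _ _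
    rw [le_div_iff₀ (by positivity)] at this
    linarith
  obtain ⟨m₀, hm₀⟩ := exists_nat_gt (4 * Real.log 2 / ε)
  refine ⟨B + 1, by omega, ?_⟩
  filter_upwards [h η hη, Filter.eventually_ge_atTop m₀, Filter.eventually_gt_atTop 0]
    with m hm hm1 hm2
  obtain ⟨k, l, hk, hl1, hl2, T, hT⟩ := hm
  have hm0 : (1 : ℝ) ≤ m := by exact_mod_cast hm2
  have hl0 : (0 : ℝ) < l := (Real.exp_pos _).trans_le hl1
  have hmε : Real.log 2 ≤ m * (ε / 4) := by
    have : (m₀ : ℝ) ≤ m := by exact_mod_cast hm1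
    rw [div_lt_iff₀ hε] at hm₀
    nlinarith
  set s := ⌊m * ρ / Real.log 2⌋₊
  have hs1 : s * Real.log 2 ≤ m * ρ := by
    rw [← le_div_iff₀ hlog]; exact Nat.floor_le (by positivity)
  have hs2 : m * ρ - Real.log 2 ≤ s * Real.log 2 := by
    have := (Nat.lt_floor_add_one (m * ρ / Real.log 2)).le
    rw [div_le_iff₀ hlog, add_mul, one_mul] at this
    linarith
  have h3 := hasCode_of_reliable (a := 2 ^ s) hm2 (by positivity) (by exact_mod_cast hl0) hΛ B hT
  rw [← pow_mul] at h3
  have hlogl : m * R₀ ≤ Real.log l := by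
    rw [Real.le_log_iff_exp_le hl0]; exact hl1
  have hlogl2 : Real.log l ≤ m * (R₀ + 1) := by
    have := Real.log_le_log hl0 hl2
    rw [Real.log_mul (by norm_num) (Real.exp_pos _).ne', Real.log_exp] at this
    nlinarith
  have hBs : ((2 ^ s : ℕ) : ℝ) = 2 ^ s := by norm_cast
  rw [hBs, Real.log_pow] at h3
  have hB0 : (0 : ℝ) ≤ B := by positivity
  have hBs1 : (B + 1) * m * ρ - (B + 1) * m * (ε / 2) ≤ B * (s * Real.log 2) - Real.log 2 := by
    have h4 : B * (m * ρ - Real.log 2) ≤ B * (s * Real.log 2) := mul_le_mul_of_nonneg_left hs2 hB0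
    have h5 := mul_le_mul_of_nonneg_left hB' (show (0 : ℝ) ≤ m by linarith)
    have h6 := mul_le_mul_of_nonneg_left hmε hb.le
    linarith
  have hBs2 : B * (s * Real.log 2) ≤ (B + 1) * m * ρ := by
    have h4 := mul_le_mul_of_nonneg_left hs1 hB0
    have h5 : 0 ≤ m * ρ := by positivity
    linarith
  have herr : (B + 1) * (6 * η + J / Λ) ≤ (B + 1) * θ :=
    mul_le_mul_of_nonneg_left (by linarith) hb.le
  refine ⟨s * B, ?_, ?_, ?_⟩
  · push_cast
    have : 0 ≤ (B + 1) * m * (ε / 2) := by positivity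
    linarith
  · push_cast; linarith
  · obtain ⟨μ, σ, i1, i2, i3, c, c1, c2, c3, c4⟩ := h3
    refine ⟨μ, σ, i1, i2, i3, c, c1, c2.trans (herr.trans hθ1), le_trans ?_ c3, c4.trans ?_⟩
    · push_cast
      have h4 := mul_le_mul_of_nonneg_left hlogl hb.le
      have h5 : (B + 1) * (6 * η + J / Λ) * ((B + 1) * Real.log l)
          ≤ (B + 1) * m * (ε / 4) := by
        have h6 : 0 ≤ (B + 1) * Real.log l :=
          mul_nonneg hb.le (le_trans (by positivity) hlogl)
        calc _ ≤ (B + 1) * θ * ((B + 1) * Real.log l) := mul_le_mul_of_nonneg_right herr h6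
          _ ≤ (B + 1) * θ * ((B + 1) * (m * (R₀ + 1))) :=
            mul_le_mul_of_nonneg_left (mul_le_mul_of_nonneg_left hlogl2 hb.le) (by positivity)
          _ = (B + 1) * m * ((B + 1) * θ * (R₀ + 1)) := by ring
          _ ≤ _ := mul_le_mul_of_nonneg_left hθ2 (by positivity)
      have h7 := mul_le_mul_of_nonneg_left hη2 (show 0 ≤ (B + 1) * (m : ℝ) by positivity)
      linarith
    · push_cast
      have : (B * (s * Real.log 2)) ^ 2 ≤ ((B + 1) * m * ρ) ^ 2 :=
        pow_le_pow_left₀ (by positivity) hBs2 2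
      linarith

theorem ceil_exp_le {x : ℝ} (hx : 0 ≤ x) : (⌈Real.exp x⌉₊ : ℝ) ≤ 2 * Real.exp x := by
  have h1 := (Nat.ceil_lt_add_one (Real.exp_pos x).le).le
  have h2 := Real.one_le_exp hx
  linarith

theorem two_pow_floor_le {x : ℝ} (hx : 0 ≤ x) :
    ((2 ^ ⌊x / Real.log 2⌋₊ : ℕ) : ℝ) ≤ Real.exp x := by
  have hlog : 0 < Real.log 2 := Real.log_pos (by norm_num)
  push_cast
  rw [← Real.log_le_iff_le_exp (by positivity), Real.log_pow, ← le_div_iff₀ hlog]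
  exact Nat.floor_le (by positivity)

theorem blockCodes_of_lt {ρ R₀ : ℝ} (hρ : 0 ≤ ρ) (hR : 0 ≤ R₀) (hρ' : ρ < infoSource W p₁ p₂ q)
    (hc : 0 ≤ infoComp W p₁ p₂ q) (h₁ : R₀ + infoComp W p₁ p₂ q < infoDest W p₁ p₂ q)
    (h₂ : R₀ + infoComp W p₁ p₂ q < infoEve W p₁ p₂ q) :
    BlockCodes W ρ (ρ + R₀ - infoLeak W p₁ p₂ q) := by
  refine blockCodes_of_reliable (q := q) hρ hR fun η hη => ?_
  obtain ⟨γ, hγ, hγ'⟩ := exists_between (show 0 < min ((infoSource W p₁ p₂ q - ρ) / 2)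
    (min ((infoDest W p₁ p₂ q - (R₀ + infoComp W p₁ p₂ q)) / 4)
      ((infoEve W p₁ p₂ q - (R₀ + infoComp W p₁ p₂ q)) / 4)) from
    lt_min (by linarith) (lt_min (by linarith) (by linarith)))
  obtain ⟨g1, g2⟩ := lt_min_iff.1 hγ'
  obtain ⟨g2, g3⟩ := lt_min_iff.1 g2
  filter_upwards [eventually_exists_reliable (W := W) (p₁ := p₁) (p₂ := p₂) (q := q) hγ hη]
    with m hm
  have hm0 : (0 : ℝ) ≤ m := by positivity
  have hk : 0 < ⌈Real.exp (m * (infoComp W p₁ p₂ q + 2 * γ))⌉₊ := Nat.ceil_pos.2 (Real.exp_pos _)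
  have : NeZero ⌈Real.exp (m * (infoComp W p₁ p₂ q + 2 * γ))⌉₊ := ⟨hk.ne'⟩
  -- The factor 4 covers two roundings up. Of `4 * γ`, half is the excess of the compression rate
  -- and half the margin below `x`.
  have hkl : ∀ x : ℝ, R₀ + infoComp W p₁ p₂ q + 4 * γ ≤ x →
      ((⌈Real.exp (m * (infoComp W p₁ p₂ q + 2 * γ))⌉₊ * ⌈Real.exp (m * R₀)⌉₊ : ℕ) : ℝ)
        ≤ 4 * Real.exp (m * (x - 2 * γ)) := by
    intro x hx
    push_cast
    calc _ ≤ 2 * Real.exp (m * (infoComp W p₁ p₂ q + 2 * γ)) * (2 * Real.exp (m * R₀)) :=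
          mul_le_mul (ceil_exp_le (by positivity)) (ceil_exp_le (by positivity)) (by positivity)
            (by positivity)
      _ = 4 * Real.exp (m * (infoComp W p₁ p₂ q + 2 * γ) + m * R₀) := by rw [Real.exp_add]; ring
      _ ≤ _ := by
          refine mul_le_mul_of_nonneg_left (Real.exp_le_exp.2 ?_) (by norm_num)
          nlinarith
  refine ⟨⌈Real.exp (m * (infoComp W p₁ p₂ q + 2 * γ))⌉₊, ⌈Real.exp (m * R₀)⌉₊, this, Nat.le_ceil _,
    ceil_exp_le (by positivity), hm _ _ _ ((two_pow_floor_le (by positivity)).trans ?_)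
      (hkl _ (by linarith)) (hkl _ (by linarith)) (Nat.le_ceil _)⟩
  exact Real.exp_le_exp.2 (mul_le_mul_of_nonneg_left (by linarith) hm0)

theorem blockCodes_of_unique [Unique V] {ρ : ℝ} (hρ : 0 ≤ ρ) (hρ' : ρ < infoSource W p₁ p₂ q) :
    BlockCodes W ρ (ρ - infoLeak W p₁ p₂ q) := by
  have := blockCodes_of_reliable (W := W) (p₁ := p₁) (p₂ := p₂) (q := q) hρ le_rfl fun η hη => by
    filter_upwards [eventually_exists_reliable_of_unique (W := W) (p₁ := p₁) (p₂ := p₂) (q := q)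
      (show 0 < (infoSource W p₁ p₂ q - ρ) / 2 by linarith) hη] with m hm
    refine ⟨1, 1, inferInstance, by simp, by simp,
      hm _ ((two_pow_floor_le (by positivity)).trans ?_)⟩
    exact Real.exp_le_exp.2 (mul_le_mul_of_nonneg_left (by linarith) (by positivity))
  rwa [add_zero] at this

end BlockCodes

/-! ### From block codes to codes of every length -/

section AllLengths

variable {X₁ X₂ Y Y₁ Y₂ : Type*} [Fintype X₁] [Fintype X₂] [Fintype Y] [Fintype Y₁] [Fintype Y₂]
  {W : Channel X₁ X₂ Y Y₁ Y₂}

theorem sqrt_sq_mul_le (K : ℕ) {x : ℝ} (hx : 0 ≤ x) :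
    Real.sqrt (K * K * (4 * x ^ 2 + 16)) ≤ K * (2 * x + 4) := by
  refine Real.sqrt_le_iff.2 ⟨by positivity, ?_⟩
  have : (0 : ℝ) ≤ K * K * x := by positivity
  linarith

set_option maxHeartbeats 800000 in
-- Repeat a block code `K²` times, pad to length `n`, and bin down to rate `R₁`. The number `b` of
-- blocks does not depend on `m`, so the padding is shorter than the constant `c` and negligible.
theorem BlockCodes.achievable (x₁ : X₁) (x₂ : X₂) {ρ E R₁ Rₑ : ℝ} (H : BlockCodes W ρ E)
    (hR : 0 ≤ R₁) (hρ : R₁ * Real.log 2 < ρ) (h₁ : Rₑ ≤ R₁) (h₂ : Rₑ * Real.log 2 ≤ max 0 E) :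
    Achievable W R₁ Rₑ := by
  rw [achievable_iff]
  intro ε₀ hε₀
  have hlog : 0 < Real.log 2 := Real.log_pos (by norm_num)
  set r := R₁ * Real.log 2 with hr
  have hr0 : 0 ≤ r := by positivity
  set ε := min (ε₀ * Real.log 2) ε₀ with hεdef
  have hε : 0 < ε := lt_min (by positivity) hε₀
  -- The standard deviation is at most `K * b * m * (2 * ρ + 4)` against a length of at least `K² *
  -- b * m`, so this `K` makes it at most `ε / 4` per letter.
  obtain ⟨K, hK⟩ := exists_nat_gt (4 * (2 * ρ + 4) / ε)
  have hK0 : (0 : ℝ) < K := by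
    refine lt_of_le_of_lt ?_ hK
    have : 0 ≤ ρ := hr0.trans hρ.le
    positivity
  have hK1 : 2 * ρ + 4 ≤ K * (ε / 4) := by
    rw [div_lt_iff₀ hε] at hK; linarith
  set N := K * K with hN
  -- Three demands: the block rate stays above the target, the equivocation loss is small, and the
  -- errors of all `K²` repetitions add up to at most `ε`.
  set ε₁ := min ((ρ - r) / 2) (min (ε / 4) (ε / (K * K))) with hε₁def
  have hε₁ : 0 < ε₁ := lt_min (by linarith) (lt_min (by positivity) (by positivity))
  have g1 : ε₁ ≤ (ρ - r) / 2 := min_le_left _ _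
  have g2 : ε₁ ≤ ε / 4 := (min_le_right _ _).trans (min_le_left _ _)
  have g3 : (K : ℝ) * K * ε₁ ≤ ε := by
    have : ε₁ ≤ ε / (K * K) := (min_le_right _ _).trans (min_le_right _ _)
    rw [le_div_iff₀ (by positivity)] at this
    linarith
  obtain ⟨b, hb, Hb⟩ := H ε₁ hε₁
  have hKn : 0 < K := by exact_mod_cast hK0
  have hc : 0 < K * K * b := by positivity
  set c := K * K * b with hcdef
  obtain ⟨m₀, hm₀⟩ := exists_nat_gt (r / ((ρ - r) / 2))
  obtain ⟨n₀, hn₀⟩ := exists_nat_gt ((c * max 0 E + 2 * Real.log 2) / (ε / 4))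
  have hdiv : Filter.Tendsto (fun n : ℕ => n / c) Filter.atTop Filter.atTop :=
    by
    simpa using Nat.tendsto_div_const_atTop hc.ne'
  filter_upwards [hdiv.eventually Hb, hdiv.eventually_ge_atTop m₀, hdiv.eventually_ge_atTop 1,
    Filter.eventually_ge_atTop n₀] with n hn hm hm1 hnn
  set m := n / c with hmdef
  obtain ⟨s, hs1, hs2, hs⟩ := hn
  have hnm : c * m + n % c = n := Nat.div_add_mod n c
  have hrem : n % c < c := Nat.mod_lt _ hc
  have hnm' : (c : ℝ) * m + (n % c : ℕ) = n := by exact_mod_cast hnm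
  have hrem' : ((n % c : ℕ) : ℝ) ≤ c := by exact_mod_cast hrem.le
  have hrem0 : (0 : ℝ) ≤ (n % c : ℕ) := by positivity
  have hcr : (c : ℝ) = K * K * b := by rw [hcdef]; push_cast; ring
  have hc0 : (0 : ℝ) < c := by exact_mod_cast hc
  have hb0 : (1 : ℝ) ≤ b := by exact_mod_cast hb
  have hm0 : (1 : ℝ) ≤ m := by exact_mod_cast hm1
  have hn0 : (0 : ℝ) < n := by nlinarith
  have hmr : r ≤ m * ((ρ - r) / 2) := by
    have : (m₀ : ℝ) ≤ m := by exact_mod_cast hm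
    rw [div_lt_iff₀ (by linarith)] at hm₀
    nlinarith
  have hnr : c * max 0 E + 2 * Real.log 2 ≤ n * (ε / 4) := by
    have : (n₀ : ℝ) ≤ n := by exact_mod_cast hnn
    rw [div_lt_iff₀ (by positivity)] at hn₀
    nlinarith
  set j := ⌊n * r / Real.log 2⌋₊
  have hj1 : j * Real.log 2 ≤ n * r := by
    rw [← le_div_iff₀ hlog]; exact Nat.floor_le (by positivity)
  have hj2 : n * r - Real.log 2 ≤ j * Real.log 2 := by
    have := (Nat.lt_floor_add_one (n * r / Real.log 2)).le
    rw [div_le_iff₀ hlog, add_mul, one_mul] at this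
    linarith
  have hjs : j ≤ s * N := by
    have : j * Real.log 2 ≤ (s * N : ℕ) * Real.log 2 := by
      push_cast
      calc j * Real.log 2 ≤ n * r := hj1
        _ ≤ (c * m + c) * r := mul_le_mul_of_nonneg_right (by linarith) hr0
        _ = c * (m * r + r) := by ring
        _ ≤ c * (m * (ρ - ε₁)) := by
            refine mul_le_mul_of_nonneg_left ?_ hc0.le
            have : m * ε₁ ≤ m * ((ρ - r) / 2) := mul_le_mul_of_nonneg_left g1 (by positivity)
            linarith
        _ = K * K * (b * m * (ρ - ε₁)) := by rw [hcr]; ring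
        _ ≤ K * K * (s * Real.log 2) := mul_le_mul_of_nonneg_left hs1 (by positivity)
        _ = _ := by rw [hN]; push_cast; ring
    have := le_of_mul_le_mul_right this hlog
    exact_mod_cast this
  -- Equivocation is never negative; recording this before repeating yields the positive part in the
  -- region.
  have hcode := ((hs.nonneg.repeat x₁ x₂ N).concat (hasCode_one W x₁ x₂ (n % c)))
  have hlen : N * (b * m) + n % c = n := by
    rw [hN, ← mul_assoc, ← hcdef]; exact hnm
  rw [hlen, mul_one, ← pow_mul, ← Nat.add_sub_cancel' hjs, pow_add] at hcode
  obtain ⟨d, hd⟩ := hcode.bin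
  have hsqrt : Real.sqrt (N * (4 * (b * m * ρ) ^ 2 + 16) + 0) ≤ n * (ε / 4) := by
    have hρ0 : 0 < ρ := hr0.trans_lt hρ
    have hbm : 1 ≤ b * (m : ℝ) := one_le_mul_of_one_le_of_one_le hb0 hm0
    rw [hN, add_zero, Nat.cast_mul]
    calc _ ≤ K * (2 * (b * m * ρ) + 4) := sqrt_sq_mul_le K (by positivity)
      _ ≤ K * (b * m * (2 * ρ + 4)) := mul_le_mul_of_nonneg_left (by linarith) hK0.le
      _ ≤ K * (b * m * (K * (ε / 4))) :=
          mul_le_mul_of_nonneg_left (mul_le_mul_of_nonneg_left hK1 (by positivity)) hK0.le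
      _ = c * m * (ε / 4) := by rw [hcr]; ring
      _ ≤ _ := mul_le_mul_of_nonneg_right (by linarith) (by positivity)
  have hε1 : ε ≤ ε₀ * Real.log 2 := min_le_left _ _
  have hnε : n * ε ≤ ε₀ * (n * Real.log 2) := by
    have := mul_le_mul_of_nonneg_left hε1 hn0.le
    linarith
  have hx0 : 0 ≤ max 0 E := le_max_left _ _
  refine ⟨2 ^ j, d, hd.mono ?_ ?_, ?_⟩
  · rw [hN, add_zero]
    push_cast
    exact g3.trans (min_le_right _ _)
  · rw [add_zero]
    have e1 : n * (Rₑ * Real.log 2) - (c * max 0 E + n * (ε / 4))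
        ≤ N * max 0 (b * m * (E - ε₁)) := by
      have e2 : b * m * (max 0 E - ε₁) ≤ max 0 (b * m * (E - ε₁)) := by
        rcases le_total E 0 with hE | hE
        · rw [max_eq_left hE]
          refine le_trans ?_ (le_max_left _ _)
          have : 0 ≤ b * m * ε₁ := by positivity
          linarith
        · rw [max_eq_right hE]; exact le_max_right _ _
      refine le_trans ?_ (mul_le_mul_of_nonneg_left e2 (by positivity))
      have e3 : (N : ℝ) * (b * m * (max 0 E - ε₁)) = c * m * max 0 E - c * m * ε₁ := by
        rw [hN, hcr]; push_cast; ring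
      rw [e3]
      have e4 := mul_le_mul_of_nonneg_left h₂ hn0.le
      have e5 : c * m * ε₁ ≤ n * (ε / 4) :=
        mul_le_mul (by linarith) g2 hε₁.le hn0.le
      have e6 : n * max 0 E ≤ (c * m + c) * max 0 E := mul_le_mul_of_nonneg_right (by linarith) hx0
      linarith
    have e7 : n * (Rₑ * Real.log 2) - Real.log 2 ≤ j * Real.log 2 := by
      have := mul_le_mul_of_nonneg_left (mul_le_mul_of_nonneg_right h₁ hlog.le) hn0.le
      linarith
    have e8 : n * (Rₑ * Real.log 2) - (c * max 0 E + Real.log 2 + n * (ε / 4))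
        ≤ min (N * max 0 (b * m * (E - ε₁))) (Real.log ((2 ^ j : ℕ) : ℝ)) := by
      refine le_min (by linarith) ?_
      rw [Nat.cast_pow, Nat.cast_ofNat, Real.log_pow]
      have : 0 ≤ c * max 0 E := by positivity
      have : 0 ≤ n * (ε / 4) := by positivity
      linarith
    have e9 : 0 ≤ n * (ε / 4) := by positivity
    linarith
  · rw [Nat.cast_pow, Nat.cast_ofNat, Real.log_pow]
    have e1 : R₁ * (n * Real.log 2) = n * r := by rw [hr]; ring
    have e2 : 0 ≤ c * max 0 E := by positivity
    have e3 : 0 ≤ n * (ε / 4) := by positivity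
    rw [e1, abs_le]
    constructor <;> linarith

end AllLengths

/-! ### Single-letter informations -/

section Informations

theorem ind_and (P Q : Prop) : ind (P ∧ Q) = ind P * ind Q := by
  by_cases hP : P <;> by_cases hQ : Q <;> simp [ind, hP, hQ]

theorem avg_ind_eq_mul {α : Type*} [Fintype α] (p : Dist α) (a : α) (F : α → ℝ) :
    avg p (fun b => ind (b = a) * F b) = p a * F a := by
  simp [avg, ind]

theorem avg_ind_eq {α : Type*} [Fintype α] (p : Dist α) (a : α) :
    avg p (fun b => ind (b = a)) = p a := by
  simpa only [mul_one] using avg_ind_eq_mul p a fun _ => 1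

theorem map_eq_avg {α β : Type*} [Fintype α] [Fintype β] {p : Dist α} {f : α → β} {b : β}
    {F : α → ℝ} (h : ∀ a, ind (f a = b) = F a) : Dist.map p f b = avg p F :=
  congrArg (avg p) (funext h)

/-- Gibbs' inequality. -/
theorem avg_log_div_nonneg {α : Type*} [Fintype α] {p r : Dist α} (h : ∀ a, 0 < p a → 0 < r a) :
    0 ≤ avg p fun a => Real.log (p a / r a) := by
  have h1 : avg p (fun a => 1 - r a / p a) ≤ avg p fun a => Real.log (p a / r a) := by
    refine avg_le_avg_of_pos p fun a ha => ?_
    have := Real.log_le_sub_one_of_pos (div_pos (h a ha) ha)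
    rw [← inv_div (r a), Real.log_inv]
    linarith
  refine le_trans ?_ h1
  rw [avg_sub, avg_const, sub_nonneg, ← Dist.sum_eq_one r]
  refine Finset.sum_le_sum fun a _ => ?_
  by_cases ha : p a = 0
  · rw [ha, zero_mul]; exact Dist.nonneg r a
  · rw [mul_div_cancel₀ _ ha]

theorem avg_nonneg_of_pos {α : Type*} [Fintype α] (p : Dist α) {F : α → ℝ}
    (h : ∀ a, 0 < p a → 0 ≤ F a) : 0 ≤ avg p F := by
  rw [← avg_const p 0]
  exact avg_le_avg_of_pos p h

variable {X₁ X₂ Y Y₁ Y₂ V : Type*} [Fintype X₁] [Fintype X₂] [Fintype Y] [Fintype Y₁]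
  [Fintype Y₂] [Fintype V]

variable (W : Channel X₁ X₂ Y Y₁ Y₂) (p₁ : Dist X₁) (p₂ : Dist X₂) (q : Y₁ → X₂ → Dist V)

open Letter

/-- Fixing `X₂` pulls out its mass and leaves the conditional law, since the inputs are independent.
With `avg_letterDist_inputs` it yields most of the joint marginals needed below. -/
theorem avg_letterDist_relay (b : X₂) (F : X₁ → Y × Y₁ × Y₂ → V → ℝ) :
    avg (letterDist W p₁ p₂ q) (fun ω => ind (ω.2.1 = b) * F ω.1 ω.2.2.1 ω.2.2.2)
      = p₂ b * avg p₁ fun x₁ => avg (W x₁ b) fun o => avg (q o.2.1 b) fun v => F x₁ o v := by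
  rw [avg_letterDist, ← avg_const_mul]
  congr 1; funext x₁
  rw [← avg_ind_eq_mul p₂ b fun x₂ => avg (W x₁ x₂) fun o => avg (q o.2.1 x₂) fun v => F x₁ o v]
  simp only [avg_const_mul]

theorem avg_letterDist_inputs (a : X₁) (b : X₂) (F : Y × Y₁ × Y₂ → V → ℝ) :
    avg (letterDist W p₁ p₂ q) (fun ω => ind (ω.1 = a) * (ind (ω.2.1 = b) * F ω.2.2.1 ω.2.2.2))
      = p₁ a * (p₂ b * avg (W a b) fun o => avg (q o.2.1 b) fun v => F o v) := by
  have h := avg_letterDist_relay W p₁ p₂ q b fun x₁ o v => ind (x₁ = a) * F o v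
  simp only [avg_const_mul] at h
  rw [avg_ind_eq_mul p₁ a fun x₁ => avg (W x₁ b) fun o => avg (q o.2.1 b) fun v => F o v] at h
  rw [mul_left_comm, ← h]
  congr 1; funext ω
  rw [mul_left_comm]

theorem destKer_apply (x₂ : X₂) (y : Y) : destKer W p₁ x₂ y
    = avg p₁ fun x₁ => avg (W x₁ x₂) fun o => ind (o.1 = y) := avg_bind _ _ _

theorem srcKer_apply (x₁ : X₁) (x₂ : X₂) (v : V) (y : Y) : srcKer W q x₁ x₂ (v, y)
    = avg (W x₁ x₂) fun o => ind (o.1 = y) * q o.2.1 x₂ v := by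
  refine (avg_compProd _ _ _).trans ?_
  congr 1; funext o
  rw [← avg_ind_eq (q o.2.1 x₂) v, ← avg_const_mul]
  congr 1; funext v'
  rw [← ind_and]
  exact ind_congr (by simp [and_comm])

theorem map_x₂ (b : X₂) : Dist.map (letterDist W p₁ p₂ q) x₂ b = p₂ b := by
  refine (map_eq_avg fun ω => ?_).trans ((avg_letterDist_relay W p₁ p₂ q b fun _ _ _ => 1).trans ?_)
  · rw [mul_one]; rfl
  · simp only [avg_const, mul_one]

theorem map_x₁ (a : X₁) : Dist.map (letterDist W p₁ p₂ q) x₁ a = p₁ a := by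
  refine (map_eq_avg (F := fun ω : Letter X₁ X₂ Y Y₁ Y₂ V => ind (ω.1 = a))
    fun ω => rfl).trans ?_
  rw [avg_letterDist]
  simp only [avg_const, avg_ind_eq]

theorem map_x₁_x₂ (a : X₁) (b : X₂) :
    Dist.map (letterDist W p₁ p₂ q) (fun ω => (ω.x₁, ω.x₂)) (a, b) = p₁ a * p₂ b := by
  refine (map_eq_avg fun ω => ?_).trans
    ((avg_letterDist_inputs W p₁ p₂ q a b fun _ _ => 1).trans ?_)
  · rw [Prod.mk.injEq, ind_and, mul_one]; rfl
  · simp only [avg_const, mul_one]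

theorem map_x₂_x₁ (a : X₁) (b : X₂) :
    Dist.map (letterDist W p₁ p₂ q) (fun ω => (ω.x₂, ω.x₁)) (b, a) = p₁ a * p₂ b := by
  rw [← map_x₁_x₂ W p₁ p₂ q]
  exact map_eq_avg fun ω => ind_congr (by simp [and_comm])

theorem map_x₂_y (b : X₂) (y : Y) :
    Dist.map (letterDist W p₁ p₂ q) (fun ω => (ω.x₂, ω.y)) (b, y) = p₂ b * destKer W p₁ b y := by
  refine (map_eq_avg fun ω => ?_).trans
    ((avg_letterDist_relay W p₁ p₂ q b fun _ o _ => ind (o.1 = y)).trans ?_)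
  · rw [Prod.mk.injEq, ind_and]; rfl
  · simp only [avg_const, destKer_apply]

theorem map_y (t : Y) : Dist.map (letterDist W p₁ p₂ q) y t = destLaw W p₁ p₂ t := by
  refine (map_eq_avg (F := fun ω : Letter X₁ X₂ Y Y₁ Y₂ V => ind (ω.2.2.1.1 = t))
    fun ω => rfl).trans ?_
  rw [avg_letterDist, avg_comm]
  simp only [avg_const, ← destKer_apply]
  rfl

theorem map_x₂_y₂_x₁ (a : X₁) (b : X₂) (t : Y₂) :
    Dist.map (letterDist W p₁ p₂ q) (fun ω => (ω.x₂, (ω.y₂, ω.x₁))) (b, (t, a))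
      = p₁ a * (p₂ b * eveKer W a b t) := by
  refine (map_eq_avg fun ω => ?_).trans
    ((avg_letterDist_inputs W p₁ p₂ q a b fun o _ => ind (o.2.2 = t)).trans ?_)
  · rw [← ind_and, ← ind_and]
    refine ind_congr ?_
    simp only [Prod.mk.injEq, x₁, x₂, y₂]
    tauto
  · simp only [avg_const]; rfl

theorem map_inputs_y₂ (a : X₁) (b : X₂) (t : Y₂) :
    Dist.map (letterDist W p₁ p₂ q) (fun ω => ((ω.x₁, ω.x₂), ω.y₂)) ((a, b), t)
      = p₁ a * (p₂ b * eveKer W a b t) := by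
  rw [← map_x₂_y₂_x₁ W p₁ p₂ q]
  refine map_eq_avg fun ω => ind_congr ?_
  simp only [Prod.mk.injEq]
  tauto

theorem map_y₂_x₁ (a : X₁) (t : Y₂) :
    Dist.map (letterDist W p₁ p₂ q) (fun ω => (ω.y₂, ω.x₁)) (t, a)
      = p₁ a * eveKerSource W p₂ a t := by
  refine (map_eq_avg (F := fun ω : Letter X₁ X₂ Y Y₁ Y₂ V => ind (ω.1 = a) * ind (ω.2.2.1.2.2 = t))
    fun ω => ?_).trans ?_
  · rw [← ind_and]
    refine ind_congr ?_
    simp only [Prod.mk.injEq, x₁, y₂]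
    tauto
  · rw [avg_letterDist]
    simp only [avg_const, avg_const_mul]
    exact avg_ind_eq_mul p₁ a fun a => eveKerSource W p₂ a t

theorem map_y₂ (t : Y₂) : Dist.map (letterDist W p₁ p₂ q) y₂ t = eveLaw W p₁ p₂ t := by
  refine (map_eq_avg (F := fun ω : Letter X₁ X₂ Y Y₁ Y₂ V => ind (ω.2.2.1.2.2 = t))
    fun ω => rfl).trans ?_
  rw [avg_letterDist]
  simp only [avg_const]
  rfl

theorem map_x₁_source (a : X₁) (b : X₂) (v : V) (t : Y) :
    Dist.map (letterDist W p₁ p₂ q) (fun ω => (ω.x₁, ((ω.yHat, ω.y), ω.x₂))) (a, ((v, t), b))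
      = p₁ a * (p₂ b * srcKer W q a b (v, t)) := by
  refine (map_eq_avg fun ω => ?_).trans
    ((avg_letterDist_inputs W p₁ p₂ q a b fun o v' => ind (o.1 = t) * ind (v' = v)).trans ?_)
  · rw [← ind_and, ← ind_and, ← ind_and]
    refine ind_congr ?_
    simp only [Prod.mk.injEq, x₁, x₂, y, yHat]
    tauto
  · simp only [avg_const_mul, avg_ind_eq, srcKer_apply]

theorem map_source (b : X₂) (v : V) (t : Y) :
    Dist.map (letterDist W p₁ p₂ q) (fun ω => ((ω.yHat, ω.y), ω.x₂)) ((v, t), b)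
      = p₂ b * srcLaw W p₁ q b (v, t) := by
  refine (map_eq_avg fun ω => ?_).trans
    ((avg_letterDist_relay W p₁ p₂ q b fun _ o v' => ind (o.1 = t) * ind (v' = v)).trans ?_)
  · rw [← ind_and, ← ind_and]
    refine ind_congr ?_
    simp only [Prod.mk.injEq, x₂, y, yHat]
    tauto
  · simp only [avg_const_mul, avg_ind_eq, ← srcKer_apply]
    rfl

theorem map_y₁_x₂ (b : X₂) (t : Y₁) :
    Dist.map (letterDist W p₁ p₂ q) (fun ω => (ω.y₁, ω.x₂)) (t, b)
      = p₂ b * relayLaw W p₁ b t := by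
  refine (map_eq_avg fun ω => ?_).trans
    ((avg_letterDist_relay W p₁ p₂ q b fun _ o _ => ind (o.2.1 = t)).trans ?_)
  · rw [← ind_and]
    refine ind_congr ?_
    simp only [Prod.mk.injEq, x₂, y₁]
    tauto
  · simp only [avg_const, relayLaw_apply]

theorem map_y₁_yHat_x₂ (b : X₂) (t : Y₁) (v : V) :
    Dist.map (letterDist W p₁ p₂ q) (fun ω => (ω.y₁, (ω.yHat, ω.x₂))) (t, (v, b))
      = p₂ b * (relayLaw W p₁ b t * q t b v) := by
  refine (map_eq_avg fun ω => ?_).trans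
    ((avg_letterDist_relay W p₁ p₂ q b fun _ o v' => ind (o.2.1 = t) * ind (v' = v)).trans ?_)
  · rw [← ind_and, ← ind_and]
    refine ind_congr ?_
    simp only [Prod.mk.injEq, x₂, y₁, yHat]
    tauto
  · simp only [avg_const_mul, avg_ind_eq]
    rw [← avg_relayLaw W p₁ b fun t' => ind (t' = t) * q t' b v,
      avg_ind_eq_mul _ t fun t' => q t' b v]

theorem map_yHat_x₂ (b : X₂) (v : V) :
    Dist.map (letterDist W p₁ p₂ q) (fun ω => (ω.yHat, ω.x₂)) (v, b)
      = p₂ b * compLaw W p₁ q b v := by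
  refine (map_eq_avg fun ω => ?_).trans
    ((avg_letterDist_relay W p₁ p₂ q b fun _ o v' => ind (v' = v)).trans ?_)
  · rw [← ind_and]
    refine ind_congr ?_
    simp only [Prod.mk.injEq, x₂, yHat]
    tauto
  · simp only [avg_ind_eq, compLaw_apply]

theorem neg_log_sub_neg_log {A B C : ℝ} (hA : 0 < A) (hB : 0 < B) (h : B / A = C) :
    -Real.log A - -Real.log B = Real.log C := by
  rw [← h, Real.log_div hB.ne' hA.ne']; ring

theorem letterProb_eq : letterProb W p₁ p₂ q = letterDist W p₁ p₂ q :=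
  funext fun ω => (letterDist_apply W p₁ p₂ q ω).symm

theorem mutualInfo_dest :
    mutualInfo (letterProb W p₁ p₂ q) x₂ y = infoDest W p₁ p₂ q / Real.log 2 := by
  rw [letterProb_eq, mutualInfo, entropy_eq_avg, condEntropy_eq_avg, ← sub_div, ← avg_sub]
  congr 1
  refine avg_congr_of_pos _ fun ω h => ?_
  have hp := letterDist_pos h
  have h1 := destKer_pos h
  have h2 := destLaw_pos h
  have h3 : 0 < p₂ ω.x₂ := hp.2.1
  rw [map_x₂, map_x₂_y, map_y]
  exact neg_log_sub_neg_log h3 (by positivity) (by field_simp)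

theorem mutualInfo_leak : mutualInfo (letterProb W p₁ p₂ q) (fun ω => (ω.x₁, ω.x₂)) y₂
    = infoLeak W p₁ p₂ q / Real.log 2 := by
  rw [letterProb_eq, mutualInfo, entropy_eq_avg, condEntropy_eq_avg, ← sub_div, ← avg_sub]
  congr 1
  refine avg_congr_of_pos _ fun ω h => ?_
  have hp := letterDist_pos h
  have h1 := eveKer_pos h
  have h2 := eveLaw_pos h
  have h3 : 0 < p₂ ω.x₂ := hp.2.1
  have h4 : 0 < p₁ ω.x₁ := hp.1
  rw [map_x₁_x₂, map_inputs_y₂, map_y₂]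
  exact neg_log_sub_neg_log (by positivity) (by positivity) (by field_simp)

theorem condMutualInfo_eve : condMutualInfo (letterProb W p₁ p₂ q) x₂ y₂ x₁
    = infoEve W p₁ p₂ q / Real.log 2 := by
  rw [letterProb_eq, condMutualInfo, condEntropy_eq_avg, condEntropy_eq_avg, ← sub_div, ← avg_sub]
  congr 1
  refine avg_congr_of_pos _ fun ω h => ?_
  have hp := letterDist_pos h
  have h1 := eveKer_pos h
  have h2 := eveKerSource_pos h
  have h3 : 0 < p₂ ω.x₂ := hp.2.1
  have h4 : 0 < p₁ ω.x₁ := hp.1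
  rw [map_x₂_x₁, map_x₁, map_x₂_y₂_x₁, map_y₂_x₁]
  exact neg_log_sub_neg_log (by positivity) (by positivity) (by field_simp)

theorem condMutualInfo_source :
    condMutualInfo (letterProb W p₁ p₂ q) x₁ (fun ω => (ω.yHat, ω.y)) x₂
      = infoSource W p₁ p₂ q / Real.log 2 := by
  rw [letterProb_eq, condMutualInfo, condEntropy_eq_avg, condEntropy_eq_avg, ← sub_div, ← avg_sub]
  congr 1
  refine avg_congr_of_pos _ fun ω h => ?_
  have hp := letterDist_pos h
  have h1 := srcKer_pos h
  have h2 := srcLaw_pos h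
  have h3 : 0 < p₂ ω.x₂ := hp.2.1
  have h4 : 0 < p₁ ω.x₁ := hp.1
  rw [map_x₁_x₂, map_x₂, map_x₁_source, map_source]
  exact neg_log_sub_neg_log (by positivity) (by positivity) (by field_simp)

theorem condMutualInfo_comp : condMutualInfo (letterProb W p₁ p₂ q) y₁ yHat x₂
    = infoComp W p₁ p₂ q / Real.log 2 := by
  rw [letterProb_eq, condMutualInfo, condEntropy_eq_avg, condEntropy_eq_avg, ← sub_div, ← avg_sub]
  congr 1
  refine avg_congr_of_pos _ fun ω h => ?_
  have hp := letterDist_pos h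
  have h1 : 0 < q ω.y₁ ω.x₂ ω.yHat := hp.2.2.2
  have h2 := compLaw_pos h
  have h3 : 0 < p₂ ω.x₂ := hp.2.1
  have h4 : 0 < relayLaw W p₁ ω.x₂ ω.y₁ := Dist.map_pos (fun o : Y × Y₁ × Y₂ => o.2.1)
    (Dist.bind_pos (k := fun x₁ => W x₁ ω.2.1) hp.1 hp.2.2.1)
  rw [map_y₁_x₂, map_x₂, map_y₁_yHat_x₂, map_yHat_x₂]
  exact neg_log_sub_neg_log (by positivity) (by positivity) (by field_simp)

end Informations

/-! ### Changing the test channel -/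

section TestChannel

variable {X₁ X₂ Y Y₁ Y₂ V V' : Type*} [Fintype X₁] [Fintype X₂] [Fintype Y] [Fintype Y₁]
  [Fintype Y₂] [Fintype V] [Fintype V']

variable (W : Channel X₁ X₂ Y Y₁ Y₂) (p₁ : Dist X₁) (p₂ : Dist X₂) (q : Y₁ → X₂ → Dist V)
  (q' : Y₁ → X₂ → Dist V')

open Letter

/-- `Ŷ₁` does not enter this information or the next two, so the test channel may be altered freely.
-/
theorem infoDest_congr : infoDest W p₁ p₂ q = infoDest W p₁ p₂ q' := by
  simp only [infoDest, avg_letterDist, y, x₂, avg_const]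

theorem infoEve_congr : infoEve W p₁ p₂ q = infoEve W p₁ p₂ q' := by
  simp only [infoEve, avg_letterDist, y₂, x₁, x₂, avg_const]

theorem infoLeak_congr : infoLeak W p₁ p₂ q = infoLeak W p₁ p₂ q' := by
  simp only [infoLeak, avg_letterDist, y₂, x₁, x₂, avg_const]

theorem infoComp_nonneg : 0 ≤ infoComp W p₁ p₂ q := by
  rw [infoComp, avg_letterDist]
  refine avg_nonneg_of_pos _ fun x₁ h₁ => avg_nonneg_of_pos _ fun x₂ h₂ =>
    avg_nonneg_of_pos _ fun o ho => ?_
  refine avg_log_div_nonneg (p := q o.2.1 x₂) (r := compLaw W p₁ q x₂) fun v hv => ?_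
  exact compLaw_pos (W := W) (p₁ := p₁) (p₂ := p₂) (q := q) (ω := (x₁, x₂, o, v))
    (mul_pos h₁ (mul_pos h₂ (mul_pos ho hv)))

/-- The law of `Y` given both inputs. -/
def directKer (x₁ : X₁) (x₂ : X₂) : Dist Y := Dist.map (W x₁ x₂) fun o => o.1

/-- `I(X₁; Y | X₂)` in nats. -/
def infoDirect : ℝ := avg p₁ fun x₁ => avg p₂ fun x₂ => avg (W x₁ x₂) fun o =>
  Real.log (directKer W x₁ x₂ o.1 / destKer W p₁ x₂ o.1)

variable {W p₁} in
theorem destKer_pos_of_directKer_pos {x₁ : X₁} {x₂ : X₂} {t : Y} (h₁ : 0 < p₁ x₁)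
    (h : 0 < directKer W x₁ x₂ t) : 0 < destKer W p₁ x₂ t := by
  rw [destKer_apply]
  exact avg_pos (fun x₁ => Dist.nonneg (directKer W x₁ x₂) t) h₁ h

theorem infoDirect_nonneg : 0 ≤ infoDirect W p₁ p₂ := by
  refine avg_nonneg_of_pos _ fun x₁ h₁ => avg_nonneg _ fun x₂ => ?_
  rw [← avg_map (W x₁ x₂) (fun o => o.1) fun t =>
    Real.log (directKer W x₁ x₂ t / destKer W p₁ x₂ t)]
  exact avg_log_div_nonneg (p := directKer W x₁ x₂) fun t => destKer_pos_of_directKer_pos h₁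

theorem srcLaw_apply (x₂ : X₂) (v : V) (t : Y) : srcLaw W p₁ q x₂ (v, t)
    = avg p₁ fun x₁ => srcKer W q x₁ x₂ (v, t) := rfl

theorem destKer_eq (x₂ : X₂) (t : Y) : destKer W p₁ x₂ t
    = avg p₁ fun x₁ => directKer W x₁ x₂ t := destKer_apply W p₁ x₂ t

theorem infoSource_eq_infoDirect [Unique V] : infoSource W p₁ p₂ q = infoDirect W p₁ p₂ := by
  have h1 : ∀ (p : Dist V) (v : V), p v = 1 := by
    intro p v
    rw [← Dist.sum_eq_one p, Fintype.sum_unique, Subsingleton.elim v default]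
  have h2 : ∀ x₁ x₂ v t, srcKer W q x₁ x₂ (v, t) = directKer W x₁ x₂ t := by
    intro x₁ x₂ v t
    simp only [srcKer_apply, h1, mul_one]
    rfl
  simp only [infoSource, infoDirect, avg_letterDist, srcLaw_apply, h2, ← destKer_eq, avg_const,
    Letter.x₁, Letter.x₂, Letter.y]

/-- The law `p`, erased with probability `δ`. -/
def erased (p : Dist V) {δ : ℝ} (h₀ : 0 ≤ δ) (h₁ : δ ≤ 1) : Dist (Option V) :=
  Dist.mk (fun o => o.elim δ fun v => (1 - δ) * p v)
    (fun o => by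
      cases o with
      | none => exact h₀
      | some v => exact mul_nonneg (by linarith) (Dist.nonneg p v))
    (by
      rw [Fintype.sum_option]
      simp only [Option.elim, ← Finset.mul_sum, Dist.sum_eq_one]
      ring)

variable {δ : ℝ} (h₀ : 0 ≤ δ) (h₁ : δ ≤ 1)

theorem avg_erased (p : Dist V) (F : Option V → ℝ) :
    avg (erased p h₀ h₁) F = δ * F none + (1 - δ) * avg p fun v => F (some v) := by
  rw [avg, Fintype.sum_option, avg, Finset.mul_sum]
  simp only [← mul_assoc]
  rfl

/-- Erasure is independent of everything else: an erased symbol informs of nothing, and otherwise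
the factors `1 - δ` cancel in the ratio. -/
theorem infoComp_erased (h : δ < 1) : infoComp W p₁ p₂ (fun t x => erased (q t x) h₀ h₁)
    = (1 - δ) * infoComp W p₁ p₂ q := by
  have h1 : ∀ x v, compLaw W p₁ (fun t x => erased (q t x) h₀ h₁) x (some v)
      = (1 - δ) * compLaw W p₁ q x v := by
    intro x v
    simp only [compLaw_apply, ← avg_const_mul]
    rfl
  have h2 : ∀ x, compLaw W p₁ (fun t x => erased (q t x) h₀ h₁) x none = δ := by
    intro x
    rw [compLaw_apply]
    exact (congrArg (avg p₁) (funext fun _ => avg_const _ δ)).trans (avg_const _ δ)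
  have h3 : Real.log (δ / δ) = 0 := by
    by_cases hδ : δ = 0
    · simp [hδ]
    · rw [div_self hδ, Real.log_one]
  simp only [infoComp, avg_letterDist, avg_erased, Letter.y₁, Letter.x₂, Letter.yHat, h1, h2]
  have h4 : ∀ t x v, erased (q t x) h₀ h₁ (some v) = (1 - δ) * q t x v := fun _ _ _ => rfl
  have h5 : ∀ t x, erased (q t x) h₀ h₁ none = δ := fun _ _ => rfl
  simp only [h4, h5, h3, mul_zero, zero_add, avg_const_mul,
    mul_div_mul_left _ _ (show 1 - δ ≠ 0 by linarith)]

/-- When `Ŷ₁` is erased the destination is left with the direct link; otherwise nothing changes. -/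
theorem infoSource_erased (h : δ < 1) (h' : 0 < δ) :
    infoSource W p₁ p₂ (fun t x => erased (q t x) h₀ h₁)
      = δ * infoDirect W p₁ p₂ + (1 - δ) * infoSource W p₁ p₂ q := by
  have h1 : ∀ x₁ x₂ v t, srcKer W (fun t x => erased (q t x) h₀ h₁) x₁ x₂ (some v, t)
      = (1 - δ) * srcKer W q x₁ x₂ (v, t) := by
    intro x₁ x₂ v t
    simp only [srcKer_apply, ← avg_const_mul]
    congr 1; funext o
    exact mul_left_comm _ _ _
  have h2 : ∀ x₁ x₂ t, srcKer W (fun t x => erased (q t x) h₀ h₁) x₁ x₂ (none, t)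
      = δ * directKer W x₁ x₂ t := by
    intro x₁ x₂ t
    rw [srcKer_apply, mul_comm δ]
    exact avg_mul_const _ _ _
  simp only [infoSource, infoDirect, avg_letterDist, avg_erased, Letter.x₁, Letter.x₂, Letter.y,
    Letter.yHat, srcLaw_apply, h1, h2, avg_const_mul, avg_add, ← destKer_eq,
    mul_div_mul_left _ _ (show 1 - δ ≠ 0 by linarith), mul_div_mul_left _ _ h'.ne']

theorem avg_mul_div_le (p : Dist V) {F : V → ℝ} (hF : ∀ v, 0 ≤ F v) :
    avg p (fun v => F v / p v) ≤ ∑ v, F v := by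
  refine Finset.sum_le_sum fun v _ => ?_
  by_cases h : p v = 0
  · rw [h, zero_mul]; exact hF v
  · rw [mul_div_cancel₀ _ h]

/-- `I(X₁; Ŷ₁, Y | X₂) ≤ I(X₁; Y | X₂) + I(Y₁; Ŷ₁ | X₂)`. -/
theorem infoSource_le : infoSource W p₁ p₂ q ≤ infoDirect W p₁ p₂ + infoComp W p₁ p₂ q := by
  have h1 : infoDirect W p₁ p₂ = avg (letterDist W p₁ p₂ q) fun ω =>
      Real.log (directKer W ω.x₁ ω.x₂ ω.y / destKer W p₁ ω.x₂ ω.y) := by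
    simp only [infoDirect, avg_letterDist, avg_const, Letter.x₁, Letter.x₂, Letter.y]
  -- The logarithm of `A / q` is the source density minus the direct and compression densities. Its
  -- mean is at most 1: `q` cancels on summing over `v`, `directKer` on summing over `t`, and the
  -- mean over `x₁` turns `srcKer` into `srcLaw`.
  set A : X₁ → X₂ → Y → V → ℝ := fun x₁ x₂ t v =>
    srcKer W q x₁ x₂ (v, t) / srcLaw W p₁ q x₂ (v, t) * destKer W p₁ x₂ t * compLaw W p₁ q x₂ v
      / directKer W x₁ x₂ t with hA
  have hA0 : ∀ x₁ x₂ t v, 0 ≤ A x₁ x₂ t v := fun x₁ x₂ t v =>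
    div_nonneg (mul_nonneg (mul_nonneg (div_nonneg (Dist.nonneg _ _) (Dist.nonneg _ _))
      (Dist.nonneg _ _)) (Dist.nonneg _ _)) (Dist.nonneg _ _)
  have h2 : infoSource W p₁ p₂ q - infoDirect W p₁ p₂ - infoComp W p₁ p₂ q
      ≤ avg (letterDist W p₁ p₂ q) fun ω => A ω.x₁ ω.x₂ ω.y ω.yHat / q ω.y₁ ω.x₂ ω.yHat - 1 := by
    rw [h1, infoSource, infoComp, ← avg_sub, ← avg_sub]
    refine avg_le_avg_of_pos _ fun ω h => ?_
    have g1 := srcKer_pos h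
    have g2 := srcLaw_pos h
    have g3 := destKer_pos h
    have g4 := compLaw_pos h
    have g5 : 0 < directKer W ω.x₁ ω.x₂ ω.y :=
      Dist.map_pos (fun o : Y × Y₁ × Y₂ => o.1) (letterDist_pos h).2.2.1
    have g6 : 0 < q ω.y₁ ω.x₂ ω.yHat := (letterDist_pos h).2.2.2
    have g7 : 0 < A ω.x₁ ω.x₂ ω.y ω.yHat := by rw [hA]; positivity
    refine le_trans (le_of_eq ?_) (Real.log_le_sub_one_of_pos (div_pos g7 g6))
    rw [hA]
    dsimp only
    rw [Real.log_div (by positivity) g6.ne', Real.log_div (by positivity) g5.ne',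
      Real.log_mul (by positivity) g4.ne', Real.log_mul (by positivity) g3.ne',
      Real.log_div g5.ne' g3.ne', Real.log_div g6.ne' g4.ne']
    ring
  have h3 : avg (letterDist W p₁ p₂ q) (fun ω => A ω.x₁ ω.x₂ ω.y ω.yHat / q ω.y₁ ω.x₂ ω.yHat)
      ≤ 1 := by
    rw [avg_letterDist, avg_comm, ← avg_const p₂ 1]
    refine avg_le_avg _ fun x₂ => ?_
    calc _ ≤ avg p₁ (fun x₁ => avg (W x₁ x₂) fun o => ∑ v, A x₁ x₂ o.1 v) :=
          avg_le_avg _ fun x₁ => avg_le_avg _ fun o =>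
            avg_mul_div_le (q o.2.1 x₂) (hA0 x₁ x₂ o.1)
      _ = avg p₁ (fun x₁ => avg (directKer W x₁ x₂) fun t => ∑ v, A x₁ x₂ t v) := by
          congr 1; funext x₁
          exact (avg_map (W x₁ x₂) (fun o => o.1) fun t => ∑ v, A x₁ x₂ t v).symm
      _ ≤ avg p₁ (fun x₁ => ∑ t, ∑ v, srcKer W q x₁ x₂ (v, t) / srcLaw W p₁ q x₂ (v, t) *
            destKer W p₁ x₂ t * compLaw W p₁ q x₂ v) := by
          refine avg_le_avg _ fun x₁ => ?_
          simp only [hA, ← Finset.sum_div]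
          exact avg_mul_div_le _ fun t => Finset.sum_nonneg fun v _ =>
            mul_nonneg (mul_nonneg (div_nonneg (Dist.nonneg _ _) (Dist.nonneg _ _))
              (Dist.nonneg _ _)) (Dist.nonneg _ _)
      _ = ∑ t, ∑ v, srcLaw W p₁ q x₂ (v, t) / srcLaw W p₁ q x₂ (v, t) *
            destKer W p₁ x₂ t * compLaw W p₁ q x₂ v := by
          simp only [avg_sum, avg_mul_const, div_eq_mul_inv, ← srcLaw_apply]
      _ ≤ ∑ t, ∑ v, destKer W p₁ x₂ t * compLaw W p₁ q x₂ v := by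
          refine Finset.sum_le_sum fun t _ => Finset.sum_le_sum fun v _ => ?_
          refine mul_le_mul_of_nonneg_right ?_ (Dist.nonneg _ _)
          exact mul_le_of_le_one_left (Dist.nonneg _ _) (div_self_le_one _)
      _ = 1 := by
          simp only [← Finset.mul_sum, Dist.sum_eq_one, mul_one]
  rw [avg_sub, avg_const] at h2
  linarith

end TestChannel

/-! ### Achievability of the region -/

section Region

variable {X₁ X₂ Y Y₁ Y₂ V : Type*} [Fintype X₁] [Fintype X₂] [Fintype Y] [Fintype Y₁]
  [Fintype Y₂] [Fintype V] {W : Channel X₁ X₂ Y Y₁ Y₂} {p₁ : Dist X₁} {p₂ : Dist X₂}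
  {R₁ Rₑ : ℝ}

/-- The strict inequalities leave room for a block rate `ρ` slightly below `S`. -/
theorem achievable_of_blockCodes (p₁ : Dist X₁) (p₂ : Dist X₂) {S D : ℝ} (hR : 0 ≤ R₁)
    (h₁ : R₁ * Real.log 2 < S) (h₂ : Rₑ ≤ R₁) (h₃ : Rₑ * Real.log 2 < max 0 (S + D))
    (H : ∀ ρ, 0 ≤ ρ → ρ < S → BlockCodes W ρ (ρ + D)) : Achievable W R₁ Rₑ := by
  have hlog : 0 < Real.log 2 := Real.log_pos (by norm_num)
  obtain ⟨x₁⟩ := Dist.nonempty p₁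
  obtain ⟨x₂⟩ := Dist.nonempty p₂
  obtain ⟨ρ, g1, g2⟩ := exists_between (show max (R₁ * Real.log 2)
    (S - (max 0 (S + D) - Rₑ * Real.log 2)) < S from max_lt h₁ (by linarith))
  obtain ⟨g1, g3⟩ := max_lt_iff.1 g1
  refine (H ρ ((mul_nonneg hR hlog.le).trans g1.le) g2).achievable x₁ x₂ hR g1 h₂ ?_
  rcases le_total (S + D) 0 with h | h
  · rw [max_eq_left h] at h₃
    exact h₃.le.trans (le_max_left _ _)
  · rw [max_eq_right h] at g3
    exact le_trans (by linarith) (le_max_right _ _)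

theorem achievable_of_lt {q : Y₁ → X₂ → Dist V} {R₀ : ℝ} (hR₀ : 0 ≤ R₀)
    (hd : R₀ + infoComp W p₁ p₂ q < infoDest W p₁ p₂ q)
    (he : R₀ + infoComp W p₁ p₂ q < infoEve W p₁ p₂ q) (hR : 0 ≤ R₁)
    (h₁ : R₁ * Real.log 2 < infoSource W p₁ p₂ q) (h₂ : Rₑ ≤ R₁)
    (h₃ : Rₑ * Real.log 2 < max 0 (R₀ + infoSource W p₁ p₂ q - infoLeak W p₁ p₂ q)) :
    Achievable W R₁ Rₑ := by
  refine achievable_of_blockCodes p₁ p₂ (D := R₀ - infoLeak W p₁ p₂ q) hR h₁ h₂ ?_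
    fun ρ hρ hρ' => ?_
  · rwa [← add_sub_assoc, add_comm (infoSource W p₁ p₂ q)]
  · rw [← add_sub_assoc]
    exact blockCodes_of_lt hρ hR₀ hρ' (infoComp_nonneg W p₁ p₂ q) hd he

/-- Only the constraint on the relay rate is non-strict. The other inequalities have slack, part of
which is traded for a margin there. -/
theorem achievable_of_satisfiesCF {q : Y₁ → X₂ → Dist V} {R₀ : ℝ} (hR₀ : 0 ≤ R₀) (hR : 0 ≤ R₁)
    (h : SatisfiesCF (letterProb W p₁ p₂ q) R₀ R₁ Rₑ) : Achievable W R₁ Rₑ := by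
  have hlog : 0 < Real.log 2 := Real.log_pos (by norm_num)
  rw [SatisfiesCF, mutualInfo_dest, mutualInfo_leak, condMutualInfo_eve, condMutualInfo_source,
    condMutualInfo_comp] at h
  obtain ⟨h1, h2, h3, h4⟩ := h
  rw [lt_div_iff₀ hlog] at h2
  rw [ge_iff_le, le_sub_iff_add_le, le_min_iff, le_div_iff₀ hlog, le_div_iff₀ hlog, add_mul,
    div_mul_cancel₀ _ hlog.ne', add_comm] at h1
  replace h4 : Rₑ * Real.log 2 <
      max 0 (R₀ * Real.log 2 + infoSource W p₁ p₂ q - infoLeak W p₁ p₂ q) := by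
    have := mul_lt_mul_of_pos_right h4 hlog
    rwa [max_mul_of_nonneg _ _ hlog.le, zero_mul, sub_mul, add_mul, div_mul_cancel₀ _ hlog.ne',
      div_mul_cancel₀ _ hlog.ne'] at this
  obtain ⟨hd, he⟩ := h1
  have hS : 0 < infoSource W p₁ p₂ q := lt_of_le_of_lt (by positivity) h2
  have hC := infoComp_nonneg W p₁ p₂ q
  rcases hR₀.eq_or_lt with h0 | h0
  · rw [← h0, zero_mul, zero_add] at hd he h4
    rcases hC.eq_or_lt with hC0 | hC0
    -- The constraint may read `0 ≥ 0`. By `infoSource_le` a worthless description does not help, so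
    -- the direct link alone supports the rate, with a single relay index that needs no margin.
    · have q₀ : Y₁ → X₂ → Dist Unit := fun _ _ => Dist.unif Unit
      have hle := infoSource_le W p₁ p₂ q
      rw [← hC0, add_zero] at hle
      refine achievable_of_blockCodes p₁ p₂ (S := infoDirect W p₁ p₂)
        (D := -infoLeak W p₁ p₂ q₀) hR (h2.trans_le hle) h3.le (h4.trans_le ?_)
        fun ρ hρ hρ' => ?_
      · rw [infoLeak_congr W p₁ p₂ q₀ q]
        exact max_le_max_left _ (by linarith)
      · rw [← sub_eq_add_neg]
        exact blockCodes_of_unique hρ (by rwa [infoSource_eq_infoDirect])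
    · set g := min (infoSource W p₁ p₂ q - R₁ * Real.log 2)
        (max 0 (infoSource W p₁ p₂ q - infoLeak W p₁ p₂ q) - Rₑ * Real.log 2) with hg
      have hg0 : 0 < g := lt_min (by linarith) (by linarith)
      -- Erasing `Ŷ₁` with probability `δ` makes the positive compression rate strictly smaller,
      -- while the source information drops by less than the slack `g`.
      obtain ⟨δ, hδ0, hδ⟩ := exists_between (show 0 < min 1 (g / infoSource W p₁ p₂ q) from
        lt_min one_pos (div_pos hg0 hS))
      obtain ⟨hδ1, hδg⟩ := lt_min_iff.1 hδ
      rw [lt_div_iff₀ hS] at hδg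
      have hδg1 := hδg.trans_le (min_le_left _ _)
      have hδg2 := hδg.trans_le (min_le_right _ _)
      have hD := mul_nonneg hδ0.le (infoDirect_nonneg W p₁ p₂)
      have hCδ := mul_pos hδ0 hC0
      refine achievable_of_lt (q := fun t x => erased (q t x) hδ0.le hδ1.le) (p₁ := p₁) (p₂ := p₂)
        le_rfl ?_ ?_ hR ?_ h3.le ?_
      · rw [infoComp_erased W p₁ p₂ q _ _ hδ1, infoDest_congr W p₁ p₂ _ q]; linarith
      · rw [infoComp_erased W p₁ p₂ q _ _ hδ1, infoEve_congr W p₁ p₂ _ q]; linarith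
      · rw [infoSource_erased W p₁ p₂ q _ _ hδ1 hδ0]; linarith
      · rw [infoSource_erased W p₁ p₂ q _ _ hδ1 hδ0, infoLeak_congr W p₁ p₂ _ q]
        rcases le_total (infoSource W p₁ p₂ q - infoLeak W p₁ p₂ q) 0 with h | h
        · rw [max_eq_left h] at h4
          exact lt_max_of_lt_left h4
        · rw [max_eq_right h] at hδg2
          exact lt_max_of_lt_right (by linarith)
  · have h0' : 0 < R₀ * Real.log 2 := by positivity
    -- A slightly smaller noise rate creates the margin; the bound on the equivocation is strict and
    -- tolerates it.
    obtain ⟨R, g1, g2⟩ := exists_between (show max 0 (R₀ * Real.log 2 -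
      (max 0 (R₀ * Real.log 2 + infoSource W p₁ p₂ q - infoLeak W p₁ p₂ q) - Rₑ * Real.log 2))
        < R₀ * Real.log 2 from max_lt h0' (by linarith))
    obtain ⟨g1, g3⟩ := max_lt_iff.1 g1
    refine achievable_of_lt (q := q) (p₁ := p₁) (p₂ := p₂) g1.le (by linarith) (by linarith) hR h2
      h3.le ?_
    rcases le_total (R₀ * Real.log 2 + infoSource W p₁ p₂ q - infoLeak W p₁ p₂ q) 0 with h | h
    · rw [max_eq_left h] at h4
      exact lt_max_of_lt_left h4
    · rw [max_eq_right h] at g3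
      exact lt_max_of_lt_right (by linarith)

end Region

end RelayEavesdropper

end

open RelayEavesdropper in
theorem theorem4 {X₁ X₂ Y Y₁ Y₂ : Type*} [Fintype X₁] [Fintype X₂] [Fintype Y] [Fintype Y₁]
    [Fintype Y₂] (W : Channel X₁ X₂ Y Y₁ Y₂) :
    ∀ r ∈ closure (convexHull ℝ (cfRegion W)), Achievable W r.1 r.2 := by
  have h : cfRegion W ⊆ {r : ℝ × ℝ | Achievable W r.1 r.2} := by
    rintro r ⟨hr, p₁, p₂, k, q, R₀, hR₀, h⟩
    exact achievable_of_satisfiesCF hR₀ hr h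
  exact fun r hr =>
    closure_minimal (convexHull_min h (convex_achievable W)) (isClosed_achievable W) hr
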